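/- **Theorem (Symmetry Theorem, generating series form).** Write $\underline{e}(x)=\exp(2\pi \mathrm{i}x)$. For integers $n_1,\dots,n_d\ge 1$ and signs $\varepsilon_1,\dots,\varepsilon_d\in\mathbb{C}$, $|\varepsilon_i|=1$, put $$\zeta\Big({\varepsilon_1,\dots,\varepsilon_d\atop n_1,\dots,n_d}\Big)=\lim_{M\to\infty}\sum_{0<k_1<\cdots<k_d\le M}\prod_{i=1}^d\frac{\varepsilon_i^{k_i}}{k_i^{n_i}},\qquad t\Big({\varepsilon_1,\dots,\varepsilon_d\atop n_1,\dots,n_d}\Big)=\lim_{M\to\infty}\sum_{0<k_1<\cdots<k_d\le M}\prod_{i=1}^d\frac{\varepsilon_i^{k_i}}{(2k_i-1)^{n_i}};$$ these limits exist whenever $d=0$ or $(\varepsilon_d,n_d)\ne(1,1)$. For arbitrary words of letters $(\varepsilon,n)$ let $\mathrm{reg}_T\zeta$ and $\mathrm{reg}_T t$ denote the stuffle regularizations: the polynomials in $T$ that equal the values above for words not ending in $(1,1)$ and that are determined for all words by the recursion obtained from the stuffle product with the one-letter word $(1,1)$, whose value is declared to be $T$: if $w=u\cdot(1,1)$ ends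 in exactly $k\ge1$ letters $(1,1)$, then $$\mathrm{reg}_T\,w=\frac1k\Big(T\cdot\mathrm{reg}_T\,u-\sum_{w'}\mathrm{reg}_T\,w'\Big),$$ where $w'$ runs with multiplicity over the terms of the stuffle product $u*(1,1)$ that end in fewer than $k$ letters $(1,1)$. For $\phi_1,\dots,\phi_d\in\mathbb{R}$ define the formal power series $$\mathcal{L}i_{T}(\phi_1,\dots,\phi_d\mid y_1,\dots,y_d)=\sum_{n_1,\dots,n_d\ge1}\mathrm{reg}_T\,\zeta\Big({\underline{e}(\phi_1),\dots,\underline{e}(\phi_d)\atop n_1,\dots,n_d}\Big)y_1^{n_1-1}\cdots y_d^{n_d-1},$$ define $\mathcal{L}i^t_{T}$ in the same way from $\mathrm{reg}_T\,t$ (both series are $1$ for $d=0$), and let $$B^t_{T}(\phi\mid y)=\mathcal{L}i^t_{T}(\phi\mid y)-\underline{e}(\phi)\,\mathcal{L}i^t_{T}(-\phi\mid-y)$$ be the regularization of the depth one $t$-Bernoulli series $\sum_{k\in\mathbb{Z}}\underline{e}(\phi k)/(2k-1-y)$. Put $y_{i,j}=y_i-y_j$. Then for every $m$ and all $\phi_1,\dots,\phi_m\in\mathbb{R}$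 the following identity of formal power series in $y_1,\dots,y_m$ holds: $$\begin{aligned}&\sum_{j=0}^m(-1)^j\,\underline{e}(\phi_1+\cdots+\phi_j)\,\mathcal{L}i^t_{T=\log 2}(\phi_{j+1},\dots,\phi_m\mid y_{j+1},\dots,y_m)\,\mathcal{L}i^t_{T=\log2}(-\phi_j,\dots,-\phi_1\mid -y_j,\dots,-y_1)\\ &-\frac1{2^{m-1}}\sum_{j=1}^m(-1)^{j-1}\mathcal{L}i_{T=0}(-\phi_{j-1},\dots,-\phi_1\mid\tfrac12y_{j,j-1},\dots,\tfrac12y_{j,1})\,B^t_{T=\log2}(\phi_1+\cdots+\phi_m\mid y_j)\,\mathcal{L}i_{T=0}(\phi_{j+1},\dots,\phi_m\mid\tfrac12y_{j+1,j},\dots,\tfrac12y_{m,j})\\ &=\begin{cases}\dfrac1{m!}\Big(\dfrac{\mathrm{i}\pi}2\Big)^m&\text{if all }\phi_i\in\mathbb{Z}\text{ and }m\text{ is even},\\[1ex]0&\text{otherwise.}\end{cases}\end{aligned}$$ -/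

import Mathlib

namespace MultipleT

/-- The phase function `e(x) = exp(2πix)`. -/
noncomputable def e (x : ℝ) : ℂ := Complex.exp (2 * Real.pi * Complex.I * x)

/-- A letter `(n, ε)`: an exponent together with a sign. The multiple zeta value (or multiple
`t`-value) with exponents `n₁, …, n_d` and signs `ε₁, …, ε_d` is indexed by the word
`[(n₁, ε₁), …, (n_d, ε_d)]`. -/
abbrev Letter : Type := ℕ × ℂ

/-- The denominators `k` of multiple zeta values. -/
noncomputable def zetaDenom (k : ℕ) : ℂ := k

/-- The denominators `2k - 1` of multiple `t`-values. -/
noncomputable def tDenom (k : ℕ) : ℂ := 2 * k - 1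

/-- The nested sum `∑_{N < k₁ < ⋯ < k_d ≤ M} ∏ᵢ εᵢ ^ kᵢ / c(kᵢ) ^ nᵢ`. -/
noncomputable def truncSum (c : ℕ → ℂ) : List Letter → ℕ → ℕ → ℂ
  | [], _, _ => 1
  | a :: w, N, M => ∑ k ∈ Finset.Ioc N M, a.2 ^ k / c k ^ a.1 * truncSum c w k M

/-- The infinite nested sum over `0 < k₁ < ⋯ < k_d`, as the limit of its truncations `k_d ≤ M`. -/
noncomputable def value (c : ℕ → ℂ) (w : List Letter) : ℂ :=
  Filter.limUnder Filter.atTop fun M : ℕ => truncSum c w 0 M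

/-- The words to which a (possibly conditionally) convergent series is attached: positive exponents,
signs on the unit circle, and last letter different from `(1, 1)`. -/
def IsConvergentWord (w : List Letter) : Prop :=
  (∀ a ∈ w, 1 ≤ a.1 ∧ ‖a.2‖ = 1) ∧ w.getLast? ≠ some (1, 1)

open Classical in
/-- The number of letters `(1, 1)` at the end of a word. -/
noncomputable def trailing (w : List Letter) : ℕ :=
  (w.reverse.takeWhile fun a => decide (a = (1, 1))).length

/-- The list of all words (with multiplicity) in the stuffle product of a word with the one-letter
word `(1, 1)`: the letter is inserted at some place, or it is merged with the letter `(n, ε)`, which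
becomes `(n + 1, ε)`. -/
def stuffleOne : List Letter → List (List Letter)
  | [] => [[(1, 1)]]
  | a :: w => ((1, 1) :: a :: w) :: ((a.1 + 1, a.2) :: w) :: (stuffleOne w).map (a :: ·)

/-- The stuffle regularization polynomial of a word with at most `k` trailing letters `(1, 1)`.
A word `w = u (1,1)` with exactly `k + 1` of them occurs `k + 1` times in the stuffle product
`u * (1,1)`, all the other words of which have at most `k` of them, so that
`reg w = (reg u * T - ∑ (reg of the other words)) / (k + 1)`. -/
noncomputable def regAux (c : ℕ → ℂ) : ℕ → List Letter → Polynomial ℂ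
  | 0, w => Polynomial.C (value c w)
  | k + 1, w =>
    if trailing w = k + 1 then
      Polynomial.C (1 / ((k : ℂ) + 1)) *
        (regAux c k w.dropLast * Polynomial.X
          - (((stuffleOne w.dropLast).filter fun v => trailing v ≤ k).map (regAux c k)).sum)
    else regAux c k w

/-- The stuffle regularization polynomial of a word, in the indeterminate `T`. -/
noncomputable def reg (c : ℕ → ℂ) (w : List Letter) : Polynomial ℂ := regAux c (trailing w) w

/-- The generating series `∑ reg_T(n₁, …, n_d ; e(φ₁), …, e(φ_d)) x₁ ^ (n₁ - 1) ⋯ x_d ^ (n_d - 1)`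
over all `n₁, …, n_d ≥ 1`, in `d` variables. -/
noncomputable def genSeries (c : ℕ → ℂ) (T : ℂ) {d : ℕ} (φ : Fin d → ℝ) :
    MvPowerSeries (Fin d) ℂ :=
  fun n => (reg c (List.ofFn fun i => (n i + 1, e (φ i)))).eval T

/-- The generating series with phases and arguments `[(φ₁, a₁), …, (φ_d, a_d)]`, where the power
series `aᵢ` (in practice linear forms) are substituted for the variables. -/
noncomputable def genSeriesAt (c : ℕ → ℂ) (T : ℂ) {σ : Type*}
    (p : List (ℝ × MvPowerSeries σ ℂ)) : MvPowerSeries σ ℂ :=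
  MvPowerSeries.subst (fun i : Fin p.length => (p.get i).2)
    (genSeries c T fun i : Fin p.length => (p.get i).1)

/-- `Li_{T}(φ₁, …, φ_d ∣ a₁, …, a_d)`: the regularized generating series of multiple zeta values. -/
noncomputable def Li (T : ℂ) {σ : Type*} (p : List (ℝ × MvPowerSeries σ ℂ)) : MvPowerSeries σ ℂ :=
  genSeriesAt zetaDenom T p

/-- `Li^t_{T}(φ₁, …, φ_d ∣ a₁, …, a_d)`: the regularized generating series of multiple
`t`-values. -/
noncomputable def Lit (T : ℂ) {σ : Type*} (p : List (ℝ × MvPowerSeries σ ℂ)) : MvPowerSeries σ ℂ :=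
  genSeriesAt tDenom T p

/-- The regularized depth one `t`-Bernoulli series `B^t_T(φ ∣ a)`. It is the regularization of
`∑_{k ∈ ℤ} e(φ k) / (2 k - 1 - a)`, written through generating series of `t`-values by splitting the
sum into `k > 0` and `k ≤ 0`, as in `sum_Icc_eq_truncSum`. -/
noncomputable def Bt (T : ℂ) {σ : Type*} (φ : ℝ) (a : MvPowerSeries σ ℂ) : MvPowerSeries σ ℂ :=
  Lit T [(φ, a)] - MvPowerSeries.C (e φ) * Lit T [(-φ, -a)]

/-- Arguments without constant term can be substituted into the generating series. -/
theorem hasSubst_of_constantCoeff_eq_zero {σ : Type*} (p : List (ℝ × MvPowerSeries σ ℂ))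
    (hp : ∀ x ∈ p, MvPowerSeries.constantCoeff x.2 = 0) :
    MvPowerSeries.HasSubst (fun i : Fin p.length => (p.get i).2) :=
  MvPowerSeries.hasSubst_of_constantCoeff_zero fun i => hp _ (List.get_mem p i)

theorem e_mul_nat (φ : ℝ) (k : ℕ) : e (φ * k) = e φ ^ k := by
  unfold e
  rw [← Complex.exp_nat_mul]
  congr 1
  push_cast
  ring

theorem e_add (x y : ℝ) : e (x + y) = e x * e y := by
  unfold e
  rw [← Complex.exp_add]
  congr 1
  push_cast
  ring

/-- The coefficient of `y ^ n` in the `t`-Bernoulli series `∑_{-M ≤ k ≤ M} e(φ k) / (2 k - 1 - y)`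
of depth one truncated to order `M`, through truncated `t`-values. -/
theorem sum_Icc_eq_truncSum (φ : ℝ) (n M : ℕ) :
    ∑ k ∈ Finset.Icc (-(M : ℤ)) M, e (φ * k) / (2 * (k : ℂ) - 1) ^ (n + 1) =
      truncSum tDenom [(n + 1, e φ)] 0 M
        - (-1) ^ n * e φ * truncSum tDenom [(n + 1, e (-φ))] 0 (M + 1) := by
  have key : ∀ M : ℕ, e (φ * ((-M : ℤ) : ℝ)) / (2 * ((-M : ℤ) : ℂ) - 1) ^ (n + 1) =
      - ((-1) ^ n * e φ * (e (-φ) ^ (M + 1) / (2 * ((M + 1 : ℕ) : ℂ) - 1) ^ (n + 1))) := by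
    intro M
    have h1 : e (φ * ((-M : ℤ) : ℝ)) = e φ * e (-φ) ^ (M + 1) := by
      rw [← e_mul_nat, ← e_add]
      congr 1
      push_cast
      ring
    have h2 : (2 * ((-M : ℤ) : ℂ) - 1) ^ (n + 1) =
        - ((-1) ^ n * (2 * ((M + 1 : ℕ) : ℂ) - 1) ^ (n + 1)) := by
      have : (2 * ((-M : ℤ) : ℂ) - 1) = (-1) * (2 * ((M + 1 : ℕ) : ℂ) - 1) := by
        push_cast
        ring
      rw [this, mul_pow, pow_succ (-1 : ℂ)]
      ring
    have h3 : ((-1 : ℂ) ^ n)⁻¹ = (-1) ^ n := by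
      rw [← inv_pow]
      norm_num
    rw [h1, h2, div_neg, div_mul_eq_div_div, div_eq_mul_inv _ ((-1 : ℂ) ^ n), h3]
    ring
  induction M with
  | zero =>
    have := key 0
    simp [truncSum, tDenom] at this ⊢
    simpa using this
  | succ M ih =>
    have hI : Finset.Icc (-((M + 1 : ℕ) : ℤ)) ((M + 1 : ℕ) : ℤ) =
        insert (-((M + 1 : ℕ) : ℤ)) (insert ((M + 1 : ℕ) : ℤ) (Finset.Icc (-(M : ℤ)) M)) := by
      ext k
      simp only [Finset.mem_Icc, Finset.mem_insert]
      omega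
    have hk : e (φ * (((M + 1 : ℕ) : ℤ) : ℝ)) = e φ ^ (M + 1) := by
      rw [← e_mul_nat]
      simp
    rw [hI, Finset.sum_insert, Finset.sum_insert, ih, key (M + 1), hk]
    · simp only [truncSum, tDenom, mul_one]
      simp only [Finset.sum_Ioc_succ_top (Nat.zero_le _), Int.cast_natCast]
      ring
    · simp
    · simp only [Finset.mem_Icc, Finset.mem_insert]
      omega

/-- The indices `1, …, j` in reverse order. -/
def firstRev (m j : ℕ) : List (Fin m) := ((List.finRange m).take j).reverse

/-- The indices `j + 1, …, m`. -/
def lastPart (m j : ℕ) : List (Fin m) := (List.finRange m).drop j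

end MultipleT

/-!
The identity is the limit of an exact identity between truncated sums. For formal variables `yᵢ`
consider the sum of `∏ᵢ e(φᵢ kᵢ) / (2 kᵢ - 1 - yᵢ)` over all integers `-M < k₁ < ⋯ < k_m ≤ M`
(`window`). It can be computed in two ways.

* Cutting the window between `0` and `1` and reflecting the nonpositive indices by `k ↦ 1 - k` gives
  the first sum of the theorem, with truncated series in place of the regularized ones
  (`window_eq_sum`).
* Partial fractions in the elements `2 kᵢ - 1 - yᵢ` give a sum over the place `j` of the factor that
  keeps its form (`window_eq_splitSum`): the product of a term of the `t`-Bernoulli series with index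
  `k`, and of truncated zeta series in the half differences of the variables to the left and to the
  right of `j`. This is the second sum of the theorem, except that the truncations of the zeta series
  are `M + k` and `M + 1 - k` rather than `M + 1`.

The coefficients of truncated generating series are, up to `O(log(M) ^ a / M)`, the regularization
polynomials evaluated at the harmonic number `H_M` (`small_coeff_nest_sub`); for `t`-values `T` is
replaced by `∑_{k ≤ M} 1 / (2k - 1) = H_M / 2 + log 2 + O(1 / M)`. So the coefficients of the left side
of the theorem are the constant terms of polynomials in `H_M`. If such a polynomial converges for
`M → ∞`, it is constant, and equal to the limit (`Regularizes.eq_of_tendsto`). What remains is to find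
the limit of the difference between coupled and decoupled truncations.

Where the factor with index `k` has small tails, by a power of `2k - 1` or by a nontrivial phase,
summation by parts shows that the difference tends to zero (`TailBdd.small_convolution`). The other
terms are those in `1 / (2k - 1)` for an integral total phase. There the decoupled products cancel
between `k` and `1 - k`, and the coupled ones assemble to the alternating sum over `j` of products of
left and right zeta series (`truncSides`), which vanishes in the limit
(`coeff_sidesSum_eq_zero`, `small₂_coeff_truncSides`): its derivatives in the two regularization
parameters are alternating sums of the same kind for fewer variables, hence zero by induction, and the
remaining constant is zero because the convolution of the truncated series vanishes identically, again
by partial fractions.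

The only exception is the constant coefficient if all phases are integral, where the right side of the
theorem comes from. There the Bernoulli factor is zero, and the window is a coefficient of
`∏_{-M < k ≤ M} (1 + z / (2k - 1))`, which tends to `cos(π z / 2)` (`tendsto_coeff_prod_window`).
-/

namespace MultipleT

open Finset Filter Topology

/-! ### Logarithmic bounds -/

/-- The logarithmic weight `1 + H_M`, where `H_M` is the harmonic number. Bounds for nested sums are
stated through its powers. -/
noncomputable def lam (M : ℕ) : ℝ := 1 + ∑ k ∈ range M, 1 / ((k : ℝ) + 1)

theorem lam_succ (M : ℕ) : lam (M + 1) = lam M + 1 / ((M : ℝ) + 1) := by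
  unfold lam
  rw [sum_range_succ]
  ring

theorem lam_mono : Monotone lam := by
  refine monotone_nat_of_le_succ fun M => ?_
  rw [lam_succ]
  have : 0 ≤ 1 / ((M : ℝ) + 1) := by positivity
  linarith

theorem one_le_lam (M : ℕ) : 1 ≤ lam M := by
  have := lam_mono (Nat.zero_le M)
  simpa [lam] using this

theorem lam_pos (M : ℕ) : 0 < lam M := lt_of_lt_of_le one_pos (one_le_lam M)

theorem lam_pow_le (M : ℕ) {a b : ℕ} (h : a ≤ b) : lam M ^ a ≤ lam M ^ b :=
  pow_le_pow_right₀ (one_le_lam M) h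

theorem lam_two_mul_le (M : ℕ) : lam (2 * M) ≤ 2 * lam M := by
  have h : lam (M + M) ≤ lam M + 1 := by
    unfold lam
    rw [sum_range_add]
    have : ∑ x ∈ range M, 1 / (((M + x : ℕ) : ℝ) + 1) ≤ 1 := by
      calc ∑ x ∈ range M, 1 / (((M + x : ℕ) : ℝ) + 1) ≤ ∑ x ∈ range M, 1 / ((M : ℝ) + 1) := by
            refine sum_le_sum fun x _ => ?_
            push_cast
            gcongr
            simp
        _ ≤ 1 := by
            rw [sum_const, card_range, nsmul_eq_mul, mul_one_div, div_le_one (by positivity)]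
            linarith
    linarith
  rw [two_mul]
  linarith [one_le_lam M]

theorem lam_le_log (M : ℕ) : lam M ≤ 2 + Real.log M := by
  have h : lam M = 1 + (harmonic M : ℝ) := by
    unfold lam
    simp [harmonic]
  rw [h]
  linarith [harmonic_le_one_add_log M]

theorem tendsto_lam_pow_div (a : ℕ) :
    Tendsto (fun M : ℕ => lam M ^ a / ((M : ℝ) + 1)) atTop (𝓝 0) := by
  have h1 : (fun x : ℝ => (2 + Real.log x) ^ a) =o[atTop] (fun x : ℝ => x) := by
    have h0 : (fun x : ℝ => 2 + Real.log x) =O[atTop] Real.log := by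
      refine Asymptotics.IsBigO.add ?_ (Asymptotics.isBigO_refl _ _)
      exact (Asymptotics.isLittleO_const_left.2
        (Or.inr (tendsto_norm_atTop_atTop.comp Real.tendsto_log_atTop))).isBigO
    exact (h0.pow a).trans_isLittleO Real.isLittleO_pow_log_id_atTop
  have h2 := h1.tendsto_div_nhds_zero.comp tendsto_natCast_atTop_atTop
  refine squeeze_zero' (Eventually.of_forall fun M => ?_) ?_ h2
  · have := lam_pos M
    positivity
  · filter_upwards [eventually_ge_atTop 1] with M hM
    have hM' : (0 : ℝ) < M := by exact_mod_cast hM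
    simp only [Function.comp]
    have := lam_le_log M
    have := lam_pos M
    gcongr
    linarith

/-- Sums of logarithmic powers over `1 / l ^ 2` have logarithmically small tails. -/
theorem exists_sum_lam_pow_le (a : ℕ) : ∃ C : ℝ, 0 ≤ C ∧ ∀ N M : ℕ, N ≤ M →
    ∑ l ∈ Ico N M, lam (l + 1) ^ a / (((l : ℝ) + 1) * (l + 2)) ≤ C * lam N ^ a / (N + 1) := by
  induction a with
  | zero =>
    refine ⟨1, zero_le_one, fun N M h => ?_⟩
    have : ∑ l ∈ Ico N M, (1 : ℝ) / (((l : ℝ) + 1) * (l + 2)) = 1 / (N + 1) - 1 / (M + 1) := by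
      induction M, h using Nat.le_induction with
      | base => simp
      | succ M hM ih =>
        rw [sum_Ico_succ_top hM, ih]
        push_cast
        field_simp
        ring
    simp only [pow_zero, mul_one, this]
    have : (0 : ℝ) ≤ 1 / (M + 1) := by positivity
    linarith
  | succ a ih =>
    obtain ⟨C, hC, h⟩ := ih
    refine ⟨2 ^ (a + 1) + (a + 1) * 2 * C, by positivity, fun N M hNM => ?_⟩
    -- summation by parts against `1 / ((l + 1) (l + 2)) = 1 / (l + 1) - 1 / (l + 2)`
    have key : ∑ l ∈ Ico N M, lam (l + 1) ^ (a + 1) / (((l : ℝ) + 1) * (l + 2))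
        + lam (M + 1) ^ (a + 1) / (M + 1)
        ≤ lam (N + 1) ^ (a + 1) / (N + 1)
          + (a + 1) * 2 * ∑ l ∈ Ico N M,
            lam (l + 1 + 1) ^ a / (((l + 1 : ℕ) + 1 : ℝ) * ((l + 1 : ℕ) + 2)) := by
      induction M, hNM using Nat.le_induction with
      | base => simp
      | succ M hM ih =>
        rw [sum_Ico_succ_top hM, sum_Ico_succ_top hM]
        have hd : lam (M + 1 + 1) ^ (a + 1) - lam (M + 1) ^ (a + 1)
            ≤ (a + 1) * lam (M + 1 + 1) ^ a * (1 / ((M : ℝ) + 2)) := by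
          have e1 : lam (M + 1 + 1) - lam (M + 1) = 1 / ((M : ℝ) + 2) := by
            rw [lam_succ (M + 1)]
            push_cast
            ring
          have h0 := lam_mono (Nat.le_succ (M + 1))
          have hp := lam_pos (M + 1)
          have hp' := lam_pos (M + 1 + 1)
          have h0 : lam (M + 1) ≤ lam (M + 1 + 1) := h0
          have e2 := (Commute.all (lam (M + 1 + 1)) (lam (M + 1))).mul_geom_sum₂ (a + 1)
          rw [← e2, e1]
          have : ∑ i ∈ range (a + 1), lam (M + 1 + 1) ^ i * lam (M + 1) ^ (a + 1 - 1 - i)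
              ≤ (a + 1) * lam (M + 1 + 1) ^ a := by
            calc _ ≤ ∑ i ∈ range (a + 1), lam (M + 1 + 1) ^ a := by
                  refine sum_le_sum fun i hi => ?_
                  have hi' : i ≤ a := by simpa [Nat.lt_succ_iff] using hi
                  calc lam (M + 1 + 1) ^ i * lam (M + 1) ^ (a + 1 - 1 - i)
                      ≤ lam (M + 1 + 1) ^ i * lam (M + 1 + 1) ^ (a + 1 - 1 - i) := by gcongr
                    _ = lam (M + 1 + 1) ^ a := by
                      rw [← pow_add]
                      congr 1
                      omega
              _ = _ := by simp
          calc _ ≤ 1 / ((M : ℝ) + 2) * ((a + 1) * lam (M + 1 + 1) ^ a) := by gcongr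
            _ = _ := by ring
        have hd2 : (lam (M + 1 + 1) ^ (a + 1) - lam (M + 1) ^ (a + 1)) / (M + 2)
            ≤ (a + 1) * 2 * (lam (M + 1 + 1) ^ a / (((M + 1 : ℕ) + 1 : ℝ) * ((M + 1 : ℕ) + 2))) := by
          have hp := lam_pos (M + 1 + 1)
          calc _ ≤ (a + 1) * lam (M + 1 + 1) ^ a * (1 / ((M : ℝ) + 2)) / (M + 2) := by gcongr
            _ ≤ _ := by
              push_cast
              rw [mul_one_div, div_div, mul_div_assoc', div_le_div_iff₀ (by positivity) (by positivity)]
              have : 0 ≤ ((a : ℝ) + 1) * lam (M + 1 + 1) ^ a := by positivity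
              have h2 : ((M : ℝ) + 1 + 1) * (M + 1 + 2) ≤ 2 * ((M + 2) * (M + 2)) := by
                nlinarith [(Nat.cast_nonneg M : (0 : ℝ) ≤ M)]
              nlinarith [mul_le_mul_of_nonneg_left h2 this]
        have e3 : lam (M + 1) ^ (a + 1) / (((M : ℝ) + 1) * (M + 2))
            = lam (M + 1) ^ (a + 1) / (M + 1) - lam (M + 1) ^ (a + 1) / (M + 2) := by
          field_simp
          ring
        rw [sub_div] at hd2
        have e4 : ((M + 1 : ℕ) : ℝ) + 1 = M + 2 := by push_cast; ring
        rw [e3, mul_add]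
        simp only [e4] at hd2 ⊢
        linarith
    have hs : ∑ l ∈ Ico N M, lam (l + 1 + 1) ^ a / (((l + 1 : ℕ) + 1 : ℝ) * ((l + 1 : ℕ) + 2))
        ≤ C * lam N ^ a / (N + 1) := by
      have := h N (M + 1) (by omega)
      refine le_trans ?_ this
      rw [sum_Ico_add' (fun l : ℕ => lam (l + 1) ^ a / (((l : ℝ) + 1) * (l + 2))) N M 1]
      refine sum_le_sum_of_subset_of_nonneg (Ico_subset_Ico_left (by omega)) fun l _ _ => ?_
      have := lam_pos (l + 1)
      positivity
    have h1 : 0 ≤ lam (M + 1) ^ (a + 1) / ((M : ℝ) + 1) := by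
      have := lam_pos (M + 1)
      positivity
    have h2 : lam (N + 1) ≤ 2 * lam N := by
      rw [lam_succ]
      have : 1 / ((N : ℝ) + 1) ≤ 1 := by
        rw [div_le_one (by positivity)]
        linarith [(Nat.cast_nonneg N : (0 : ℝ) ≤ N)]
      linarith [one_le_lam N]
    have h3 : lam (N + 1) ^ (a + 1) / ((N : ℝ) + 1) ≤ 2 ^ (a + 1) * lam N ^ (a + 1) / (N + 1) := by
      rw [← mul_pow]
      have := lam_pos (N + 1)
      gcongr
    have h4 : C * lam N ^ a / (N + 1) ≤ C * lam N ^ (a + 1) / ((N : ℝ) + 1) := by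
      have := one_le_lam N
      gcongr ?_ / _
      exact mul_le_mul_of_nonneg_left (lam_pow_le N (Nat.le_succ a)) hC
    calc _ ≤ lam (N + 1) ^ (a + 1) / ((N : ℝ) + 1) + (a + 1) * 2 * (C * lam N ^ a / (N + 1)) := by
          have := mul_le_mul_of_nonneg_left hs (by positivity : 0 ≤ ((a : ℝ) + 1) * 2)
          linarith
      _ ≤ 2 ^ (a + 1) * lam N ^ (a + 1) / (N + 1) + (a + 1) * 2 * (C * lam N ^ (a + 1) / (N + 1)) := by
          gcongr
      _ = _ := by ring

/-- A sequence of at most logarithmic growth. -/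
def LogBdd (f : ℕ → ℂ) : Prop := ∃ (C : ℝ) (a : ℕ), 0 ≤ C ∧ ∀ M, ‖f M‖ ≤ C * lam M ^ a

/-- A sequence which is `O(log(M) ^ a / M)` for some `a`. -/
def Small (f : ℕ → ℂ) : Prop := ∃ (C : ℝ) (a : ℕ), 0 ≤ C ∧ ∀ M, ‖f M‖ ≤ C * lam M ^ a / (M + 1)

theorem LogBdd.add {f g : ℕ → ℂ} (hf : LogBdd f) (hg : LogBdd g) :
    LogBdd fun M => f M + g M := by
  obtain ⟨C, a, hC, h⟩ := hf
  obtain ⟨D, b, hD, h'⟩ := hg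
  refine ⟨C + D, max a b, by positivity, fun M => (norm_add_le _ _).trans ?_⟩
  have := lam_pow_le M (le_max_left a b)
  have := lam_pow_le M (le_max_right a b)
  nlinarith [h M, h' M]

theorem LogBdd.mul {f g : ℕ → ℂ} (hf : LogBdd f) (hg : LogBdd g) :
    LogBdd fun M => f M * g M := by
  obtain ⟨C, a, hC, h⟩ := hf
  obtain ⟨D, b, hD, h'⟩ := hg
  refine ⟨C * D, a + b, by positivity, fun M => ?_⟩
  rw [norm_mul, pow_add]
  calc _ ≤ (C * lam M ^ a) * (D * lam M ^ b) :=
        mul_le_mul (h M) (h' M) (norm_nonneg _) ((norm_nonneg _).trans (h M))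
    _ = _ := by ring

theorem logBdd_const (c : ℂ) : LogBdd fun _ => c := ⟨‖c‖, 0, norm_nonneg _, by simp⟩

theorem LogBdd.sum {ι : Type*} (s : Finset ι) {f : ι → ℕ → ℂ} (h : ∀ i ∈ s, LogBdd (f i)) :
    LogBdd fun M => ∑ i ∈ s, f i M := by
  classical
  induction s using Finset.induction_on with
  | empty => simpa using logBdd_const 0
  | insert i s hi ih =>
    simp only [sum_insert hi]
    exact (h i (mem_insert_self _ _)).add (ih fun j hj => h j (mem_insert_of_mem hj))

theorem Small.logBdd {f : ℕ → ℂ} (hf : Small f) : LogBdd f := by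
  obtain ⟨C, a, hC, h⟩ := hf
  refine ⟨C, a, hC, fun M => (h M).trans ?_⟩
  have := lam_pos M
  exact div_le_self (by positivity) (by linarith [(Nat.cast_nonneg M : (0 : ℝ) ≤ M)])

theorem Small.add {f g : ℕ → ℂ} (hf : Small f) (hg : Small g) : Small fun M => f M + g M := by
  obtain ⟨C, a, hC, h⟩ := hf
  obtain ⟨D, b, hD, h'⟩ := hg
  refine ⟨C + D, max a b, by positivity, fun M => (norm_add_le _ _).trans ?_⟩
  have h1 : C * lam M ^ a / (M + 1) ≤ C * lam M ^ (max a b) / (M + 1) := by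
    gcongr ?_ / _
    exact mul_le_mul_of_nonneg_left (lam_pow_le M (le_max_left a b)) hC
  have h2 : D * lam M ^ b / (M + 1) ≤ D * lam M ^ (max a b) / (M + 1) := by
    gcongr ?_ / _
    exact mul_le_mul_of_nonneg_left (lam_pow_le M (le_max_right a b)) hD
  calc _ ≤ C * lam M ^ (max a b) / (M + 1) + D * lam M ^ (max a b) / (M + 1) :=
        add_le_add ((h M).trans h1) ((h' M).trans h2)
    _ = _ := by ring

theorem Small.mul {f g : ℕ → ℂ} (hf : Small f) (hg : LogBdd g) : Small fun M => f M * g M := by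
  obtain ⟨C, a, hC, h⟩ := hf
  obtain ⟨D, b, hD, h'⟩ := hg
  refine ⟨C * D, a + b, by positivity, fun M => ?_⟩
  have := lam_pos M
  rw [norm_mul, pow_add]
  calc _ ≤ (C * lam M ^ a / (M + 1)) * (D * lam M ^ b) :=
        mul_le_mul (h M) (h' M) (norm_nonneg _) ((norm_nonneg _).trans (h M))
    _ = _ := by ring

theorem Small.const_mul {f : ℕ → ℂ} (hf : Small f) (c : ℂ) : Small fun M => c * f M := by
  simpa [mul_comm] using hf.mul (logBdd_const c)

theorem small_zero : Small fun _ => 0 := ⟨0, 0, le_rfl, by simp⟩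

theorem Small.neg {f : ℕ → ℂ} (hf : Small f) : Small fun M => -f M := by
  simpa using hf.const_mul (-1)

theorem Small.sub {f g : ℕ → ℂ} (hf : Small f) (hg : Small g) : Small fun M => f M - g M := by
  simpa [sub_eq_add_neg] using hf.add hg.neg

theorem Small.sum {ι : Type*} (s : Finset ι) {f : ι → ℕ → ℂ} (h : ∀ i ∈ s, Small (f i)) :
    Small fun M => ∑ i ∈ s, f i M := by
  classical
  induction s using Finset.induction_on with
  | empty => simpa using small_zero
  | insert i s hi ih =>
    simp only [sum_insert hi]
    exact (h i (mem_insert_self _ _)).add (ih fun j hj => h j (mem_insert_of_mem hj))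

theorem Small.listSum {ι : Type*} (l : List ι) {f : ι → ℕ → ℂ} (h : ∀ i ∈ l, Small (f i)) :
    Small fun M => (l.map fun i => f i M).sum := by
  induction l with
  | nil => simpa using small_zero
  | cons i l ih =>
    simp only [List.map_cons, List.sum_cons]
    exact (h i (by simp)).add (ih fun j hj => h j (by simp [hj]))

theorem Small.tendsto {f : ℕ → ℂ} (hf : Small f) : Tendsto f atTop (𝓝 0) := by
  obtain ⟨C, a, -, h⟩ := hf
  refine squeeze_zero_norm h ?_
  have := (tendsto_lam_pow_div a).const_mul C
  simpa [mul_div_assoc] using this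

theorem LogBdd.polynomial_eval {f : ℕ → ℂ} (hf : LogBdd f) (P : Polynomial ℂ) :
    LogBdd fun M => P.eval (f M) := by
  induction P using Polynomial.induction_on' with
  | add p q hp hq => simpa using hp.add hq
  | monomial n c =>
    simp only [Polynomial.eval_monomial]
    refine (logBdd_const c).mul ?_
    induction n with
    | zero => simpa using logBdd_const 1
    | succ n ih => simpa [pow_succ] using ih.mul hf

/-- A polynomial is Lipschitz up to logarithmic factors. -/
theorem Small.polynomial_eval_sub {f g : ℕ → ℂ} (hf : LogBdd f) (hg : LogBdd g)
    (h : Small fun M => f M - g M) (P : Polynomial ℂ) :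
    Small fun M => P.eval (f M) - P.eval (g M) := by
  induction P using Polynomial.induction_on' with
  | add p q hp hq =>
    convert hp.add hq using 2
    simp
    ring
  | monomial n c =>
    simp only [Polynomial.eval_monomial, ← mul_sub]
    refine Small.const_mul ?_ c
    induction n with
    | zero => simpa using small_zero
    | succ n ih =>
      have hgn : LogBdd fun M => g M ^ n := by
        simpa using hg.polynomial_eval (Polynomial.X ^ n)
      convert (ih.mul hf).add (h.mul hgn) using 2
      ring

/-! ### Summation by parts and convergence -/

/-- A sequence of logarithmic growth whose increments are `O(log(M) ^ a / M)`. -/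
def LogLip (f : ℕ → ℂ) : Prop := LogBdd f ∧ Small fun M => f (M + 1) - f M

/-- The tails of the series `∑ γ k` are `O(1 / N)`, possibly because of cancellation. -/
def TailBdd (γ : ℕ → ℂ) : Prop :=
  ∃ C : ℝ, 0 ≤ C ∧ ∀ N M : ℕ, N ≤ M → ‖∑ k ∈ Ioc N M, γ k‖ ≤ C / (N + 1)

/-- Summation by parts with the tails of `γ`. -/
theorem sum_mul_pred_eq (γ V : ℕ → ℂ) {N M : ℕ} (h : N ≤ M) :
    ∑ k ∈ Ioc N M, γ k * V (k - 1) = V N * ∑ k ∈ Ioc N M, γ k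
      + ∑ l ∈ Ico N M, (V (l + 1) - V l) * ∑ k ∈ Ioc (l + 1) M, γ k := by
  induction M, h using Nat.le_induction with
  | base => simp
  | succ M hM ih =>
    rw [sum_Ioc_succ_top hM, sum_Ioc_succ_top hM, sum_Ico_succ_top hM, ih]
    have h1 : ∑ l ∈ Ico N M, (V (l + 1) - V l) * ∑ k ∈ Ioc (l + 1) (M + 1), γ k
        = ∑ l ∈ Ico N M, (V (l + 1) - V l) * ∑ k ∈ Ioc (l + 1) M, γ k
          + (V M - V N) * γ (M + 1) := by
      rw [← sum_Ico_sub V hM, sum_mul, ← sum_add_distrib]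
      refine sum_congr rfl fun l hl => ?_
      rw [sum_Ioc_succ_top (by simp at hl; omega)]
      ring
    rw [h1]
    simp
    ring

theorem exists_lim_of_norm_sub_le {F : ℕ → ℂ} {C : ℝ} {a : ℕ} (hC : 0 ≤ C)
    (h : ∀ N M, N ≤ M → ‖F M - F N‖ ≤ C * lam N ^ a / (N + 1)) :
    ∃ L, Small fun M => F M - L := by
  have h0 : Tendsto (fun M : ℕ => C * lam M ^ a / (M + 1)) atTop (𝓝 0) := by
    have := (tendsto_lam_pow_div a).const_mul C
    simpa [mul_div_assoc] using this
  have hc : CauchySeq F := by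
    refine cauchySeq_of_le_tendsto_0' (fun M : ℕ => C * lam M ^ a / (M + 1)) (fun N M hNM => ?_) h0
    rw [dist_comm, dist_eq_norm]
    exact h N M hNM
  obtain ⟨L, hL⟩ := cauchySeq_tendsto_of_complete hc
  refine ⟨L, C, a, hC, fun N => ?_⟩
  rw [norm_sub_rev]
  exact le_of_tendsto ((hL.sub_const (F N)).norm)
    ((eventually_ge_atTop N).mono fun M hM => h N M hM)

/-- Abel's criterion with a rate: a series with small tails may be multiplied by a sequence of
logarithmic growth and small increments. -/
theorem TailBdd.exists_lim {γ V : ℕ → ℂ} (hγ : TailBdd γ) (hV : LogLip V) :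
    ∃ L, Small fun M => ∑ k ∈ Ioc 0 M, γ k * V (k - 1) - L := by
  obtain ⟨C, hC, hγ⟩ := hγ
  obtain ⟨⟨D, b, hD, hV⟩, ⟨D', b', hD', hV'⟩⟩ := hV
  obtain ⟨K, hK, hsum⟩ := exists_sum_lam_pow_le b'
  refine exists_lim_of_norm_sub_le (C := C * D + D' * C * K) (a := max b b') (by positivity)
    fun N M hNM => ?_
  have h1 : ∑ k ∈ Ioc 0 M, γ k * V (k - 1) - ∑ k ∈ Ioc 0 N, γ k * V (k - 1)
      = ∑ k ∈ Ioc N M, γ k * V (k - 1) := by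
    rw [← sum_Ioc_consecutive _ (Nat.zero_le N) hNM]
    ring
  rw [h1, sum_mul_pred_eq γ V hNM]
  have h2 : ‖V N * ∑ k ∈ Ioc N M, γ k‖ ≤ C * D * lam N ^ (max b b') / (N + 1) := by
    rw [norm_mul]
    have := lam_pos N
    calc _ ≤ (D * lam N ^ b) * (C / (N + 1)) :=
          mul_le_mul (hV N) (hγ N M hNM) (norm_nonneg _) (by positivity)
      _ ≤ (D * lam N ^ (max b b')) * (C / (N + 1)) := by
          gcongr ?_ * _
          exact mul_le_mul_of_nonneg_left (lam_pow_le N (le_max_left b b')) hD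
      _ = _ := by ring
  have h3 : ‖∑ l ∈ Ico N M, (V (l + 1) - V l) * ∑ k ∈ Ioc (l + 1) M, γ k‖
      ≤ D' * C * K * lam N ^ (max b b') / (N + 1) := by
    calc _ ≤ ∑ l ∈ Ico N M, D' * C * (lam (l + 1) ^ b' / (((l : ℝ) + 1) * (l + 2))) := by
          refine norm_sum_le_of_le _ fun l hl => ?_
          rw [norm_mul]
          have := lam_pos l
          have h4 := hγ (l + 1) M (by simp at hl; omega)
          have h5 : ((l + 1 : ℕ) : ℝ) + 1 = l + 2 := by push_cast; ring
          rw [h5] at h4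
          calc _ ≤ (D' * lam l ^ b' / (l + 1)) * (C / (l + 2)) :=
                mul_le_mul (hV' l) h4 (norm_nonneg _) (by positivity)
            _ ≤ (D' * lam (l + 1) ^ b' / (l + 1)) * (C / (l + 2)) := by
                gcongr
                exact lam_mono (Nat.le_succ l)
            _ = _ := by field_simp
      _ = D' * C * ∑ l ∈ Ico N M, lam (l + 1) ^ b' / (((l : ℝ) + 1) * (l + 2)) := by
          rw [mul_sum]
      _ ≤ D' * C * (K * lam N ^ b' / (N + 1)) := by gcongr; exact hsum N M hNM
      _ ≤ D' * C * (K * lam N ^ (max b b') / (N + 1)) := by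
          gcongr ?_ * (?_ / _)
          exact mul_le_mul_of_nonneg_left (lam_pow_le N (le_max_right b b')) hK
      _ = _ := by ring
  calc _ ≤ _ := norm_add_le _ _
    _ ≤ C * D * lam N ^ (max b b') / (N + 1) + D' * C * K * lam N ^ (max b b') / (N + 1) :=
        add_le_add h2 h3
    _ = _ := by ring

theorem sum_Ioc_one_div_le (M : ℕ) : ∑ k ∈ Ioc 0 M, 1 / (k : ℝ) ≤ lam M := by
  have : ∑ k ∈ Ioc 0 M, 1 / (k : ℝ) = ∑ k ∈ range M, 1 / ((k : ℝ) + 1) := by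
    induction M with
    | zero => simp
    | succ M ih =>
      rw [sum_Ioc_succ_top (Nat.zero_le M), sum_range_succ, ih]
      push_cast
      rfl
  rw [this]
  unfold lam
  linarith

/-- Appending a letter to a word preserves logarithmic growth and small increments. -/
theorem logLip_sum_mul_pred {g V : ℕ → ℂ} (hg : ∀ k, 1 ≤ k → ‖g k‖ ≤ 1 / k) (hV : LogBdd V) :
    LogLip fun M => ∑ k ∈ Ioc 0 M, g k * V (k - 1) := by
  obtain ⟨C, a, hC, h⟩ := hV
  constructor
  · refine ⟨C, a + 1, hC, fun M => ?_⟩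
    have := lam_pos M
    calc _ ≤ ∑ k ∈ Ioc 0 M, 1 / (k : ℝ) * (C * lam M ^ a) := by
          refine norm_sum_le_of_le _ fun k hk => ?_
          rw [mem_Ioc] at hk
          rw [norm_mul]
          refine mul_le_mul (hg k hk.1) ((h _).trans ?_) (norm_nonneg _) (by positivity)
          have := lam_pos (k - 1)
          gcongr
          exact lam_mono (by omega)
      _ = (∑ k ∈ Ioc 0 M, 1 / (k : ℝ)) * (C * lam M ^ a) := by rw [sum_mul]
      _ ≤ lam M * (C * lam M ^ a) := by gcongr; exact sum_Ioc_one_div_le M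
      _ = _ := by ring
  · refine ⟨C, a, hC, fun M => ?_⟩
    simp only [sum_Ioc_succ_top (Nat.zero_le M), add_sub_cancel_left, norm_mul]
    have h1 := hg (M + 1) (by omega)
    push_cast at h1
    calc _ ≤ 1 / ((M : ℝ) + 1) * (C * lam M ^ a) :=
          mul_le_mul h1 (h M) (norm_nonneg _) (by positivity)
      _ = _ := by ring

/-! ### Letters and words -/

/-- The properties of the denominators `k` and `2k - 1` that matter for convergence. -/
structure RegularDenom (c : ℕ → ℂ) : Prop where
  exists_real : ∃ ρ : ℕ → ℝ, Monotone ρ ∧ (∀ k, c k = ρ k) ∧ ∀ k : ℕ, 1 ≤ k → (k : ℝ) ≤ ρ k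

theorem regularDenom_zeta : RegularDenom zetaDenom :=
  ⟨fun k => k, Nat.mono_cast, fun k => by simp [zetaDenom], fun k _ => le_rfl⟩

theorem regularDenom_t : RegularDenom tDenom := by
  refine ⟨fun k => 2 * k - 1, fun a b h => ?_, fun k => by simp [tDenom], fun k hk => ?_⟩
  · have : (a : ℝ) ≤ b := by exact_mod_cast h
    simp only
    linarith
  · have : (1 : ℝ) ≤ k := by exact_mod_cast hk
    linarith

theorem RegularDenom.ne_zero {c : ℕ → ℂ} (hc : RegularDenom c) {k : ℕ} (hk : 1 ≤ k) :
    c k ≠ 0 := by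
  obtain ⟨ρ, -, h, h'⟩ := hc.exists_real
  rw [h]
  have := h' k hk
  have : (1 : ℝ) ≤ k := by exact_mod_cast hk
  exact_mod_cast (by linarith : ρ k > 0).ne'

/-- The factor `ε ^ k / c(k) ^ n` of a nested sum that belongs to a letter. -/
noncomputable def letterTerm (c : ℕ → ℂ) (a : Letter) (k : ℕ) : ℂ := a.2 ^ k / c k ^ a.1

/-- Letters with positive exponent and sign on the unit circle. -/
def ValidLetter (a : Letter) : Prop := 1 ≤ a.1 ∧ ‖a.2‖ = 1

theorem norm_letterTerm_le {c : ℕ → ℂ} (hc : RegularDenom c) {a : Letter} (ha : ValidLetter a)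
    {k : ℕ} (hk : 1 ≤ k) : ‖letterTerm c a k‖ ≤ 1 / (k : ℝ) ^ a.1 := by
  obtain ⟨ρ, -, h, h'⟩ := hc.exists_real
  have hk' : (0 : ℝ) < k := by exact_mod_cast hk
  have := h' k hk
  rw [letterTerm, norm_div, norm_pow, norm_pow, ha.2, one_pow, h, Complex.norm_real,
    Real.norm_of_nonneg (by linarith)]
  gcongr

theorem norm_letterTerm_le_one_div {c : ℕ → ℂ} (hc : RegularDenom c) {a : Letter}
    (ha : ValidLetter a) {k : ℕ} (hk : 1 ≤ k) : ‖letterTerm c a k‖ ≤ 1 / (k : ℝ) := by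
  refine (norm_letterTerm_le hc ha hk).trans ?_
  have hk' : (1 : ℝ) ≤ k := by exact_mod_cast hk
  gcongr
  exact le_self_pow₀ hk' (by have := ha.1; omega)

/-- Summation by parts for a geometric sequence on the unit circle with decreasing weights, kept as an
invariant that is stable under `M ↦ M + 1`. -/
theorem norm_sum_pow_mul_le {ε : ℂ} (hε : ‖ε‖ = 1) {b : ℕ → ℝ} {N : ℕ}
    (hb : ∀ k, N < k → b (k + 1) ≤ b k) {M : ℕ} (hM : N + 1 ≤ M) :
    ‖(1 - ε) * ∑ k ∈ Ioc N M, ε ^ k * (b k : ℂ) + ε ^ (M + 1) * b M‖ ≤ 2 * |b (N + 1)| - b M := by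
  induction M, hM using Nat.le_induction with
  | base =>
    rw [sum_Ioc_succ_top (le_refl N)]
    simp only [Ioc_self, sum_empty, zero_add]
    have : (1 - ε) * (ε ^ (N + 1) * (b (N + 1) : ℂ)) + ε ^ (N + 1 + 1) * (b (N + 1) : ℂ)
        = ε ^ (N + 1) * b (N + 1) := by ring
    rw [this, norm_mul, norm_pow, hε, one_pow, one_mul, Complex.norm_real, Real.norm_eq_abs]
    linarith [le_abs_self (b (N + 1))]
  | succ M hM ih =>
    rw [sum_Ioc_succ_top (by omega)]
    have h1 : (1 - ε) * (∑ k ∈ Ioc N M, ε ^ k * (b k : ℂ) + ε ^ (M + 1) * (b (M + 1) : ℂ))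
        + ε ^ (M + 1 + 1) * (b (M + 1) : ℂ)
        = ((1 - ε) * ∑ k ∈ Ioc N M, ε ^ k * (b k : ℂ) + ε ^ (M + 1) * b M)
          + ε ^ (M + 1) * ((b (M + 1) - b M : ℝ) : ℂ) := by
      push_cast
      ring
    rw [h1]
    refine (norm_add_le _ _).trans ?_
    have h2 : ‖ε ^ (M + 1) * ((b (M + 1) - b M : ℝ) : ℂ)‖ = b M - b (M + 1) := by
      rw [norm_mul, norm_pow, hε, one_pow, one_mul, Complex.norm_real, Real.norm_eq_abs,
        abs_of_nonpos (by linarith [hb M (by omega)])]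
      ring
    rw [h2]
    linarith

theorem tailBdd_of_ne_one {c : ℕ → ℂ} (hc : RegularDenom c) {a : Letter} (ha : ValidLetter a)
    (h1 : a.2 ≠ 1) : TailBdd (letterTerm c a) := by
  obtain ⟨ρ, hm, h, h'⟩ := hc.exists_real
  have hε : 0 < ‖1 - a.2‖ := norm_pos_iff.2 (sub_ne_zero.2 (Ne.symm h1))
  refine ⟨3 / ‖1 - a.2‖, by positivity, fun N M hNM => ?_⟩
  rcases hNM.eq_or_lt with rfl | hlt
  · simp
    positivity
  set b : ℕ → ℝ := fun k => 1 / ρ k ^ a.1 with hb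
  have hpos : ∀ k, 1 ≤ k → 0 < ρ k := fun k hk => by
    have : (1 : ℝ) ≤ k := by exact_mod_cast hk
    linarith [h' k hk]
  have hbpos : ∀ k, 1 ≤ k → 0 < b k := fun k hk => by
    have := hpos k hk
    positivity
  have hdec : ∀ k, N < k → b (k + 1) ≤ b k := fun k hk => by
    have := hpos k (by omega)
    simp only [hb]
    gcongr
    exact hm (Nat.le_succ k)
  have hdec' : b M ≤ b (N + 1) := by
    have := hpos (N + 1) (by omega)
    simp only [hb]
    gcongr
    exact hm hlt
  have hs : ∑ k ∈ Ioc N M, letterTerm c a k = ∑ k ∈ Ioc N M, a.2 ^ k * (b k : ℂ) := by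
    refine sum_congr rfl fun k _ => ?_
    simp [letterTerm, hb, h, div_eq_mul_inv]
  have key := norm_sum_pow_mul_le ha.2 hdec hlt
  have hN : b (N + 1) ≤ 1 / ((N : ℝ) + 1) := by
    have h2 := h' (N + 1) (by omega)
    push_cast at h2
    have h3 : (1 : ℝ) ≤ ρ (N + 1) := by linarith [(Nat.cast_nonneg N : (0 : ℝ) ≤ N)]
    simp only [hb]
    gcongr
    exact h2.trans (le_self_pow₀ h3 (by have := ha.1; omega))
  have h4 : ‖(1 - a.2) * ∑ k ∈ Ioc N M, a.2 ^ k * (b k : ℂ)‖ ≤ 2 * b (N + 1) := by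
    have h5 := norm_sub_le ((1 - a.2) * ∑ k ∈ Ioc N M, a.2 ^ k * (b k : ℂ) + a.2 ^ (M + 1) * b M)
      (a.2 ^ (M + 1) * b M)
    rw [add_sub_cancel_right] at h5
    have h6 : ‖a.2 ^ (M + 1) * (b M : ℂ)‖ = b M := by
      rw [norm_mul, norm_pow, ha.2, one_pow, one_mul, Complex.norm_real,
        Real.norm_of_nonneg (hbpos M (by omega)).le]
    rw [h6] at h5
    rw [abs_of_pos (hbpos (N + 1) (by omega))] at key
    linarith
  rw [hs, div_div, le_div_iff₀ (by positivity)]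
  rw [norm_mul] at h4
  have h7 : 0 ≤ (N : ℝ) + 1 := by positivity
  have h8 : b (N + 1) * ((N : ℝ) + 1) ≤ 1 := by
    rw [le_div_iff₀ (by positivity)] at hN
    exact hN
  nlinarith [mul_le_mul_of_nonneg_right h4 h7]

theorem tailBdd_of_two_le {c : ℕ → ℂ} (hc : RegularDenom c) {a : Letter} (ha : ValidLetter a)
    (h2 : 2 ≤ a.1) : TailBdd (letterTerm c a) := by
  refine ⟨2, by norm_num, fun N M hNM => ?_⟩
  calc _ ≤ ∑ k ∈ Ioc N M, 2 * (1 / (k : ℝ) - 1 / (k + 1)) := by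
        refine norm_sum_le_of_le _ fun k hk => ?_
        rw [mem_Ioc] at hk
        have hk' : (1 : ℝ) ≤ k := by exact_mod_cast (by omega : 1 ≤ k)
        refine (norm_letterTerm_le hc ha (by omega)).trans ?_
        calc 1 / (k : ℝ) ^ a.1 ≤ 1 / (k : ℝ) ^ 2 := by gcongr
          _ ≤ 2 * (1 / (k : ℝ) - 1 / (k + 1)) := by
            rw [div_sub_div _ _ (by positivity) (by positivity), mul_div_assoc',
              div_le_div_iff₀ (by positivity) (by positivity)]
            nlinarith
    _ = 2 * (1 / ((N : ℝ) + 1) - 1 / (M + 1)) := by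
        rw [← mul_sum]
        congr 1
        induction M, hNM using Nat.le_induction with
        | base => simp
        | succ M hM ih =>
          rw [sum_Ioc_succ_top hM, ih]
          push_cast
          ring
    _ ≤ _ := by
        have : 0 ≤ 1 / ((M : ℝ) + 1) := by positivity
        rw [div_eq_mul_one_div 2 ((N : ℝ) + 1)]
        linarith

/-- The terms of a letter different from `(1, 1)` have small tails: for a nontrivial sign because of
cancellation, and otherwise because the exponent is at least `2`. -/
theorem tailBdd_letterTerm {c : ℕ → ℂ} (hc : RegularDenom c) {a : Letter} (ha : ValidLetter a)
    (h1 : a ≠ (1, 1)) : TailBdd (letterTerm c a) := by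
  by_cases h : a.2 = 1
  · refine tailBdd_of_two_le hc ha ?_
    have h2 : a.1 ≠ 1 := fun h' => h1 (Prod.ext h' h)
    have := ha.1
    omega
  · exact tailBdd_of_ne_one hc ha h

theorem truncSum_concat (c : ℕ → ℂ) (w : List Letter) (a : Letter) (N M : ℕ) :
    truncSum c (w ++ [a]) N M = ∑ k ∈ Ioc N M, letterTerm c a k * truncSum c w N (k - 1) := by
  induction w generalizing N with
  | nil => simp [truncSum, letterTerm]
  | cons b w ih =>
    simp only [List.cons_append, truncSum, ih, mul_sum]
    rw [sum_comm' (t' := Ioc N M) (s' := fun k => Ioc N (k - 1))]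
    · refine sum_congr rfl fun k _ => sum_congr rfl fun j _ => ?_
      ring
    · intro j k
      simp only [mem_Ioc]
      omega

/-- Words all of whose letters are valid. -/
def ValidWord (w : List Letter) : Prop := ∀ a ∈ w, ValidLetter a

theorem logLip_truncSum {c : ℕ → ℂ} (hc : RegularDenom c) {w : List Letter} (hw : ValidWord w) :
    LogLip fun M => truncSum c w 0 M := by
  induction w using List.reverseRecOn with
  | nil => exact ⟨by simpa [truncSum] using logBdd_const 1, by simpa [truncSum] using small_zero⟩
  | append_singleton w a ih =>
    simp only [truncSum_concat]
    exact logLip_sum_mul_pred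
      (fun k hk => norm_letterTerm_le_one_div hc (hw a (by simp)) hk)
      (ih fun b hb => hw b (by simp [hb])).1

/-- The nested sums of a convergent word converge with rate `O(log(M) ^ a / M)`. -/
theorem exists_small_truncSum_sub {c : ℕ → ℂ} (hc : RegularDenom c) {w : List Letter}
    (hw : IsConvergentWord w) : ∃ L, Small fun M => truncSum c w 0 M - L := by
  induction w using List.reverseRecOn with
  | nil => exact ⟨1, by simpa [truncSum] using small_zero⟩
  | append_singleton w a _ =>
    simp only [truncSum_concat]
    refine (tailBdd_letterTerm hc (hw.1 a (by simp)) ?_).exists_lim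
      (logLip_truncSum hc fun b hb => hw.1 b (by simp [hb]))
    have := hw.2
    simpa using this

theorem exists_tendsto_truncSum {c : ℕ → ℂ} (hc : RegularDenom c) {w : List Letter}
    (hw : IsConvergentWord w) : ∃ l, Tendsto (fun M => truncSum c w 0 M) atTop (𝓝 l) := by
  obtain ⟨L, hL⟩ := exists_small_truncSum_sub hc hw
  exact ⟨L, by simpa using hL.tendsto.add_const L⟩

theorem small_truncSum_sub_value {c : ℕ → ℂ} (hc : RegularDenom c) {w : List Letter}
    (hw : IsConvergentWord w) : Small fun M => truncSum c w 0 M - value c w := by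
  obtain ⟨L, hL⟩ := exists_small_truncSum_sub hc hw
  have h : Tendsto (fun M => truncSum c w 0 M) atTop (𝓝 L) := by
    simpa using hL.tendsto.add_const L
  rw [value, h.limUnder_eq]
  exact hL

/-! ### Stuffle product and regularization -/

/-- The truncated value of the word `(1, 1)`, which takes the place of the indeterminate `T`. -/
noncomputable def truncOne (c : ℕ → ℂ) (N M : ℕ) : ℂ := ∑ k ∈ Ioc N M, 1 / c k

theorem logBdd_truncOne {c : ℕ → ℂ} (hc : RegularDenom c) : LogBdd (truncOne c 0) := by
  have h := (logLip_truncSum hc (w := [(1, 1)]) (by simp [ValidWord, ValidLetter])).1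
  have h' : truncOne c 0 = fun M => truncSum c [(1, 1)] 0 M := by
    funext M
    simp [truncSum, truncOne]
  rw [h']
  exact h

/-- The stuffle product with `(1, 1)` holds exactly for truncated sums. -/
theorem truncSum_mul_truncOne {c : ℕ → ℂ} (hc : RegularDenom c) (w : List Letter) (N M : ℕ) :
    truncSum c w N M * truncOne c N M = ((stuffleOne w).map fun v => truncSum c v N M).sum := by
  induction w generalizing N with
  | nil => simp [stuffleOne, truncSum, truncOne]
  | cons a w ih =>
    have h1 : ((stuffleOne w).map fun v => truncSum c (a :: v) N M).sum
        = ∑ k ∈ Ioc N M, letterTerm c a k * (truncSum c w k M * truncOne c k M) := by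
      simp only [truncSum, ih, ← List.sum_map_mul_left]
      generalize stuffleOne w = L
      induction L with
      | nil => simp
      | cons v L ihL => simp [ihL, sum_add_distrib, letterTerm]
    have h2 : truncSum c ((1, 1) :: a :: w) N M
        = ∑ k ∈ Ioc N M, letterTerm c a k * (truncSum c w k M * truncOne c N (k - 1)) := by
      simp only [truncSum, truncOne, mul_sum]
      rw [sum_comm' (t' := Ioc N M) (s' := fun k => Ioc N (k - 1))]
      · refine sum_congr rfl fun k _ => sum_congr rfl fun j _ => ?_
        simp [letterTerm]
        ring
      · intro j k
        simp only [mem_Ioc]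
        omega
    have h3 : truncSum c ((a.1 + 1, a.2) :: w) N M
        = ∑ k ∈ Ioc N M, letterTerm c a k * (truncSum c w k M * (1 / c k)) := by
      simp only [truncSum]
      refine sum_congr rfl fun k hk => ?_
      rw [mem_Ioc] at hk
      have := hc.ne_zero (k := k) (by omega)
      simp only [letterTerm]
      field_simp
      ring
    simp only [stuffleOne, List.map_cons, List.sum_cons, List.map_map, Function.comp_def]
    rw [h1, h2, h3, ← sum_add_distrib, ← sum_add_distrib]
    simp only [truncSum]
    rw [sum_mul]
    refine sum_congr rfl fun k hk => ?_
    rw [mem_Ioc] at hk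
    have h4 : truncOne c N M = truncOne c N (k - 1) + (1 / c k + truncOne c k M) := by
      unfold truncOne
      rw [← sum_Ioc_consecutive _ (by omega : N ≤ k) hk.2,
        ← sum_Ioc_consecutive _ (by omega : N ≤ k - 1) (by omega : k - 1 ≤ k)]
      have : Ioc (k - 1) k = {k} := by
        ext j
        simp only [mem_Ioc, mem_singleton]
        omega
      rw [this, sum_singleton]
      ring
    rw [h4]
    simp only [letterTerm]
    ring

theorem stuffleOne_concat (w : List Letter) (b : Letter) :
    stuffleOne (w ++ [b]) = (stuffleOne w).map (· ++ [b])
      ++ [w ++ [(b.1 + 1, b.2)], w ++ [b, (1, 1)]] := by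
  induction w with
  | nil => simp [stuffleOne]
  | cons a w ih =>
    simp [stuffleOne, ih]

@[simp] theorem trailing_nil : trailing [] = 0 := by simp [trailing]

theorem trailing_concat_one (w : List Letter) : trailing (w ++ [(1, 1)]) = trailing w + 1 := by
  simp [trailing]

theorem trailing_concat_of_ne (w : List Letter) {b : Letter} (hb : b ≠ (1, 1)) :
    trailing (w ++ [b]) = 0 := by
  simp [trailing, hb]

theorem eq_concat_of_trailing {w : List Letter} {k : ℕ} (h : trailing w = k + 1) :
    w = w.dropLast ++ [(1, 1)] ∧ trailing w.dropLast = k := by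
  induction w using List.reverseRecOn with
  | nil => simp at h
  | append_singleton w b _ =>
    by_cases hb : b = (1, 1)
    · subst hb
      rw [trailing_concat_one] at h
      simpa using h
    · rw [trailing_concat_of_ne w hb] at h
      omega

/-- In the stuffle product of a word `w` with `(1, 1)`, the words with more trailing letters
`(1, 1)` than `w` are copies of `w (1, 1)`. -/
theorem sum_stuffleOne {V : Type*} [AddCommMonoid V] (F : List Letter → V) {w : List Letter}
    (hw : ValidWord w) :
    ((stuffleOne w).map F).sum
      = (((stuffleOne w).filter fun v => trailing v ≤ trailing w).map F).sum
        + (trailing w + 1) • F (w ++ [(1, 1)]) := by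
  induction w using List.reverseRecOn generalizing F with
  | nil =>
    have : trailing [(1, 1)] = 1 := trailing_concat_one []
    simp [stuffleOne, this]
  | append_singleton w b ih =>
    have hw' : ValidWord w := fun a ha => hw a (by simp [ha])
    have hb1 : ((b.1 + 1, b.2) : Letter) ≠ (1, 1) := by
      intro h
      have h1 := (hw b (by simp)).1
      have h2 := congrArg Prod.fst h
      simp only at h2
      omega
    have h2 : trailing (w ++ [b, (1, 1)]) = trailing (w ++ [b]) + 1 := by
      rw [← trailing_concat_one, List.append_assoc]
      rfl
    have h3 := trailing_concat_of_ne w hb1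
    rw [stuffleOne_concat]
    simp only [List.filter_append, List.map_append, List.sum_append, List.filter_map, List.map_map,
      List.filter_cons, List.filter_nil, h2, h3]
    by_cases hb : b = (1, 1)
    · subst hb
      simp only [Function.comp_def, trailing_concat_one, add_le_add_iff_right]
      have := ih (fun v => F (v ++ [(1, 1)])) hw'
      rw [this]
      simp [add_smul]
      abel
    · simp only [Function.comp_def, trailing_concat_of_ne w hb, trailing_concat_of_ne _ hb]
      simp [add_assoc]

theorem validWord_of_mem_stuffleOne {w v : List Letter} (hw : ValidWord w)
    (hv : v ∈ stuffleOne w) : ValidWord v := by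
  induction w generalizing v with
  | nil =>
    have : v = [(1, 1)] := by simpa [stuffleOne] using hv
    subst this
    simp [ValidWord, ValidLetter]
  | cons a w ih =>
    have ha : ValidLetter a := hw a (by simp)
    have hw' : ValidWord w := fun b hb => hw b (by simp [hb])
    simp only [stuffleOne, List.mem_cons, List.mem_map] at hv
    rcases hv with rfl | rfl | ⟨u, hu, rfl⟩
    · intro b hb
      simp only [List.mem_cons] at hb
      rcases hb with rfl | rfl | hb
      · simp [ValidLetter]
      · exact ha
      · exact hw' b hb
    · intro b hb
      simp only [List.mem_cons] at hb
      rcases hb with rfl | hb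
      · exact ⟨by simp, ha.2⟩
      · exact hw' b hb
    · intro b hb
      simp only [List.mem_cons] at hb
      rcases hb with rfl | hb
      · exact ha
      · exact ih hw' hu b hb

theorem isConvergentWord_of_trailing {w : List Letter} (hw : ValidWord w) (h : trailing w = 0) :
    IsConvergentWord w := by
  refine ⟨hw, fun h' => ?_⟩
  induction w using List.reverseRecOn with
  | nil => simp at h'
  | append_singleton w b _ =>
    have : b = (1, 1) := by simpa using h'
    subst this
    rw [trailing_concat_one] at h
    omega

theorem regAux_eq_reg (c : ℕ → ℂ) {k : ℕ} {w : List Letter} (h : trailing w ≤ k) :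
    regAux c k w = reg c w := by
  induction k with
  | zero =>
    have : trailing w = 0 := by omega
    rw [reg, this]
  | succ k ih =>
    rcases h.eq_or_lt with h | h
    · rw [reg, h]
    · rw [regAux, if_neg h.ne, ih (by omega)]

theorem reg_of_trailing_eq_zero (c : ℕ → ℂ) {w : List Letter} (h : trailing w = 0) :
    reg c w = Polynomial.C (value c w) := by
  rw [reg, h, regAux]

/-- The recursion that defines the regularization, in terms of the regularization only. -/
theorem reg_concat_one (c : ℕ → ℂ) (w : List Letter) :
    reg c (w ++ [(1, 1)]) = Polynomial.C (1 / ((trailing w : ℂ) + 1)) *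
      (reg c w * Polynomial.X
        - (((stuffleOne w).filter fun v => trailing v ≤ trailing w).map (reg c)).sum) := by
  rw [reg, trailing_concat_one, regAux, if_pos (trailing_concat_one w), List.dropLast_concat,
    regAux_eq_reg c le_rfl]
  have h : ((stuffleOne w).filter fun v => trailing v ≤ trailing w).map (regAux c (trailing w))
      = ((stuffleOne w).filter fun v => trailing v ≤ trailing w).map (reg c) := by
    refine List.map_congr_left fun v hv => regAux_eq_reg c ?_
    simpa using (List.mem_filter.1 hv).2
  rw [h]

/-- Regularization polynomials are homomorphic for the stuffle product with `(1, 1)`. -/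
theorem sum_reg_stuffleOne (c : ℕ → ℂ) {w : List Letter} (hw : ValidWord w) :
    ((stuffleOne w).map (reg c)).sum = reg c w * Polynomial.X := by
  have h : ((trailing w : ℂ) + 1) ≠ 0 := by exact Nat.cast_add_one_ne_zero _
  rw [sum_stuffleOne (reg c) hw, reg_concat_one, nsmul_eq_mul, ← mul_assoc]
  have : (((trailing w + 1 : ℕ) : Polynomial ℂ)) * Polynomial.C (1 / ((trailing w : ℂ) + 1)) = 1 := by
    rw [← map_natCast Polynomial.C, ← Polynomial.C_mul]
    push_cast
    rw [mul_one_div_cancel h, Polynomial.C_1]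
  rw [this]
  ring

/-- The truncated nested sums are polynomials in the truncated value of `(1, 1)`, up to an error
that tends to zero. -/
theorem small_truncSum_sub_reg {c : ℕ → ℂ} (hc : RegularDenom c) {w : List Letter}
    (hw : ValidWord w) : Small fun M => truncSum c w 0 M - (reg c w).eval (truncOne c 0 M) := by
  obtain ⟨k, hk⟩ : ∃ k, trailing w ≤ k := ⟨_, le_rfl⟩
  induction k generalizing w with
  | zero =>
    have h : trailing w = 0 := by omega
    simpa [reg_of_trailing_eq_zero c h] using
      small_truncSum_sub_value hc (isConvergentWord_of_trailing hw h)
  | succ k ih =>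
    rcases hk.eq_or_lt with h | h
    swap
    · exact ih hw (by omega)
    obtain ⟨h1, h2⟩ := eq_concat_of_trailing h
    set u := w.dropLast with hu
    have hu' : ValidWord u := fun a ha => hw a (by rw [h1]; simp [ha])
    have h0 : ((k : ℂ) + 1) ≠ 0 := by exact Nat.cast_add_one_ne_zero _
    have h3 : ∀ M, truncSum c w 0 M - (reg c w).eval (truncOne c 0 M) =
        1 / ((k : ℂ) + 1) * ((truncSum c u 0 M - (reg c u).eval (truncOne c 0 M)) * truncOne c 0 M
          - (((stuffleOne u).filter fun v => trailing v ≤ k).map fun v =>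
            truncSum c v 0 M - (reg c v).eval (truncOne c 0 M)).sum) := by
      intro M
      have h4 := truncSum_mul_truncOne hc u 0 M
      rw [sum_stuffleOne _ hu', ← h1, h2, nsmul_eq_mul] at h4
      have h5 : (((stuffleOne u).filter fun v => trailing v ≤ k).map fun v =>
          truncSum c v 0 M - (reg c v).eval (truncOne c 0 M)).sum
          = (((stuffleOne u).filter fun v => trailing v ≤ k).map fun v => truncSum c v 0 M).sum
            - ((((stuffleOne u).filter fun v => trailing v ≤ k).map (reg c)).sum).eval
              (truncOne c 0 M) := by
        generalize (stuffleOne u).filter (fun v => trailing v ≤ k) = L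
        induction L with
        | nil => simp
        | cons v L ihL =>
          simp only [List.map_cons, List.sum_cons, Polynomial.eval_add, ihL]
          ring
      rw [h5, sub_mul, h4]
      conv_lhs => rw [h1, reg_concat_one, h2, ← h1]
      simp only [Polynomial.eval_mul, Polynomial.eval_C, Polynomial.eval_sub, Polynomial.eval_X]
      push_cast
      field_simp
      ring
    simp only [h3]
    refine Small.const_mul (Small.sub ?_ ?_) _
    · exact (ih hu' (by omega)).mul (logBdd_truncOne hc)
    · refine Small.listSum _ fun v hv => ?_
      rw [List.mem_filter] at hv
      exact ih (validWord_of_mem_stuffleOne hu' hv.1) (by simpa using hv.2)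

theorem derivative_reg_concat_of_ne (c : ℕ → ℂ) (w : List Letter) {b : Letter}
    (hb : b ≠ (1, 1)) : Polynomial.derivative (reg c (w ++ [b])) = 0 := by
  rw [reg_of_trailing_eq_zero c (trailing_concat_of_ne w hb), Polynomial.derivative_C]

/-- The derivative with respect to `T` removes a final letter `(1, 1)`. -/
theorem derivative_reg_concat_one (c : ℕ → ℂ) {w : List Letter} (hw : ValidWord w) :
    Polynomial.derivative (reg c (w ++ [(1, 1)])) = reg c w := by
  obtain ⟨n, hn⟩ : ∃ n, trailing w ≤ n := ⟨_, le_rfl⟩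
  induction n using Nat.strong_induction_on generalizing w with
  | _ n ih =>
  have hprod := congrArg Polynomial.derivative (sum_reg_stuffleOne c hw)
  rcases List.eq_nil_or_concat w with rfl | ⟨u, b, rfl⟩
  · simpa [stuffleOne, reg_of_trailing_eq_zero c trailing_nil, value, truncSum,
      tendsto_const_nhds.limUnder_eq] using hprod
  rw [List.concat_eq_append] at *
  have hu : ValidWord u := fun a ha => hw a (by simp [ha])
  have hb1 : ((b.1 + 1, b.2) : Letter) ≠ (1, 1) := by
    intro h
    have h1 := (hw b (by simp)).1
    have h2 := congrArg Prod.fst h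
    simp only at h2
    omega
  have e1 : u ++ [b, (1, 1)] = u ++ [b] ++ [(1, 1)] := by simp
  have hlin : ∀ L : List (List Letter), Polynomial.derivative (L.map (reg c)).sum
      = (L.map fun v => Polynomial.derivative (reg c v)).sum := fun L => by
    induction L with
    | nil => simp
    | cons v L ihL => simp [ihL]
  rw [hlin, stuffleOne_concat, List.map_append, List.sum_append, List.map_map] at hprod
  simp only [Function.comp_def, List.map_cons, List.map_nil, List.sum_cons, List.sum_nil, add_zero,
    derivative_reg_concat_of_ne c u hb1, zero_add, e1] at hprod
  by_cases hb : b = (1, 1)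
  · subst hb
    rw [trailing_concat_one] at hn
    have hcopies := sum_stuffleOne (fun v => Polynomial.derivative (reg c (v ++ [(1, 1)]))) hu
    have hfilter : (((stuffleOne u).filter fun v => trailing v ≤ trailing u).map fun v =>
        Polynomial.derivative (reg c (v ++ [(1, 1)])))
        = ((stuffleOne u).filter fun v => trailing v ≤ trailing u).map (reg c) := by
      refine List.map_congr_left fun v hv => ?_
      rw [List.mem_filter] at hv
      have h1 : trailing v ≤ trailing u := by simpa using hv.2
      exact ih (trailing u) (by omega) (validWord_of_mem_stuffleOne hu hv.1) h1
    have hsum := sum_stuffleOne (reg c) hu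
    rw [sum_reg_stuffleOne c hu] at hsum
    rw [hcopies, hfilter, Polynomial.derivative_mul, Polynomial.derivative_X,
      ih (trailing u) (by omega) hu le_rfl, hsum] at hprod
    have h0 : ((trailing u : Polynomial ℂ) + 2) ≠ 0 := by
      exact_mod_cast (by omega : trailing u + 2 ≠ 0)
    refine mul_left_cancel₀ h0 ?_
    simp only [nsmul_eq_mul] at hprod
    push_cast at hprod
    linear_combination hprod
  · simp only [derivative_reg_concat_of_ne c _ hb] at hprod
    rw [Polynomial.derivative_mul, derivative_reg_concat_of_ne c _ hb] at hprod
    simpa using hprod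

/-! ### The two harmonic sums -/

/-- The sum over odd denominators, as the sum over all denominators minus the even ones. -/
theorem truncOne_tDenom (M : ℕ) :
    truncOne tDenom 0 M = truncOne zetaDenom 0 (2 * M) - truncOne zetaDenom 0 M / 2 := by
  induction M with
  | zero => simp [truncOne]
  | succ M ih =>
    unfold truncOne at *
    rw [Nat.mul_succ, sum_Ioc_succ_top (Nat.zero_le _), sum_Ioc_succ_top (Nat.zero_le M),
      sum_Ioc_succ_top (by omega : 0 ≤ 2 * M + 1), sum_Ioc_succ_top (by omega : 0 ≤ 2 * M), ih]
    simp only [tDenom, zetaDenom]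
    have h1 : ((M : ℂ) + 1) ≠ 0 := Nat.cast_add_one_ne_zero M
    have h2 : ((2 * M : ℕ) : ℂ) + 1 ≠ 0 := Nat.cast_add_one_ne_zero _
    push_cast at h2 ⊢
    have h3 : 2 * ((M : ℂ) + 1) - 1 = 2 * M + 1 := by ring
    have h4 : 2 * (M : ℂ) + 1 + 1 = 2 * (M + 1) := by ring
    rw [h3, h4]
    field_simp
    ring

theorem truncOne_zetaDenom (M : ℕ) : truncOne zetaDenom 0 M = (lam M - 1 : ℝ) := by
  unfold truncOne lam zetaDenom
  induction M with
  | zero => simp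
  | succ M ih =>
    rw [sum_Ioc_succ_top (Nat.zero_le M), sum_range_succ, ih]
    push_cast
    ring

theorem abs_lam_two_mul_sub_le (M : ℕ) :
    |lam (2 * M) - lam M - Real.log 2| ≤ 1 / ((M : ℝ) + 1) := by
  have hsum : ∀ n : ℕ, lam (M + (n + 1)) - lam M = (lam (M + n) - lam M) + 1 / ((M : ℝ) + n + 1) :=
    fun n => by
      rw [← add_assoc, lam_succ]
      push_cast
      ring
  have lower : ∀ n : ℕ, Real.log (M + n + 1) - Real.log (M + 1) ≤ lam (M + n) - lam M := fun n => by
    induction n with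
    | zero => simp
    | succ n ih =>
      have h0 : (0 : ℝ) < (M : ℝ) + n + 1 := by positivity
      have h1 := Real.log_le_sub_one_of_pos
        (show (0 : ℝ) < ((M : ℝ) + (n + 1 : ℕ) + 1) / (M + n + 1) by positivity)
      rw [Real.log_div (by positivity) h0.ne'] at h1
      have h2 : ((M : ℝ) + (n + 1 : ℕ) + 1) / (M + n + 1) - 1 = 1 / (M + n + 1) := by
        push_cast
        field_simp
        ring
      rw [hsum]
      linarith
  have hlow := lower M
  have h1 := Real.one_sub_inv_le_log_of_pos
    (show (0 : ℝ) < ((M : ℝ) + M + 1) / (2 * (M + 1)) by positivity)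
  rw [Real.log_div (by positivity) (by positivity), Real.log_mul (by norm_num) (by positivity),
    inv_div] at h1
  have h2 : 1 - 2 * ((M : ℝ) + 1) / (M + M + 1) = -(1 / (M + M + 1)) := by
    field_simp
    ring
  have h3 : 1 / ((M : ℝ) + M + 1) ≤ 1 / (M + 1) := by
    gcongr
    linarith [(Nat.cast_nonneg M : (0 : ℝ) ≤ M)]
  rw [two_mul, abs_le]
  refine ⟨by linarith, ?_⟩
  rcases Nat.eq_zero_or_pos M with rfl | hM
  · have := Real.log_pos (by norm_num : (1 : ℝ) < 2)
    simp
    linarith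
  have hM' : (0 : ℝ) < M := by exact_mod_cast hM
  have upper : ∀ n : ℕ, lam (M + n) - lam M ≤ Real.log (M + n) - Real.log M := fun n => by
    induction n with
    | zero => simp
    | succ n ih =>
      have h0 : (0 : ℝ) < (M : ℝ) + n + 1 := by positivity
      have h1 := Real.one_sub_inv_le_log_of_pos
        (show (0 : ℝ) < ((M : ℝ) + (n + 1 : ℕ)) / (M + n) by positivity)
      rw [Real.log_div (by positivity) (by positivity), inv_div] at h1
      have h2 : 1 - ((M : ℝ) + n) / (M + (n + 1 : ℕ)) = 1 / (M + n + 1) := by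
        push_cast
        field_simp
        ring
      rw [hsum]
      linarith
  have hup := upper M
  have h4 : Real.log ((M : ℝ) + M) = Real.log 2 + Real.log M := by
    rw [← two_mul, Real.log_mul (by norm_num) hM'.ne']
  have h5 : 0 ≤ 1 / ((M : ℝ) + 1) := by positivity
  linarith

/-- The two indeterminates are related by `T_t = T / 2 + log 2`. -/
theorem small_truncOne_tDenom_sub :
    Small fun M => truncOne tDenom 0 M - (truncOne zetaDenom 0 M / 2 + Real.log 2) := by
  refine ⟨1, 0, zero_le_one, fun M => ?_⟩
  have h : truncOne tDenom 0 M - (truncOne zetaDenom 0 M / 2 + Real.log 2)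
      = ((lam (2 * M) - lam M - Real.log 2 : ℝ) : ℂ) := by
    rw [truncOne_tDenom, truncOne_zetaDenom, truncOne_zetaDenom]
    push_cast
    ring
  simp only [h, Complex.norm_real, Real.norm_eq_abs]
  simpa using abs_lam_two_mul_sub_le M

end MultipleT

namespace MultipleT

open Finset

/-! ### Nested sums over integers -/

section Nest

variable {ι κ R S V : Type*} [CommRing R] [CommRing S] [AddCommMonoid V]

/-- The nested sum `∑_{A < k₁ < ⋯ < k_d < B} ∏ᵢ g(xᵢ, kᵢ)` over integers attached to a list
`[x₁, …, x_d]`. -/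
noncomputable def nest (g : ι → ℤ → R) : List ι → ℤ → ℤ → R
  | [], _, _ => 1
  | x :: l, A, B => ∑ k ∈ Ioo A B, g x k * nest g l k B

theorem nest_concat (g : ι → ℤ → R) (l : List ι) (x : ι) (A B : ℤ) :
    nest g (l ++ [x]) A B = ∑ k ∈ Ioo A B, g x k * nest g l A k := by
  induction l generalizing A with
  | nil => simp [nest]
  | cons y l ih =>
    simp only [List.cons_append, nest, ih, mul_sum]
    rw [sum_comm' (t' := Ioo A B) (s' := fun k => Ioo A k)]
    · refine sum_congr rfl fun k _ => sum_congr rfl fun j _ => ?_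
      ring
    · intro j k
      simp only [mem_Ioo]
      omega

theorem nest_map (g : ι → ℤ → R) (f : κ → ι) (l : List κ) (A B : ℤ) :
    nest g (l.map f) A B = nest (fun i => g (f i)) l A B := by
  induction l generalizing A with
  | nil => rfl
  | cons y l ih => simp only [List.map_cons, nest, ih]

theorem nest_congr {g g' : ι → ℤ → R} {l : List ι} {A B : ℤ}
    (h : ∀ i ∈ l, ∀ k, A < k → k < B → g i k = g' i k) : nest g l A B = nest g' l A B := by
  induction l generalizing A with
  | nil => rfl
  | cons y l ih =>
    simp only [nest]
    refine sum_congr rfl fun k hk => ?_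
    rw [mem_Ioo] at hk
    rw [h y (by simp) k hk.1 hk.2,
      ih fun i hi j hj hj' => h i (by simp [hi]) j (hk.1.trans hj) hj']

theorem map_nest (f : R →+* S) (g : ι → ℤ → R) (l : List ι) (A B : ℤ) :
    f (nest g l A B) = nest (fun i k => f (g i k)) l A B := by
  induction l generalizing A with
  | nil => simp [nest]
  | cons y l ih => simp [nest, map_sum, ih]

theorem nest_mul_left (c : ι → R) (g : ι → ℤ → R) (l : List ι) (A B : ℤ) :
    nest (fun i k => c i * g i k) l A B = (l.map c).prod * nest g l A B := by
  induction l generalizing A with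
  | nil => simp [nest]
  | cons y l ih =>
    simp only [nest, ih, List.map_cons, List.prod_cons, mul_sum]
    refine sum_congr rfl fun k _ => ?_
    ring

theorem nest_shift (g : ι → ℤ → R) (l : List ι) (A B c : ℤ) :
    nest g l A B = nest (fun i k => g i (k + c)) l (A - c) (B - c) := by
  induction l generalizing A with
  | nil => rfl
  | cons y l ih =>
    simp only [nest]
    refine sum_bij' (fun k _ => k - c) (fun k _ => k + c) ?_ ?_ ?_ ?_ ?_
    · intro k hk
      rw [mem_Ioo] at *
      omega
    · intro k hk
      rw [mem_Ioo] at *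
      omega
    · intros
      ring
    · intros
      ring
    · intro k _
      simp only [sub_add_cancel]
      rw [ih]

theorem nest_reverse (g : ι → ℤ → R) (l : List ι) (A B c : ℤ) :
    nest g l.reverse A B = nest (fun i k => g i (c - k)) l (c - B) (c - A) := by
  induction l generalizing B with
  | nil => rfl
  | cons y l ih =>
    simp only [List.reverse_cons, nest_concat, nest]
    refine sum_bij' (fun k _ => c - k) (fun k _ => c - k) ?_ ?_ ?_ ?_ ?_
    · intro k hk
      rw [mem_Ioo] at *
      omega
    · intro k hk
      rw [mem_Ioo] at *
      omega
    · intros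
      ring
    · intros
      ring
    · intro k _
      simp only [sub_sub_cancel]
      rw [ih]

/-- A nested sum is cut at `C` into the indices below `C` and the indices from `C` on. -/
theorem nest_cut (g : ι → ℤ → R) (l : List ι) {A B C : ℤ} (hA : A < C) (hB : C ≤ B) :
    nest g l A B = ∑ j ∈ range (l.length + 1),
      nest g (l.take j) A C * nest g (l.drop j) (C - 1) B := by
  induction l generalizing A with
  | nil => simp [nest]
  | cons y l ih =>
    rw [List.length_cons, sum_range_succ']
    simp only [List.take_zero, List.drop_zero, List.take_succ_cons, List.drop_succ_cons]
    have h1 : Ioo A B = Ioo A C ∪ Ioo (C - 1) B := by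
      ext k
      simp only [mem_Ioo, mem_union]
      omega
    have h2 : Disjoint (Ioo A C) (Ioo (C - 1) B) := by
      rw [disjoint_left]
      intro k
      simp only [mem_Ioo]
      omega
    simp only [nest, one_mul]
    rw [h1, sum_union h2]
    congr 1
    simp only [sum_mul]
    rw [sum_comm]
    refine sum_congr rfl fun k hk => ?_
    rw [mem_Ioo] at hk
    rw [ih hk.2, mul_sum]
    refine sum_congr rfl fun j _ => ?_
    ring

/-- The sum of `F(xₚ₋₁ ⋯ x₁, xₚ, xₚ₊₁ ⋯ x_d)` over all places `p` of a list. The part in front of the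
chosen place is passed in reverse order; the first list argument is what precedes the list. -/
def splitSum (F : List ι → ι → List ι → V) : List ι → List ι → V
  | _, [] => 0
  | pre, x :: r => F pre x r + splitSum F (x :: pre) r

theorem splitSum_congr {F G : List ι → ι → List ι → V} {pre l : List ι}
    (h : ∀ p x r, p.reverse ++ x :: r = pre.reverse ++ l → F p x r = G p x r) :
    splitSum F pre l = splitSum G pre l := by
  induction l generalizing pre with
  | nil => rfl
  | cons y l ih =>
    simp only [splitSum]
    rw [h pre y l rfl, ih fun p x r hp => h p x r (by simpa using hp)]

theorem splitSum_pre_concat (F : List ι → ι → List ι → V) (pre l : List ι) (y : ι) :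
    splitSum F (pre ++ [y]) l = splitSum (fun p x r => F (p ++ [y]) x r) pre l := by
  induction l generalizing pre with
  | nil => rfl
  | cons z l ih =>
    simp only [splitSum]
    rw [← ih (z :: pre)]
    rfl

theorem splitSum_concat (F : List ι → ι → List ι → V) (pre l : List ι) (y : ι) :
    splitSum F pre (l ++ [y])
      = splitSum (fun p x r => F p x (r ++ [y])) pre l + F (l.reverse ++ pre) y [] := by
  induction l generalizing pre with
  | nil => simp [splitSum]
  | cons z l ih => simp [splitSum, ih, add_assoc]

theorem map_splitSum {W : Type*} [AddCommMonoid W] (f : V →+ W) (F : List ι → ι → List ι → V)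
    (pre l : List ι) : f (splitSum F pre l) = splitSum (fun p x r => f (F p x r)) pre l := by
  induction l generalizing pre with
  | nil => simp [splitSum]
  | cons z l ih => simp [splitSum, ih]

theorem splitSum_sum (s : Finset κ) (F : κ → List ι → ι → List ι → V) (pre l : List ι) :
    splitSum (fun p x r => ∑ k ∈ s, F k p x r) pre l = ∑ k ∈ s, splitSum (F k) pre l := by
  induction l generalizing pre with
  | nil => simp [splitSum]
  | cons z l ih => simp [splitSum, ih, sum_add_distrib]

theorem splitSum_add (F G : List ι → ι → List ι → V) (pre l : List ι) :
    splitSum (fun p x r => F p x r + G p x r) pre l = splitSum F pre l + splitSum G pre l := by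
  induction l generalizing pre with
  | nil => simp [splitSum]
  | cons z l ih =>
    simp only [splitSum, ih]
    abel

theorem mul_splitSum (c : R) (F : List ι → ι → List ι → R) (pre l : List ι) :
    c * splitSum F pre l = splitSum (fun p x r => c * F p x r) pre l :=
  map_splitSum (AddMonoidHom.mulLeft c) F pre l

/-- The sum of `F [(x₁, k₁), …, (x_d, k_d)]` over `A < k₁ < ⋯ < k_d < B`. -/
noncomputable def tupleSum : List ι → ℤ → ℤ → (List (ι × ℤ) → V) → V
  | [], _, _, F => F []
  | x :: l, A, B, F => ∑ k ∈ Ioo A B, tupleSum l k B fun t => F ((x, k) :: t)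

theorem tupleSum_congr {F G : List (ι × ℤ) → V} {l : List ι} {A B : ℤ}
    (h : ∀ ts : List (ι × ℤ), ts.map Prod.fst = l → (∀ t ∈ ts, A < t.2) →
      ts.Pairwise (fun s t => s.2 < t.2) → F ts = G ts) :
    tupleSum l A B F = tupleSum l A B G := by
  induction l generalizing A F G with
  | nil => exact h [] rfl (by simp) (by simp)
  | cons x l ih =>
    simp only [tupleSum]
    refine sum_congr rfl fun k hk => ?_
    rw [mem_Ioo] at hk
    refine ih fun ts h1 h2 h3 => h _ (by simp [h1]) ?_ ?_
    · intro t ht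
      rcases List.mem_cons.1 ht with rfl | ht
      · exact hk.1
      · exact hk.1.trans (h2 t ht)
    · exact List.pairwise_cons.2 ⟨fun t ht => h2 t ht, h3⟩

theorem tupleSum_add (F G : List (ι × ℤ) → V) (l : List ι) (A B : ℤ) :
    tupleSum l A B (fun ts => F ts + G ts) = tupleSum l A B F + tupleSum l A B G := by
  induction l generalizing A F G with
  | nil => rfl
  | cons x l ih => simp only [tupleSum, ih, sum_add_distrib]

theorem tupleSum_zero (l : List ι) (A B : ℤ) : tupleSum l A B (fun _ => (0 : V)) = 0 := by
  induction l generalizing A with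
  | nil => rfl
  | cons x l ih => simp [tupleSum, ih]

theorem tupleSum_mul_prod (c : R) (g : ι × ℤ → R) (l : List ι) (A B : ℤ) :
    tupleSum l A B (fun ts => c * (ts.map g).prod) = c * nest (fun i k => g (i, k)) l A B := by
  induction l generalizing A c with
  | nil => simp [tupleSum, nest]
  | cons x l ih =>
    simp only [tupleSum, nest, List.map_cons, List.prod_cons, ← mul_assoc, ih, mul_sum]

/-- A sum over increasing tuples of a sum over the places of the tuple, the summand being a product
over the other places: for a fixed place and a fixed entry `c` there, the entries on both sides of
it vary independently. -/
theorem tupleSum_splitSum (v : ι × ℤ → R) (u w : ι × ℤ → ι × ℤ → R) (tp : List (ι × ℤ))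
    (l : List ι) (A B : ℤ) :
    tupleSum l A B (fun ts => splitSum
      (fun tp t ts => v t * (tp.map (u t)).prod * (ts.map (w t)).prod) tp ts)
      = splitSum (fun pre x r => ∑ c ∈ Ioo A B, v (x, c) * (tp.map (u (x, c))).prod
          * nest (fun i k => u (x, c) (i, k)) pre.reverse A c
          * nest (fun i k => w (x, c) (i, k)) r c B) [] l := by
  induction l generalizing A tp with
  | nil => simp [tupleSum, splitSum]
  | cons y l ih =>
    simp only [tupleSum, splitSum, tupleSum_add, tupleSum_mul_prod, ih, sum_add_distrib]
    congr 1
    · simp [nest]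
    · rw [show ([y] : List ι) = [] ++ [y] from rfl, splitSum_pre_concat, ← splitSum_sum]
      refine splitSum_congr fun p x r _ => ?_
      rw [sum_comm' (t' := Ioo A B) (s' := fun c => Ioo A c)]
      · refine sum_congr rfl fun c _ => ?_
        simp only [List.reverse_append, List.reverse_cons, List.reverse_nil, List.nil_append,
          List.singleton_append, nest, List.map_cons, List.prod_cons, mul_sum, sum_mul]
        refine sum_congr rfl fun k _ => ?_
        ring
      · intro j k
        simp only [mem_Ioo]
        omega

end Nest

/-! ### Partial fractions -/

section PartialFractions

variable {τ R : Type*} [CommRing R]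

/-- The partial fraction expansion `∏ 1 / xₜ = ∑ₜ 1 / xₜ ∏_{s ≠ t} 1 / (xₛ - xₜ)` in a ring in which
the elements `xₜ` have inverses `I t` and the differences `xₛ - xₜ` have inverses `D t s`. -/
theorem prod_inv_eq_splitSum (I X : τ → R) (D : τ → τ → R) {ts : List τ} (hne : ts ≠ [])
    (hI : ∀ t ∈ ts, I t * X t = 1)
    (hD : ts.Pairwise fun s t => D t s * (X s - X t) = 1 ∧ D s t * (X t - X s) = 1) :
    (ts.map I).prod = splitSum
      (fun pre t r => I t * (pre.map (D t)).prod * (r.map (D t)).prod) [] ts := by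
  induction ts generalizing I X with
  | nil => exact absurd rfl hne
  | cons t₀ ts ih =>
    rw [List.pairwise_cons] at hD
    rcases eq_or_ne ts [] with rfl | hts
    · simp [splitSum]
    have h1 := ih I X hts (fun t ht => hI t (by simp [ht])) hD.2
    have h2 := ih (D t₀) (fun t => X t - X t₀) hts (fun t ht => (hD.1 t ht).2)
      (hD.2.imp fun h => by simpa using h)
    rw [List.map_cons, List.prod_cons, h1, splitSum, h2,
      show ([t₀] : List τ) = [] ++ [t₀] from rfl, splitSum_pre_concat, List.map_nil,
      List.prod_nil, mul_one, mul_splitSum, mul_splitSum, ← splitSum_add]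
    refine splitSum_congr fun p t r h => ?_
    have ht : t ∈ ts := by
      have : t ∈ p.reverse ++ t :: r := by simp
      rw [h] at this
      simpa using this
    have e0 := hI t₀ (by simp)
    have e1 := hI t (by simp [ht])
    obtain ⟨e2, e3⟩ := hD.1 t ht
    have e4 : D t t₀ = -D t₀ t := by
      linear_combination (-D t₀ t) * e2 - (D t t₀) * e3
    have e5 : I t₀ * I t = I t₀ * D t₀ t + I t * D t t₀ := by
      rw [e4]
      linear_combination (-I t₀ * I t) * e3 + (I t₀ * D t₀ t) * e1 - (I t * D t₀ t) * e0
    simp only [List.map_append, List.prod_append, List.map_cons, List.map_nil, List.prod_cons,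
      List.prod_nil, mul_one]
    linear_combination ((p.map (D t)).prod * (r.map (D t)).prod) * e5

/-- The coefficient sum of the partial fraction expansion of at least two factors vanishes. -/
theorem splitSum_prod_inv_sub_eq_zero (X : τ → R) (D : τ → τ → R) {ts : List τ}
    (hlen : 2 ≤ ts.length)
    (hD : ts.Pairwise fun s t => D t s * (X s - X t) = 1 ∧ D s t * (X t - X s) = 1) :
    splitSum (fun pre t r => (pre.map (D t)).prod * (r.map (D t)).prod) [] ts = 0 := by
  rcases ts with _ | ⟨t₀, ts⟩
  · simp at hlen
  rw [List.pairwise_cons] at hD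
  have hts : ts ≠ [] := by
    rintro rfl
    simp at hlen
  have h2 := prod_inv_eq_splitSum (D t₀) (fun t => X t - X t₀) D hts
    (fun t ht => (hD.1 t ht).2) (hD.2.imp fun h => by simpa using h)
  rw [splitSum, h2, show ([t₀] : List τ) = [] ++ [t₀] from rfl, splitSum_pre_concat, List.map_nil,
    List.prod_nil, one_mul, ← splitSum_add]
  have h0 : ∀ l : List τ, splitSum (fun _ _ _ => (0 : R)) [] l = 0 := fun l => by
    simpa using mul_splitSum (0 : R) (fun _ _ _ => (0 : R)) [] l |>.symm
  rw [← h0 ts]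
  refine splitSum_congr fun p t r h => ?_
  have ht : t ∈ ts := by
    have : t ∈ p.reverse ++ t :: r := by simp
    rw [h] at this
    simpa using this
  obtain ⟨e2, e3⟩ := hD.1 t ht
  have e4 : D t t₀ = -D t₀ t := by
    linear_combination (-D t₀ t) * e2 - (D t t₀) * e3
  simp only [List.map_append, List.prod_append, List.map_cons, List.map_nil, List.prod_cons,
    List.prod_nil, mul_one, e4]
  ring

end PartialFractions

end MultipleT

namespace MultipleT

open Finset MvPowerSeries

/-! ### Coefficients of generating series -/

section Coefficients

variable {σ V W : Type*} [AddCommMonoid V] [Module ℂ V] [AddCommMonoid W] [Module ℂ W]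

theorem sum_Ioo_int {V : Type*} [AddCommMonoid V] (f : ℤ → V) (N M : ℕ) :
    ∑ k ∈ Ioo (N : ℤ) (M + 1), f k = ∑ k ∈ Ioc N M, f k := by
  refine sum_bij' (fun k _ => k.toNat) (fun k _ => (k : ℤ)) ?_ ?_ ?_ ?_ ?_
  · intro k hk
    simp only [mem_Ioo, mem_Ioc] at *
    omega
  · intro k hk
    simp only [mem_Ioo, mem_Ioc] at *
    omega
  · intro k hk
    simp only [mem_Ioo] at hk
    omega
  · intro k hk
    simp
  · intro k hk
    simp only [mem_Ioo] at hk
    rw [Int.toNat_of_nonneg (by omega)]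

theorem norm_e (φ : ℝ) : ‖e φ‖ = 1 := by
  unfold e
  rw [Complex.norm_exp]
  simp

/-- The sum of `F` over all words `(d₁ + 1, e(φ₁)) ⋯ (d_l + 1, e(φ_l))`, weighted by the coefficients
at `n` of the series `G a₁ ^ d₁ ⋯ a_l ^ d_l`. Only exponents `dᵢ` up to the degree of `n` occur, since
in practice the `aᵢ` have no constant term. -/
noncomputable def wordSum (n : σ →₀ ℕ) :
    (List Letter → V) → List (ℝ × MvPowerSeries σ ℂ) → MvPowerSeries σ ℂ → V
  | F, [], G => coeff n G • F []
  | F, x :: p, G =>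
    ∑ r ∈ range (n.degree + 1), wordSum n (fun w => F ((r + 1, e x.1) :: w)) p (G * x.2 ^ r)

theorem map_wordSum (f : V →ₗ[ℂ] W) (n : σ →₀ ℕ) (F : List Letter → V)
    (p : List (ℝ × MvPowerSeries σ ℂ)) (G : MvPowerSeries σ ℂ) :
    f (wordSum n F p G) = wordSum n (fun w => f (F w)) p G := by
  induction p generalizing F G with
  | nil => simp [wordSum]
  | cons x p ih => simp [wordSum, ih]

theorem wordSum_congr {n : σ →₀ ℕ} {F F' : List Letter → V}
    (h : ∀ w, ValidWord w → F w = F' w) (p : List (ℝ × MvPowerSeries σ ℂ))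
    (G : MvPowerSeries σ ℂ) : wordSum n F p G = wordSum n F' p G := by
  induction p generalizing F F' G with
  | nil => simp [wordSum, h [] (by simp [ValidWord])]
  | cons x p ih =>
    simp only [wordSum]
    refine sum_congr rfl fun r _ => ih (fun w hw => h _ ?_) _
    intro a ha
    rcases List.mem_cons.1 ha with rfl | ha
    · exact ⟨by simp, norm_e _⟩
    · exact hw a ha

theorem wordSum_zero (n : σ →₀ ℕ) (p : List (ℝ × MvPowerSeries σ ℂ)) (G : MvPowerSeries σ ℂ) :
    wordSum n (fun _ => (0 : V)) p G = 0 := by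
  induction p generalizing G with
  | nil => simp [wordSum]
  | cons x p ih => simp [wordSum, ih]

theorem wordSum_sub (n : σ →₀ ℕ) (F F' : List Letter → ℂ) (p : List (ℝ × MvPowerSeries σ ℂ))
    (G : MvPowerSeries σ ℂ) :
    wordSum n (fun w => F w - F' w) p G = wordSum n F p G - wordSum n F' p G := by
  induction p generalizing F F' G with
  | nil => simp [wordSum, mul_sub]
  | cons x p ih => simp [wordSum, ih, sum_sub_distrib]

theorem wordSum_sum {κ : Type*} (s : Finset κ) (n : σ →₀ ℕ) (F : κ → List Letter → V)
    (p : List (ℝ × MvPowerSeries σ ℂ)) (G : MvPowerSeries σ ℂ) :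
    wordSum n (fun w => ∑ k ∈ s, F k w) p G = ∑ k ∈ s, wordSum n (F k) p G := by
  induction p generalizing F G with
  | nil => simp [wordSum, smul_sum]
  | cons x p ih =>
    simp only [wordSum, ih]
    rw [sum_comm]

theorem wordSum_concat (n : σ →₀ ℕ) (F : List Letter → V) (p : List (ℝ × MvPowerSeries σ ℂ))
    (x : ℝ × MvPowerSeries σ ℂ) (G : MvPowerSeries σ ℂ) :
    wordSum n F (p ++ [x]) G = ∑ r ∈ range (n.degree + 1),
      wordSum n (fun w => F (w ++ [(r + 1, e x.1)])) p (G * x.2 ^ r) := by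
  induction p generalizing F G with
  | nil => simp [wordSum]
  | cons y p ih =>
    simp only [List.cons_append, wordSum, ih]
    rw [sum_comm]
    refine sum_congr rfl fun r _ => sum_congr rfl fun s _ => ?_
    rw [mul_right_comm]

theorem small_wordSum (n : σ →₀ ℕ) {F : List Letter → ℕ → ℂ}
    (h : ∀ w, ValidWord w → Small (F w)) (p : List (ℝ × MvPowerSeries σ ℂ))
    (G : MvPowerSeries σ ℂ) : Small fun M => wordSum n (fun w => F w M) p G := by
  induction p generalizing F G with
  | nil =>
    simp only [wordSum, smul_eq_mul]
    exact (h [] (by simp [ValidWord])).const_mul _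
  | cons x p ih =>
    simp only [wordSum]
    refine Small.sum _ fun r _ => ih (F := fun w => F ((r + 1, e x.1) :: w)) (fun w hw => h _ ?_) _
    intro a ha
    rcases List.mem_cons.1 ha with rfl | ha
    · exact ⟨by simp, norm_e _⟩
    · exact hw a ha

theorem logBdd_wordSum (n : σ →₀ ℕ) {F : List Letter → ℕ → ℂ}
    (h : ∀ w, ValidWord w → LogBdd (F w)) (p : List (ℝ × MvPowerSeries σ ℂ))
    (G : MvPowerSeries σ ℂ) : LogBdd fun M => wordSum n (fun w => F w M) p G := by
  induction p generalizing F G with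
  | nil =>
    simp only [wordSum, smul_eq_mul]
    exact (logBdd_const _).mul (h [] (by simp [ValidWord]))
  | cons x p ih =>
    simp only [wordSum]
    refine LogBdd.sum _ fun r _ => ih (F := fun w => F ((r + 1, e x.1) :: w)) (fun w hw => h _ ?_) _
    intro a ha
    rcases List.mem_cons.1 ha with rfl | ha
    · exact ⟨by simp, norm_e _⟩
    · exact hw a ha

theorem coeff_mul_pow_eq_zero {n : σ →₀ ℕ} {a : MvPowerSeries σ ℂ} (ha : constantCoeff a = 0)
    {r : ℕ} (hr : n.degree < r) (G : MvPowerSeries σ ℂ) : coeff n (G * a ^ r) = 0 := by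
  refine coeff_of_lt_order ?_
  calc (n.degree : ℕ∞) < r := by exact_mod_cast hr
    _ ≤ (a ^ r).order := le_order_pow_of_constantCoeff_eq_zero r ha
    _ ≤ G.order + (a ^ r).order := le_add_self
    _ ≤ _ := le_order_mul

/-- The geometric series `1 / (c - a) = ∑ a ^ r / c ^ (r + 1)` on coefficients. -/
theorem coeff_mul_inv_C_sub {n : σ →₀ ℕ} {a : MvPowerSeries σ ℂ} (ha : constantCoeff a = 0)
    {c : ℂ} (hc : c ≠ 0) (G : MvPowerSeries σ ℂ) :
    coeff n (G * (C c - a)⁻¹)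
      = ∑ r ∈ range (n.degree + 1), 1 / c ^ (r + 1) * coeff n (G * a ^ r) := by
  have h0 : constantCoeff (C c - a) ≠ 0 := by simpa [ha] using hc
  have hcc : (C c : MvPowerSeries σ ℂ) * C c⁻¹ = 1 := by rw [← map_mul, mul_inv_cancel₀ hc, map_one]
  have h1 : (C c - a)⁻¹ = ∑ r ∈ range (n.degree + 1), C (1 / c ^ (r + 1)) * a ^ r
      + C (1 / c ^ (n.degree + 1)) * (C c - a)⁻¹ * a ^ (n.degree + 1) := by
    have h2 : ∀ D : ℕ, (C c - a) * ∑ r ∈ range D, C (1 / c ^ (r + 1)) * a ^ r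
        = 1 - C (1 / c ^ D) * a ^ D := fun D => by
      induction D with
      | zero => simp
      | succ D ih =>
        rw [sum_range_succ, mul_add, ih]
        have : (C (1 / c ^ (D + 1)) : MvPowerSeries σ ℂ) = C (1 / c ^ D) * C c⁻¹ := by
          rw [← map_mul]
          congr 1
          rw [pow_succ]
          field_simp
        rw [this]
        linear_combination (C (1 / c ^ D) * a ^ D) * hcc
    have h3 := MvPowerSeries.mul_inv_cancel _ h0
    have h4 := h2 (n.degree + 1)
    linear_combination (-(C c - a)⁻¹) * h4 + (∑ r ∈ range (n.degree + 1),
      C (1 / c ^ (r + 1)) * a ^ r) * h3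
  rw [h1, mul_add, map_add, mul_sum, map_sum]
  have h5 : G * (C (1 / c ^ (n.degree + 1)) * (C c - a)⁻¹ * a ^ (n.degree + 1))
      = (G * C (1 / c ^ (n.degree + 1)) * (C c - a)⁻¹) * a ^ (n.degree + 1) := by ring
  rw [h5, coeff_mul_pow_eq_zero ha (Nat.lt_succ_self _), add_zero]
  refine sum_congr rfl fun r _ => ?_
  rw [mul_left_comm, coeff_C_mul]

/-- The summand `e(φ k) / (c(k) - a)` of a generating series of nested sums. -/
noncomputable def serLetter (c : ℤ → ℂ) (x : ℝ × MvPowerSeries σ ℂ) (k : ℤ) : MvPowerSeries σ ℂ :=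
  C (e (x.1 * k)) * (C (c k) - x.2)⁻¹

theorem coeff_mul_nest_serLetter {c : ℕ → ℂ} {c' : ℤ → ℂ} (hcc : ∀ k : ℕ, c' k = c k)
    (hc : RegularDenom c) (n : σ →₀ ℕ) {p : List (ℝ × MvPowerSeries σ ℂ)}
    (hp : ∀ x ∈ p, constantCoeff x.2 = 0) (G : MvPowerSeries σ ℂ) (N M : ℕ) :
    coeff n (G * nest (serLetter c') p N (M + 1)) = wordSum n (fun w => truncSum c w N M) p G := by
  induction p generalizing G N with
  | nil => simp [nest, wordSum, truncSum]
  | cons x p ih =>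
    have ih' := ih fun y hy => hp y (by simp [hy])
    simp only [nest, sum_Ioo_int, mul_sum, map_sum, wordSum, truncSum, wordSum_sum]
    rw [sum_comm]
    refine sum_congr rfl fun k hk => ?_
    rw [mem_Ioc] at hk
    have h1 : G * (serLetter c' x k * nest (serLetter c') p k (M + 1))
        = (C (e (x.1 * k)) * (G * nest (serLetter c') p k (M + 1))) * (C (c k) - x.2)⁻¹ := by
      rw [serLetter, hcc]
      push_cast
      ring
    rw [h1, coeff_mul_inv_C_sub (hp x (by simp)) (hc.ne_zero (by omega))]
    refine sum_congr rfl fun r _ => ?_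
    have h2 := map_wordSum (LinearMap.mulLeft ℂ (e x.1 ^ k / c k ^ (r + 1))) n
      (fun w => truncSum c w k M) p (G * x.2 ^ r)
    simp only [LinearMap.mulLeft_apply] at h2
    rw [← h2, ← ih', mul_assoc (C _), coeff_C_mul, e_mul_nat, mul_right_comm G]
    ring

theorem coeff_genSeriesAt (c : ℕ → ℂ) (T : ℂ) {p : List (ℝ × MvPowerSeries σ ℂ)}
    (hp : ∀ x ∈ p, constantCoeff x.2 = 0) (n : σ →₀ ℕ) :
    coeff n (genSeriesAt c T p) = wordSum n (fun w => (reg c w).eval T) p 1 := by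
  have key : ∀ (F : List Letter → ℂ) (p : List (ℝ × MvPowerSeries σ ℂ)) (G : MvPowerSeries σ ℂ),
      ∑ d : Fin p.length → Fin (n.degree + 1),
        F (List.ofFn fun i => ((d i : ℕ) + 1, e (p.get i).1))
          * coeff n (G * ∏ i, (p.get i).2 ^ (d i : ℕ)) = wordSum n F p G := by
    intro F p G
    induction p generalizing F G with
    | nil => simp [wordSum, mul_comm]
    | cons x p ih =>
      simp only [wordSum, ← ih]
      rw [← Fin.sum_univ_eq_sum_range (fun r => ∑ d : Fin p.length → Fin (n.degree + 1),
        F ((r + 1, e x.1) :: List.ofFn fun i => ((d i : ℕ) + 1, e (p.get i).1))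
          * coeff n (G * x.2 ^ r * ∏ i, (p.get i).2 ^ (d i : ℕ))) (n.degree + 1)]
      rw [← Fintype.sum_prod_type']
      refine (Fintype.sum_equiv (Fin.consEquiv fun _ : Fin (p.length + 1) => Fin (n.degree + 1))
        _ _ fun d => ?_).symm
      simp only [Fin.consEquiv_apply, List.length_cons, List.ofFn_succ, Fin.prod_univ_succ,
        List.get_cons_zero, List.get_cons_succ', Fin.cons_zero, Fin.cons_succ, mul_assoc]
  rw [genSeriesAt, coeff_subst (hasSubst_of_constantCoeff_eq_zero p hp), ← key]
  rw [finsum_eq_sum_of_support_subset (s := (univ : Finset (Fin p.length → Fin (n.degree + 1))).image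
    fun d => Finsupp.equivFunOnFinite.symm fun i => (d i : ℕ))]
  · rw [sum_image]
    · refine sum_congr rfl fun d _ => ?_
      rw [Finsupp.prod_fintype _ _ (by simp), smul_eq_mul, one_mul]
      rfl
    · intro d _ d' _ h
      funext i
      have := DFunLike.congr_fun h i
      simpa [Fin.ext_iff] using this
  · intro d hd
    rw [Function.mem_support] at hd
    have hle : ∀ i, d i < n.degree + 1 := by
      intro i
      by_contra hi
      refine hd ?_
      rw [Finsupp.prod_fintype _ _ (by simp), ← mul_prod_erase univ _ (mem_univ i), mul_comm,
        coeff_mul_pow_eq_zero (hp _ (List.get_mem p i)) (by omega), smul_zero]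
    rw [mem_coe, mem_image]
    refine ⟨fun i => ⟨d i, hle i⟩, mem_univ _, ?_⟩
    ext i
    simp

/-- The polynomial in `T` whose values are the coefficients of `genSeriesAt c T p`. -/
noncomputable def regCoeff (c : ℕ → ℂ) (p : List (ℝ × MvPowerSeries σ ℂ)) (n : σ →₀ ℕ) :
    Polynomial ℂ := wordSum n (reg c) p 1

theorem eval_wordSum (n : σ →₀ ℕ) (F : List Letter → Polynomial ℂ)
    (p : List (ℝ × MvPowerSeries σ ℂ)) (G : MvPowerSeries σ ℂ) (T : ℂ) :
    (wordSum n F p G).eval T = wordSum n (fun w => (F w).eval T) p G :=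
  map_wordSum (Polynomial.leval T) n F p G

theorem eval_regCoeff (c : ℕ → ℂ) {p : List (ℝ × MvPowerSeries σ ℂ)}
    (hp : ∀ x ∈ p, constantCoeff x.2 = 0) (n : σ →₀ ℕ) (T : ℂ) :
    (regCoeff c p n).eval T = coeff n (genSeriesAt c T p) := by
  rw [regCoeff, eval_wordSum, coeff_genSeriesAt c T hp]

/-- The coefficients of truncated generating series are asymptotic to the regularized ones. -/
theorem small_coeff_nest_sub {c : ℕ → ℂ} {c' : ℤ → ℂ} (hcc : ∀ k : ℕ, c' k = c k)
    (hc : RegularDenom c) (n : σ →₀ ℕ) {p : List (ℝ × MvPowerSeries σ ℂ)}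
    (hp : ∀ x ∈ p, constantCoeff x.2 = 0) :
    Small fun M : ℕ => coeff n (nest (serLetter c') p 0 (M + 1))
      - (regCoeff c p n).eval (truncOne c 0 M) := by
  have h := small_wordSum n (fun w hw => small_truncSum_sub_reg hc hw) p 1
  convert h using 2 with M
  have h1 := coeff_mul_nest_serLetter hcc hc n hp 1 0 M
  rw [one_mul] at h1
  push_cast at h1
  rw [h1, regCoeff, eval_wordSum]
  rw [wordSum_sub]

theorem logLip_coeff_nest {c : ℕ → ℂ} {c' : ℤ → ℂ} (hcc : ∀ k : ℕ, c' k = c k)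
    (hc : RegularDenom c) (n : σ →₀ ℕ) {p : List (ℝ × MvPowerSeries σ ℂ)}
    (hp : ∀ x ∈ p, constantCoeff x.2 = 0) :
    LogLip fun M : ℕ => coeff n (nest (serLetter c') p 0 (M + 1)) := by
  have h1 : ∀ M : ℕ, coeff n (nest (serLetter c') p 0 (M + 1))
      = wordSum n (fun w => truncSum c w 0 M) p 1 := fun M => by
    have h := coeff_mul_nest_serLetter hcc hc n hp 1 0 M
    rw [one_mul] at h
    exact_mod_cast h
  constructor
  · simp only [h1]
    exact logBdd_wordSum n (fun w hw => (logLip_truncSum hc hw).1) p 1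
  · have h := small_wordSum n (fun w hw => (logLip_truncSum hc hw).2) p 1
    convert h using 2 with M
    simp only [wordSum_sub, h1]

/-- Differentiation with respect to `T` removes the last argument if its phase is an integer, and
gives zero otherwise. -/
theorem derivative_regCoeff_concat (c : ℕ → ℂ) (p : List (ℝ × MvPowerSeries σ ℂ))
    (x : ℝ × MvPowerSeries σ ℂ) (n : σ →₀ ℕ) :
    Polynomial.derivative (regCoeff c (p ++ [x]) n)
      = if e x.1 = 1 then regCoeff c p n else 0 := by
  rw [regCoeff, map_wordSum Polynomial.derivative, wordSum_concat, sum_range_succ']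
  have h1 : ∑ r ∈ range n.degree, wordSum n
      (fun w => Polynomial.derivative (reg c (w ++ [(r + 1 + 1, e x.1)]))) p (1 * x.2 ^ (r + 1)) = 0 := by
    refine sum_eq_zero fun r _ => ?_
    rw [← wordSum_zero n p (1 * x.2 ^ (r + 1))]
    exact wordSum_congr (fun w _ => derivative_reg_concat_of_ne c w (by simp)) _ _
  rw [h1, zero_add, pow_zero, mul_one]
  split_ifs with hx
  · rw [hx]
    exact wordSum_congr (fun w hw => derivative_reg_concat_one c hw) _ _
  · rw [← wordSum_zero (V := Polynomial ℂ) n p 1]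
    exact wordSum_congr (fun w _ => derivative_reg_concat_of_ne c w (by simp [hx])) _ _

end Coefficients

/-! ### Exact identities between truncated generating series -/

section Exact

variable {σ ι : Type*}

/-- The denominators of zeta values at integers. -/
def zetaInt (k : ℤ) : ℂ := k

/-- The denominators of `t`-values at integers. -/
noncomputable def tInt (k : ℤ) : ℂ := 2 * k - 1

theorem zetaInt_natCast (k : ℕ) : zetaInt k = zetaDenom k := by simp [zetaInt, zetaDenom]

theorem tInt_natCast (k : ℕ) : tInt k = tDenom k := by simp [tInt, tDenom]

/-- The arguments `(-φᵢ, (aₓ - aᵢ) / 2)` of the zeta series to the left of the place `x`. -/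
noncomputable def leftArgs (φ : ι → ℝ) (a : ι → MvPowerSeries σ ℂ) (x : ι) (l : List ι) :
    List (ℝ × MvPowerSeries σ ℂ) := l.map fun i => (-φ i, C (1 / 2) * (a x - a i))

/-- The arguments `(φᵢ, (aᵢ - aₓ) / 2)` of the zeta series to the right of the place `x`. -/
noncomputable def rightArgs (φ : ι → ℝ) (a : ι → MvPowerSeries σ ℂ) (x : ι) (l : List ι) :
    List (ℝ × MvPowerSeries σ ℂ) := l.map fun i => (φ i, C (1 / 2) * (a i - a x))

/-- The truncated generating series `∑_{0 < k₁ < ⋯ < k_d < n} ∏ᵢ e(φᵢ kᵢ) / (kᵢ - aᵢ)`. -/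
noncomputable def truncLi (p : List (ℝ × MvPowerSeries σ ℂ)) (n : ℤ) : MvPowerSeries σ ℂ :=
  nest (serLetter zetaInt) p 0 n

/-- The truncated generating series `∑_{A < k₁ < ⋯ < k_d < B} ∏ᵢ e(φᵢ kᵢ) / (2 kᵢ - 1 - aᵢ)`, in which
the indices may have any sign. -/
noncomputable def window (φ : ι → ℝ) (a : ι → MvPowerSeries σ ℂ) (l : List ι) (A B : ℤ) :
    MvPowerSeries σ ℂ :=
  nest (serLetter tInt) (l.map fun i => (φ i, a i)) A B

theorem inv_C_mul (r : ℂ) (x : MvPowerSeries σ ℂ) : (C r * x)⁻¹ = C r⁻¹ * x⁻¹ := by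
  rw [MvPowerSeries.mul_inv_rev, C_inv, mul_comm]

theorem e_zero : e 0 = 1 := by simp [e]

theorem e_list_sum (l : List ℝ) : e l.sum = (l.map e).prod := by
  induction l with
  | nil => simp [e_zero]
  | cons x l ih => simp [e_add, ih]

theorem e_mul_int {Φ : ℝ} (h : e Φ = 1) (k : ℤ) : e (Φ * k) = 1 := by
  have hneg : e (-Φ) = 1 := by
    have := e_add Φ (-Φ)
    rw [add_neg_cancel, e_zero, h, one_mul] at this
    exact this.symm
  obtain ⟨n, rfl | rfl⟩ := k.eq_nat_or_neg
  · have := e_mul_nat Φ n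
    push_cast
    rw [this, h, one_pow]
  · have := e_mul_nat (-Φ) n
    push_cast
    rw [mul_neg, ← neg_mul, this, hneg, one_pow]

theorem serLetter_tInt_one_sub (φ : ℝ) (a : MvPowerSeries σ ℂ) (k : ℤ) :
    serLetter tInt (φ, a) (1 - k) = C (-e φ) * serLetter tInt (-φ, -a) k := by
  unfold serLetter
  have h1 : (C (tInt (1 - k)) - a : MvPowerSeries σ ℂ) = C (-1) * (C (tInt k) - -a) := by
    have : tInt (1 - k) = -tInt k := by
      unfold tInt
      push_cast
      ring
    rw [this]
    simp only [map_neg, map_one]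
    ring
  have h2 : e (φ * ((1 - k : ℤ) : ℝ)) = e φ * e (-φ * k) := by
    rw [← e_add]
    congr 1
    push_cast
    ring
  simp only [h1, inv_C_mul, h2]
  norm_num
  ring

/-- Cutting the window between `0` and `1` and reflecting the nonpositive indices gives the first
sum of the symmetry identity. -/
theorem window_eq_sum (φ : ι → ℝ) (a : ι → MvPowerSeries σ ℂ) (l : List ι) (M : ℕ) :
    window φ a l (-M) (M + 1) = ∑ j ∈ range (l.length + 1),
      (-1) ^ j * C (e ((l.take j).map φ).sum)
        * nest (serLetter tInt) ((l.drop j).map fun i => (φ i, a i)) 0 (M + 1)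
        * nest (serLetter tInt) ((l.take j).reverse.map fun i => (-φ i, -a i)) 0 (M + 1) := by
  rw [window, nest_map, nest_cut _ _ (C := 1) (by omega) (by omega)]
  refine sum_congr rfl fun j hj => ?_
  have h1 := nest_reverse (fun i => serLetter tInt (φ i, a i)) (l.take j).reverse (-(M : ℤ)) 1 1
  simp only [List.reverse_reverse, serLetter_tInt_one_sub, sub_self, sub_neg_eq_add] at h1
  rw [nest_mul_left] at h1
  have h2 : ((l.take j).reverse.map fun i => (C (-e (φ i)) : MvPowerSeries σ ℂ)).prod
      = (-1) ^ j * C (e ((l.take j).map φ).sum) := by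
    have h3 : ∀ l' : List ι, (l'.map fun i => (C (-e (φ i)) : MvPowerSeries σ ℂ)).prod
        = (-1) ^ l'.length * C (e (l'.map φ).sum) := fun l' => by
      induction l' with
      | nil => simp [e_zero]
      | cons y l' ih =>
        rw [List.map_cons, List.prod_cons, ih, List.map_cons, List.sum_cons, e_add, map_mul,
          List.length_cons, map_neg]
        ring
    rw [List.map_reverse, List.prod_reverse, h3, List.length_take, min_eq_left]
    rw [mem_range] at hj
    omega
  rw [h1, h2, nest_map, nest_map, add_comm (1 : ℤ) M]
  simp only [sub_self]
  ring

/-- The elements `2k - 1 - a` whose inverses are summed. -/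
noncomputable def tPoint (a : ι → MvPowerSeries σ ℂ) (t : ι × ℤ) : MvPowerSeries σ ℂ :=
  C (tInt t.2) - a t.1

theorem tPoint_mul_inv {a : ι → MvPowerSeries σ ℂ} (ha : ∀ i, constantCoeff (a i) = 0)
    (t : ι × ℤ) : (tPoint a t)⁻¹ * tPoint a t = 1 := by
  refine MvPowerSeries.inv_mul_cancel _ ?_
  have : (2 * t.2 - 1 : ℂ) ≠ 0 := by
    intro h
    have h' : (2 * t.2 - 1 : ℤ) = 0 := by exact_mod_cast h
    omega
  simpa [tPoint, ha, tInt] using this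

theorem tPoint_sub_mul_inv {a : ι → MvPowerSeries σ ℂ} (ha : ∀ i, constantCoeff (a i) = 0)
    {s t : ι × ℤ} (h : s.2 ≠ t.2) :
    (tPoint a s - tPoint a t)⁻¹ * (tPoint a s - tPoint a t) = 1 := by
  refine MvPowerSeries.inv_mul_cancel _ ?_
  have : (2 * s.2 - 1 - (2 * t.2 - 1) : ℂ) ≠ 0 := by
    intro h0
    have h' : (2 * s.2 - 1 - (2 * t.2 - 1) : ℤ) = 0 := by exact_mod_cast h0
    omega
  simpa [tPoint, ha, tInt] using this

/-- The factor `e(φₛ (kₛ - kₜ)) / (xₛ - xₜ)`, where `x = 2k - 1 - a`, of the partial fraction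
expansion. -/
noncomputable def diffFactor (φ : ι → ℝ) (a : ι → MvPowerSeries σ ℂ) (t s : ι × ℤ) :
    MvPowerSeries σ ℂ :=
  C (e (φ s.1 * (s.2 - t.2 : ℤ))) * (tPoint a s - tPoint a t)⁻¹

theorem nest_diffFactor_left (φ : ι → ℝ) (a : ι → MvPowerSeries σ ℂ) (x : ι) (c A : ℤ)
    (pre : List ι) :
    nest (fun i k => diffFactor φ a (x, c) (i, k)) pre.reverse A c
      = C ((-1 / 2) ^ pre.length) * truncLi (leftArgs φ a x pre) (c - A) := by
  rw [nest_reverse _ _ _ _ c, sub_self, truncLi, leftArgs, nest_map]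
  have h1 : ∀ i k, diffFactor φ a (x, c) (i, c - k)
      = C (-1 / 2) * serLetter zetaInt (-φ i, C (1 / 2) * (a x - a i)) k := by
    intro i k
    have h2 : tPoint a (i, c - k) - tPoint a (x, c)
        = C (-2) * (C (zetaInt k) - C (1 / 2) * (a x - a i)) := by
      have h3 : (C (-2) : MvPowerSeries σ ℂ) * C (1 / 2) = -1 := by
        rw [← map_mul, ← map_one C, ← map_neg]
        norm_num
      have h4 : (C (tInt (c - k)) - C (tInt c) : MvPowerSeries σ ℂ) = C (-2) * C (zetaInt k) := by
        rw [← map_mul, ← map_sub]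
        congr 1
        unfold tInt zetaInt
        push_cast
        ring
      simp only [tPoint]
      linear_combination h4 + (a x - a i) * h3
    simp only [diffFactor, serLetter, h2, inv_C_mul]
    have h5 : φ i * ((c - k - c : ℤ) : ℝ) = -φ i * k := by
      push_cast
      ring
    rw [h5, show ((-2 : ℂ)⁻¹) = -1 / 2 by norm_num]
    ring
  simp only [h1]
  rw [nest_mul_left, List.map_const', List.prod_replicate, map_pow]

theorem nest_diffFactor_right (φ : ι → ℝ) (a : ι → MvPowerSeries σ ℂ) (x : ι) (c B : ℤ)
    (r : List ι) :
    nest (fun i k => diffFactor φ a (x, c) (i, k)) r c B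
      = C ((1 / 2) ^ r.length) * truncLi (rightArgs φ a x r) (B - c) := by
  rw [nest_shift _ _ _ _ c, sub_self, truncLi, rightArgs, nest_map]
  have h1 : ∀ i k, diffFactor φ a (x, c) (i, k + c)
      = C (1 / 2) * serLetter zetaInt (φ i, C (1 / 2) * (a i - a x)) k := by
    intro i k
    have h2 : tPoint a (i, k + c) - tPoint a (x, c)
        = C 2 * (C (zetaInt k) - C (1 / 2) * (a i - a x)) := by
      have h3 : (C 2 : MvPowerSeries σ ℂ) * C (1 / 2) = 1 := by
        rw [← map_mul, ← map_one C]
        norm_num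
      have h4 : (C (tInt (k + c)) - C (tInt c) : MvPowerSeries σ ℂ) = C 2 * C (zetaInt k) := by
        rw [← map_mul, ← map_sub]
        congr 1
        unfold tInt zetaInt
        push_cast
        ring
      simp only [tPoint]
      linear_combination h4 + (a i - a x) * h3
    simp only [diffFactor, serLetter, h2, inv_C_mul]
    have h5 : φ i * ((k + c - c : ℤ) : ℝ) = φ i * k := by
      push_cast
      ring
    rw [h5, show ((2 : ℂ)⁻¹) = 1 / 2 by norm_num]
    ring
  simp only [h1]
  rw [nest_mul_left, List.map_const', List.prod_replicate, map_pow]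

/-- The total phase of a tuple, in terms of the differences to the index of a chosen place. -/
theorem prod_phase_mul_splitSum (φ : ι → ℝ) (a : ι → MvPowerSeries σ ℂ)
    (J : ι × ℤ → MvPowerSeries σ ℂ) (ts : List (ι × ℤ)) :
    (ts.map fun t => (C (e (φ t.1 * t.2)) : MvPowerSeries σ ℂ)).prod
      * splitSum (fun p t r => J t * (p.map fun s => (tPoint a s - tPoint a t)⁻¹).prod
          * (r.map fun s => (tPoint a s - tPoint a t)⁻¹).prod) [] ts
      = splitSum (fun p t r => C (e (((ts.map Prod.fst).map φ).sum * t.2)) * J t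
          * (p.map (diffFactor φ a t)).prod * (r.map (diffFactor φ a t)).prod) [] ts := by
  rw [mul_splitSum]
  refine splitSum_congr fun p t r h => ?_
  have h1 : ∀ l : List (ι × ℤ), (l.map fun s => (C (e (φ s.1 * s.2)) : MvPowerSeries σ ℂ)).prod
      = C (e (((l.map Prod.fst).map φ).sum * t.2))
        * (l.map fun s => (C (e (φ s.1 * (s.2 - t.2 : ℤ))) : MvPowerSeries σ ℂ)).prod := fun l => by
    induction l with
    | nil => simp [e_zero]
    | cons s l ih =>
      simp only [List.map_cons, List.prod_cons, List.sum_cons, ih]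
      have : e (φ s.1 * s.2) * e (((l.map Prod.fst).map φ).sum * t.2)
          = e ((φ s.1 + ((l.map Prod.fst).map φ).sum) * t.2) * e (φ s.1 * (s.2 - t.2 : ℤ)) := by
        rw [← e_add, ← e_add]
        congr 1
        push_cast
        ring
      have := congrArg (C (σ := σ)) this
      simp only [map_mul] at this
      linear_combination (List.map (fun s => (C (e (φ s.1 * (s.2 - t.2 : ℤ))) : MvPowerSeries σ ℂ))
        l).prod * this
  have h2 : (ts.map fun s => (C (e (φ s.1 * (s.2 - t.2 : ℤ))) : MvPowerSeries σ ℂ)).prod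
      = (p.map fun s => (C (e (φ s.1 * (s.2 - t.2 : ℤ))) : MvPowerSeries σ ℂ)).prod
        * (r.map fun s => (C (e (φ s.1 * (s.2 - t.2 : ℤ))) : MvPowerSeries σ ℂ)).prod := by
    rw [show ts = p.reverse ++ t :: r by simpa using h.symm]
    simp [List.map_reverse, List.prod_reverse, e_zero]
  have h3 : ∀ l : List (ι × ℤ), (l.map (diffFactor φ a t)).prod
      = (l.map fun s => (C (e (φ s.1 * (s.2 - t.2 : ℤ))) : MvPowerSeries σ ℂ)).prod
        * (l.map fun s => (tPoint a s - tPoint a t)⁻¹).prod := fun l => by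
    rw [← List.prod_map_mul]
    rfl
  rw [h1, h2, h3, h3]
  ring

theorem tupleSum_splitSum_diffFactor (φ : ι → ℝ) (a : ι → MvPowerSeries σ ℂ)
    (v : ι × ℤ → MvPowerSeries σ ℂ) (l : List ι) (A B : ℤ) :
    tupleSum l A B (fun ts => splitSum (fun p t r => v t * (p.map (diffFactor φ a t)).prod
        * (r.map (diffFactor φ a t)).prod) [] ts)
      = C ((1 / 2) ^ (l.length - 1)) * splitSum (fun pre x r => (-1) ^ pre.length
          * ∑ c ∈ Ioo A B, v (x, c) * truncLi (leftArgs φ a x pre) (c - A)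
            * truncLi (rightArgs φ a x r) (B - c)) [] l := by
  rw [tupleSum_splitSum, mul_splitSum]
  refine splitSum_congr fun p x r h => ?_
  have hl : l.length - 1 = p.length + r.length := by
    have := congrArg List.length h
    simp at this
    omega
  rw [mul_sum, mul_sum]
  refine sum_congr rfl fun c _ => ?_
  rw [nest_diffFactor_left, nest_diffFactor_right, hl]
  have : (C ((-1 / 2) ^ p.length) : MvPowerSeries σ ℂ) * C ((1 / 2) ^ r.length)
      = C ((1 / 2) ^ (p.length + r.length)) * (-1) ^ p.length := by
    rw [← map_mul, show (-1 : MvPowerSeries σ ℂ) = C (-1) by simp, ← map_pow, ← map_mul]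
    congr 1
    rw [pow_add, show (-1 / 2 : ℂ) = 1 / 2 * (-1) by norm_num, mul_pow]
    ring
  simp only [List.map_nil, List.prod_nil, mul_one]
  linear_combination (v (x, c) * truncLi (leftArgs φ a x p) (c - A)
    * truncLi (rightArgs φ a x r) (B - c)) * this

/-- Partial fractions turn the sum over a window into the second sum of the symmetry identity, with
coupled truncations. -/
theorem window_eq_splitSum (φ : ι → ℝ) {a : ι → MvPowerSeries σ ℂ}
    (ha : ∀ i, constantCoeff (a i) = 0) {l : List ι} (hl : l ≠ []) (A B : ℤ) :
    window φ a l A B = C ((1 / 2) ^ (l.length - 1)) *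
      splitSum (fun pre x r => (-1) ^ pre.length * ∑ c ∈ Ioo A B,
        serLetter tInt ((l.map φ).sum, a x) c * truncLi (leftArgs φ a x pre) (c - A)
          * truncLi (rightArgs φ a x r) (B - c)) [] l := by
  have h0 : window φ a l A B = tupleSum l A B (fun ts =>
      (1 : MvPowerSeries σ ℂ) * (ts.map fun t => serLetter tInt (φ t.1, a t.1) t.2).prod) := by
    rw [tupleSum_mul_prod, one_mul, window, nest_map]
  rw [h0]
  refine Eq.trans ?_ (tupleSum_splitSum_diffFactor φ a
    (fun t => C (e ((l.map φ).sum * t.2)) * (tPoint a t)⁻¹) l A B)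
  refine tupleSum_congr fun ts h1 _ h3 => ?_
  have hne : ts ≠ [] := by
    rintro rfl
    exact hl (by simpa using h1.symm)
  have h4 := prod_inv_eq_splitSum (fun t => (tPoint a t)⁻¹) (tPoint a)
    (fun t s => (tPoint a s - tPoint a t)⁻¹) hne (fun t _ => tPoint_mul_inv ha t)
    (h3.imp fun h => ⟨tPoint_sub_mul_inv ha h.ne, tPoint_sub_mul_inv ha h.ne'⟩)
  rw [one_mul, ← h1, ← prod_phase_mul_splitSum φ a (fun t => (tPoint a t)⁻¹), ← h4,
    ← List.prod_map_mul]
  rfl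

/-- For an integral total phase, the coupled convolution of the zeta series vanishes. -/
theorem splitSum_convolution_eq_zero {φ : ι → ℝ} {a : ι → MvPowerSeries σ ℂ}
    (ha : ∀ i, constantCoeff (a i) = 0) {l : List ι} (hl : 2 ≤ l.length)
    (hφ : e (l.map φ).sum = 1) (A B : ℤ) :
    splitSum (fun pre x r => (-1) ^ pre.length * ∑ c ∈ Ioo A B,
        truncLi (leftArgs φ a x pre) (c - A) * truncLi (rightArgs φ a x r) (B - c)) [] l = 0 := by
  have h := tupleSum_splitSum_diffFactor φ a
    (fun t => C (e ((l.map φ).sum * t.2)) * 1) l A B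
  have h0 : tupleSum l A B (fun ts => splitSum (fun p t r => C (e ((l.map φ).sum * t.2)) * 1
      * (p.map (diffFactor φ a t)).prod * (r.map (diffFactor φ a t)).prod) [] ts) = 0 := by
    rw [← tupleSum_zero l A B]
    refine tupleSum_congr fun ts h1 _ h3 => ?_
    have h4 := splitSum_prod_inv_sub_eq_zero (tPoint a)
      (fun t s => (tPoint a s - tPoint a t)⁻¹) (ts := ts) (by rw [← h1] at hl; simpa using hl)
      (h3.imp fun h => ⟨tPoint_sub_mul_inv ha h.ne, tPoint_sub_mul_inv ha h.ne'⟩)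
    rw [← h1, ← prod_phase_mul_splitSum φ a (fun _ => 1)]
    simp only [one_mul]
    rw [h4, mul_zero]
  rw [h0] at h
  simp only [e_mul_int hφ, map_one, one_mul] at h
  have h2 : (C ((1 / 2) ^ (l.length - 1)) : MvPowerSeries σ ℂ) * C (2 ^ (l.length - 1)) = 1 := by
    rw [← map_mul, ← mul_pow]
    norm_num
  linear_combination (-splitSum (fun pre x r => (-1) ^ pre.length * ∑ c ∈ Ioo A B,
        truncLi (leftArgs φ a x pre) (c - A) * truncLi (rightArgs φ a x r) (B - c)) [] l) * h2
    - C (2 ^ (l.length - 1)) * h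

end Exact

end MultipleT

namespace MultipleT

open Finset Filter Topology

/-! ### Convolution estimates -/

theorem sum_one_div_mul_le (M : ℕ) :
    ∑ l ∈ range M, 1 / (((M - l : ℕ) : ℝ) * (l + 1)) ≤ 2 * lam M / (M + 1) := by
  have h1 : ∀ l ∈ range M, 1 / (((M - l : ℕ) : ℝ) * (l + 1))
      = 1 / ((M : ℝ) + 1) * (1 / ((l : ℝ) + 1) + 1 / (((M - 1 - l : ℕ) : ℝ) + 1)) := by
    intro l hl
    rw [mem_range] at hl
    have h2 : ((M - 1 - l : ℕ) : ℝ) + 1 = (M - l : ℕ) := by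
      have : M - 1 - l + 1 = M - l := by omega
      exact_mod_cast this
    have h3 : (M : ℝ) + 1 = (M - l : ℕ) + ((l : ℝ) + 1) := by
      have : M + 1 = (M - l) + (l + 1) := by omega
      exact_mod_cast this
    have h4 : ((M - l : ℕ) : ℝ) ≠ 0 := by
      have : M - l ≠ 0 := by omega
      exact_mod_cast this
    have h5 : (l : ℝ) + 1 ≠ 0 := by positivity
    rw [h2, h3]
    rw [h3] at *
    have h6 : ((M - l : ℕ) : ℝ) + ((l : ℝ) + 1) ≠ 0 := by positivity
    field_simp
  rw [sum_congr rfl h1, ← mul_sum, sum_add_distrib,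
    sum_range_reflect (fun l : ℕ => 1 / ((l : ℝ) + 1)) M]
  have h2 : ∑ l ∈ range M, 1 / ((l : ℝ) + 1) ≤ lam M := by
    unfold lam
    linarith
  calc _ ≤ 1 / ((M : ℝ) + 1) * (lam M + lam M) := by gcongr
    _ = _ := by ring

theorem lam_pow_le_two_mul {N M : ℕ} (h : N ≤ 2 * M) (a : ℕ) :
    lam N ^ a ≤ 2 ^ a * lam M ^ a := by
  rw [← mul_pow]
  have := lam_pos N
  gcongr
  exact (lam_mono h).trans (lam_two_mul_le M)

/-- Coupling the truncations of two factors of logarithmic growth to a summation index does not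
matter in the limit, if the summand has small tails. -/
theorem TailBdd.small_convolution {γ f h : ℕ → ℂ} (hγ : TailBdd γ) (hf : LogLip f)
    (hh : LogLip h) :
    Small fun M => ∑ k ∈ Ioc 0 M, γ k * (f (M - k) * h (M + (k - 1)) - f M * h M) := by
  obtain ⟨C, hC, hγ⟩ := hγ
  obtain ⟨⟨F, a, hF, hf⟩, ⟨F', a', hF', hf'⟩⟩ := hf
  obtain ⟨⟨H, b, hH, hh⟩, ⟨H', b', hH', hh'⟩⟩ := hh
  have hparts : ∀ M : ℕ, ∀ U : ℕ → ℂ, ∑ k ∈ Ioc 0 M, γ k * (U k - U 0)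
      = ∑ l ∈ range M, (U (l + 1) - U l) * ∑ k ∈ Ioc l M, γ k := by
    intro M U
    simp only [← sum_range_sub, mul_sum]
    rw [sum_comm' (t' := range M) (s' := fun l => Ioc l M)]
    · refine sum_congr rfl fun l _ => sum_congr rfl fun k _ => ?_
      ring
    · intro k l
      simp only [mem_range, mem_Ioc]
      omega
  set c := max (a' + b) (a + b') with hc
  refine ⟨(F' * 2 ^ c * H + F * 2 ^ c * H') * C * 2, c + 1, by positivity, fun M => ?_⟩
  have h0 := hparts M fun k => f (M - k) * h (M + (k - 1))
  simp only [Nat.zero_sub, add_zero, Nat.sub_zero] at h0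
  simp only [h0]
  have hlam := lam_pos M
  have hbound : ∀ l ∈ range M, ‖(f (M - (l + 1)) * h (M + (l + 1 - 1)) - f (M - l) * h (M + (l - 1)))
      * ∑ k ∈ Ioc l M, γ k‖
      ≤ (F' * 2 ^ c * H + F * 2 ^ c * H') * lam M ^ c * C * (1 / (((M - l : ℕ) : ℝ) * (l + 1))) := by
    intro l hl
    rw [mem_range] at hl
    have hpos : (0 : ℝ) < (M - l : ℕ) := by
      have : 0 < M - l := by omega
      exact_mod_cast this
    have e1 : f (M - (l + 1)) * h (M + (l + 1 - 1)) - f (M - l) * h (M + (l - 1))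
        = -(f (M - (l + 1) + 1) - f (M - (l + 1))) * h (M + l)
          + f (M - l) * (h (M + l) - h (M + (l - 1))) := by
      rw [show M - (l + 1) + 1 = M - l by omega, Nat.add_sub_cancel]
      ring
    have e2 : ‖-(f (M - (l + 1) + 1) - f (M - (l + 1))) * h (M + l)‖
        ≤ F' * 2 ^ c * H * lam M ^ c / (M - l : ℕ) := by
      rw [norm_mul, norm_neg]
      have h1 := hf' (M - (l + 1))
      have h2 : ((M - (l + 1) : ℕ) : ℝ) + 1 = (M - l : ℕ) := by
        have : M - (l + 1) + 1 = M - l := by omega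
        exact_mod_cast this
      rw [h2] at h1
      have h3 := lam_pow_le M (le_max_left (a' + b) (a + b'))
      have h4 := lam_pos (M - (l + 1))
      have h5 := lam_pos (M + l)
      calc _ ≤ (F' * lam (M - (l + 1)) ^ a' / (M - l : ℕ)) * (H * lam (M + l) ^ b) :=
            mul_le_mul h1 (hh _) (norm_nonneg _) (by positivity)
        _ ≤ (F' * (2 ^ a' * lam M ^ a') / (M - l : ℕ)) * (H * (2 ^ b * lam M ^ b)) := by
            gcongr
            · exact lam_pow_le_two_mul (by omega) _
            · exact lam_pow_le_two_mul (by omega) _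
        _ = F' * 2 ^ (a' + b) * H * lam M ^ (a' + b) / (M - l : ℕ) := by ring
        _ ≤ F' * 2 ^ c * H * lam M ^ c / (M - l : ℕ) := by
            gcongr
            · norm_num
            · exact le_max_left _ _
    have e3 : ‖f (M - l) * (h (M + l) - h (M + (l - 1)))‖
        ≤ F * 2 ^ c * H' * lam M ^ c / (M - l : ℕ) := by
      rcases Nat.eq_zero_or_pos l with rfl | hl0
      · simp
        positivity
      rw [norm_mul]
      have h1 : ‖h (M + (l - 1) + 1) - h (M + (l - 1))‖ ≤ _ := hh' (M + (l - 1))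
      rw [show M + (l - 1) + 1 = M + l by omega] at h1
      have h2 : ((M - l : ℕ) : ℝ) ≤ ((M + (l - 1) : ℕ) : ℝ) + 1 := by
        have : M - l ≤ M + (l - 1) + 1 := by omega
        exact_mod_cast this
      have h3 := lam_pow_le M (le_max_right (a' + b) (a + b'))
      have h4 := lam_pos (M - l)
      have h5 := lam_pos (M + (l - 1))
      calc _ ≤ (F * lam (M - l) ^ a) * (H' * lam (M + (l - 1)) ^ b' / (((M + (l - 1) : ℕ) : ℝ) + 1)) :=
            mul_le_mul (hf _) h1 (norm_nonneg _) (by positivity)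
        _ ≤ (F * (2 ^ a * lam M ^ a)) * (H' * (2 ^ b' * lam M ^ b') / (M - l : ℕ)) := by
            gcongr
            · exact lam_pow_le_two_mul (by omega) _
            · exact lam_pow_le_two_mul (by omega) _
        _ = F * 2 ^ (a + b') * H' * lam M ^ (a + b') / (M - l : ℕ) := by ring
        _ ≤ F * 2 ^ c * H' * lam M ^ c / (M - l : ℕ) := by
            gcongr
            · norm_num
            · exact le_max_right _ _
    rw [norm_mul, e1]
    calc _ ≤ (F' * 2 ^ c * H * lam M ^ c / (M - l : ℕ) + F * 2 ^ c * H' * lam M ^ c / (M - l : ℕ))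
          * (C / (l + 1)) :=
          mul_le_mul ((norm_add_le _ _).trans (add_le_add e2 e3)) (hγ l M hl.le) (norm_nonneg _)
            (by positivity)
      _ = _ := by field_simp
  calc _ ≤ ∑ l ∈ range M, (F' * 2 ^ c * H + F * 2 ^ c * H') * lam M ^ c * C
            * (1 / (((M - l : ℕ) : ℝ) * (l + 1))) := norm_sum_le_of_le _ hbound
    _ ≤ (F' * 2 ^ c * H + F * 2 ^ c * H') * lam M ^ c * C * (2 * lam M / (M + 1)) := by
        rw [← mul_sum]
        gcongr
        exact sum_one_div_mul_le M
    _ = _ := by ring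

/-- A double sequence which is `O(log(A) ^ a log(B) ^ a (1 / A + 1 / B))`. -/
def Small₂ (E : ℕ → ℕ → ℂ) : Prop := ∃ (C : ℝ) (a : ℕ), 0 ≤ C ∧ ∀ A B,
  ‖E A B‖ ≤ C * (lam A * lam B) ^ a * (1 / ((A : ℝ) + 1) + 1 / ((B : ℝ) + 1))

theorem small₂_zero : Small₂ fun _ _ => 0 := ⟨0, 0, le_rfl, by simp⟩

theorem Small₂.swap {E : ℕ → ℕ → ℂ} (h : Small₂ E) : Small₂ fun A B => E B A := by
  obtain ⟨C, a, hC, h⟩ := h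
  refine ⟨C, a, hC, fun A B => ?_⟩
  rw [mul_comm (lam A), add_comm (1 / ((A : ℝ) + 1))]
  exact h B A

theorem one_le_lam_mul (A B : ℕ) : 1 ≤ lam A * lam B :=
  one_le_mul_of_one_le_of_one_le (one_le_lam A) (one_le_lam B)

theorem Small₂.add {E E' : ℕ → ℕ → ℂ} (h : Small₂ E) (h' : Small₂ E') :
    Small₂ fun A B => E A B + E' A B := by
  obtain ⟨C, a, hC, h⟩ := h
  obtain ⟨D, b, hD, h'⟩ := h'
  refine ⟨C + D, max a b, by positivity, fun A B => ?_⟩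
  have h1 := pow_le_pow_right₀ (one_le_lam_mul A B) (le_max_left a b)
  have h2 := pow_le_pow_right₀ (one_le_lam_mul A B) (le_max_right a b)
  calc _ ≤ C * (lam A * lam B) ^ a * (1 / ((A : ℝ) + 1) + 1 / ((B : ℝ) + 1))
        + D * (lam A * lam B) ^ b * (1 / ((A : ℝ) + 1) + 1 / ((B : ℝ) + 1)) :=
        (norm_add_le _ _).trans (add_le_add (h A B) (h' A B))
    _ ≤ C * (lam A * lam B) ^ (max a b) * (1 / ((A : ℝ) + 1) + 1 / ((B : ℝ) + 1))
        + D * (lam A * lam B) ^ (max a b) * (1 / ((A : ℝ) + 1) + 1 / ((B : ℝ) + 1)) := by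
        refine add_le_add ?_ ?_
        · exact mul_le_mul_of_nonneg_right (mul_le_mul_of_nonneg_left h1 hC) (by positivity)
        · exact mul_le_mul_of_nonneg_right (mul_le_mul_of_nonneg_left h2 hD) (by positivity)
    _ = _ := by ring

theorem Small₂.const_mul {E : ℕ → ℕ → ℂ} (h : Small₂ E) (c : ℂ) :
    Small₂ fun A B => c * E A B := by
  obtain ⟨C, a, hC, h⟩ := h
  refine ⟨‖c‖ * C, a, by positivity, fun A B => ?_⟩
  rw [norm_mul, mul_assoc ‖c‖, mul_assoc ‖c‖]
  gcongr
  exact h A B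

theorem Small₂.sum {ι : Type*} (s : Finset ι) {E : ι → ℕ → ℕ → ℂ} (h : ∀ i ∈ s, Small₂ (E i)) :
    Small₂ fun A B => ∑ i ∈ s, E i A B := by
  classical
  induction s using Finset.induction_on with
  | empty => simpa using small₂_zero
  | insert i s hi ih =>
    simp only [sum_insert hi]
    exact (h i (mem_insert_self _ _)).add (ih fun j hj => h j (mem_insert_of_mem hj))

theorem Small₂.splitSum {ι : Type*} {E : ℕ → ℕ → List ι → ι → List ι → ℂ}
    (h : ∀ p x r, Small₂ fun A B => E A B p x r) (pre l : List ι) :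
    Small₂ fun A B => MultipleT.splitSum (E A B) pre l := by
  induction l generalizing pre with
  | nil => exact small₂_zero
  | cons y l ih => exact (h pre y l).add (ih _)

theorem Small.mul_right₂ {f g : ℕ → ℂ} (hf : Small f) (hg : LogBdd g) :
    Small₂ fun A B => f A * g B := by
  obtain ⟨C, a, hC, h⟩ := hf
  obtain ⟨D, b, hD, h'⟩ := hg
  refine ⟨C * D, max a b, by positivity, fun A B => ?_⟩
  have h1 := lam_pow_le A (le_max_left a b)
  have h2 := lam_pow_le B (le_max_right a b)
  have hA := lam_pos A
  have hB := lam_pos B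
  rw [norm_mul, mul_pow]
  calc _ ≤ (C * lam A ^ a / (A + 1)) * (D * lam B ^ b) :=
        mul_le_mul (h A) (h' B) (norm_nonneg _) (by positivity)
    _ ≤ (C * lam A ^ (max a b) / (A + 1)) * (D * lam B ^ (max a b)) := by
        refine mul_le_mul ?_ (mul_le_mul_of_nonneg_left h2 hD) (by positivity) (by positivity)
        gcongr ?_ / _
        exact mul_le_mul_of_nonneg_left h1 hC
    _ = C * D * (lam A ^ (max a b) * lam B ^ (max a b)) * (1 / ((A : ℝ) + 1)) := by ring
    _ ≤ _ := by
        gcongr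
        have : 0 ≤ 1 / ((B : ℝ) + 1) := by positivity
        linarith

/-- Products of asymptotically equal factors are asymptotically equal as double sequences. -/
theorem small₂_mul_sub_mul {f g P Q : ℕ → ℂ} (hf : Small fun M => f M - P M)
    (hg : Small fun M => g M - Q M) (hP : LogBdd P) (hQ : LogBdd Q) :
    Small₂ fun A B => f A * g B - P A * Q B := by
  have hg' : LogBdd g := by
    simpa using hg.logBdd.add hQ
  convert (hf.mul_right₂ hg').add (hg.mul_right₂ hP).swap using 3
  ring

theorem Small₂.small_convolution {E : ℕ → ℕ → ℂ} (hE : Small₂ E) {g : ℕ → ℂ}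
    (hg : ∀ k, 1 ≤ k → ‖g k‖ ≤ 1 / k) :
    Small fun M => ∑ k ∈ Ioc 0 M, g k * E (M - k) (M + (k - 1)) := by
  obtain ⟨C, a, hC, h⟩ := hE
  refine ⟨C * (4 ^ a) * 2 * 2, 2 * a + 1, by positivity, fun M => ?_⟩
  have hlam := lam_pos M
  have hs : ∑ k ∈ Ioc 0 M, g k * E (M - k) (M + (k - 1))
      = ∑ l ∈ range M, g (l + 1) * E (M - (l + 1)) (M + l) := by
    have h0 := sum_Ico_add' (fun k => g k * E (M - k) (M + (k - 1))) 0 M 1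
    simp only [Nat.add_sub_cancel, zero_add] at h0
    rw [range_eq_Ico, h0]
    refine sum_congr ?_ fun _ _ => rfl
    ext k
    simp only [mem_Ioc, mem_Ico]
    omega
  simp only [hs]
  have hb : ∀ l ∈ range M, ‖g (l + 1) * E (M - (l + 1)) (M + l)‖
      ≤ C * 4 ^ a * lam M ^ (2 * a) * 2 * (1 / (((M - l : ℕ) : ℝ) * (l + 1))) := by
    intro l hl
    rw [mem_range] at hl
    have hpos : (0 : ℝ) < (M - l : ℕ) := by
      have : 0 < M - l := by omega
      exact_mod_cast this
    have h1 := hg (l + 1) (by omega)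
    push_cast at h1
    have h2 := h (M - (l + 1)) (M + l)
    have h3 : ((M - (l + 1) : ℕ) : ℝ) + 1 = (M - l : ℕ) := by
      have : M - (l + 1) + 1 = M - l := by omega
      exact_mod_cast this
    have h4 : ((M - l : ℕ) : ℝ) ≤ ((M + l : ℕ) : ℝ) + 1 := by
      have : M - l ≤ M + l + 1 := by omega
      exact_mod_cast this
    rw [h3] at h2
    have h5 := lam_pos (M - (l + 1))
    have h6 := lam_pos (M + l)
    rw [norm_mul]
    calc _ ≤ (1 / ((l : ℝ) + 1)) * (C * (lam (M - (l + 1)) * lam (M + l)) ^ a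
          * (1 / ((M - l : ℕ) : ℝ) + 1 / (((M + l : ℕ) : ℝ) + 1))) :=
          mul_le_mul h1 h2 (norm_nonneg _) (by positivity)
      _ ≤ (1 / ((l : ℝ) + 1)) * (C * ((2 ^ a * lam M ^ a) * (2 ^ a * lam M ^ a))
          * (1 / ((M - l : ℕ) : ℝ) + 1 / ((M - l : ℕ) : ℝ))) := by
          rw [mul_pow]
          gcongr
          · exact lam_pow_le_two_mul (by omega) _
          · exact lam_pow_le_two_mul (by omega) _
      _ = _ := by
          have : (4 : ℝ) ^ a = 2 ^ a * 2 ^ a := by rw [← mul_pow]; norm_num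
          rw [this, two_mul a, pow_add]
          field_simp
          ring
  calc _ ≤ ∑ l ∈ range M, C * 4 ^ a * lam M ^ (2 * a) * 2
            * (1 / (((M - l : ℕ) : ℝ) * (l + 1))) := norm_sum_le_of_le _ hb
    _ ≤ C * 4 ^ a * lam M ^ (2 * a) * 2 * (2 * lam M / (M + 1)) := by
        rw [← mul_sum]
        gcongr
        exact sum_one_div_mul_le M
    _ = _ := by ring

/-- A constant whose antidiagonal sums are those of a double sequence tending to zero vanishes. -/
theorem Small₂.eq_zero_of_sum_eq {E : ℕ → ℕ → ℂ} (hE : Small₂ E) {K : ℂ}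
    (h : ∀ N : ℕ, ∑ c ∈ range (N + 1), E c (N - c) = ((N : ℂ) + 1) * K) : K = 0 := by
  obtain ⟨C, a, hC, hE⟩ := hE
  have hb : ∀ N : ℕ, ‖K‖ ≤ 4 * C * (lam N ^ (2 * a + 1) / ((N : ℝ) + 1)) := by
    intro N
    have hlam := lam_pos N
    have h1 : ‖∑ c ∈ range (N + 1), E c (N - c)‖ ≤ ∑ c ∈ range (N + 1),
        C * lam N ^ (2 * a) * (1 / ((c : ℝ) + 1) + 1 / (((N + 1 - 1 - c : ℕ) : ℝ) + 1)) := by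
      refine norm_sum_le_of_le _ fun c hc => (hE c (N - c)).trans ?_
      rw [mem_range] at hc
      have h2 := lam_pos c
      have h3 := lam_pos (N - c)
      rw [Nat.add_sub_cancel, two_mul, pow_add, ← mul_pow]
      gcongr
      · exact lam_mono (by omega)
      · exact lam_mono (by omega)
    rw [h N, norm_mul, ← mul_sum, sum_add_distrib,
      sum_range_reflect (fun l : ℕ => 1 / ((l : ℝ) + 1)) (N + 1)] at h1
    have h4 : ‖((N : ℂ) + 1)‖ = N + 1 := by
      rw [← Nat.cast_succ, Complex.norm_natCast]
      push_cast
      rfl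
    have h5 : ∑ l ∈ range (N + 1), 1 / ((l : ℝ) + 1) ≤ 2 * lam N := by
      have : ∑ l ∈ range (N + 1), 1 / ((l : ℝ) + 1) = lam (N + 1) - 1 := by
        unfold lam
        ring
      rw [this, lam_succ]
      have : 1 / ((N : ℝ) + 1) ≤ 1 := by
        rw [div_le_one (by positivity)]
        linarith [(Nat.cast_nonneg N : (0 : ℝ) ≤ N)]
      linarith [one_le_lam N]
    rw [h4] at h1
    rw [mul_div_assoc', le_div_iff₀ (by positivity)]
    calc ‖K‖ * ((N : ℝ) + 1) = ((N : ℝ) + 1) * ‖K‖ := mul_comm _ _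
      _ ≤ C * lam N ^ (2 * a) * (2 * lam N + 2 * lam N) := by
          refine h1.trans ?_
          gcongr
      _ = _ := by ring
  have h0 := (tendsto_lam_pow_div (2 * a + 1)).const_mul (4 * C)
  rw [mul_zero] at h0
  exact norm_le_zero_iff.1 (ge_of_tendsto' h0 hb)

end MultipleT

namespace MultipleT

open Finset MvPowerSeries

/-! ### The product of left and right zeta series -/

section Sides

variable {σ ι : Type*}

theorem constantCoeff_of_mem_leftArgs {φ : ι → ℝ} {a : ι → MvPowerSeries σ ℂ}
    (ha : ∀ i, constantCoeff (a i) = 0) {x : ι} {l : List ι} :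
    ∀ y ∈ leftArgs φ a x l, constantCoeff y.2 = 0 := by
  intro y hy
  obtain ⟨i, -, rfl⟩ := List.mem_map.1 hy
  simp [ha]

theorem constantCoeff_of_mem_rightArgs {φ : ι → ℝ} {a : ι → MvPowerSeries σ ℂ}
    (ha : ∀ i, constantCoeff (a i) = 0) {x : ι} {l : List ι} :
    ∀ y ∈ rightArgs φ a x l, constantCoeff y.2 = 0 := by
  intro y hy
  obtain ⟨i, -, rfl⟩ := List.mem_map.1 hy
  simp [ha]

theorem genSeriesAt_nil (c : ℕ → ℂ) (T : ℂ) :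
    genSeriesAt c T ([] : List (ℝ × MvPowerSeries σ ℂ)) = 1 := by
  ext n
  rw [coeff_genSeriesAt c T (by simp), wordSum, reg_of_trailing_eq_zero c trailing_nil]
  simp [value, truncSum, tendsto_const_nhds.limUnder_eq]

theorem e_neg_eq_one_iff (φ : ℝ) : e (-φ) = 1 ↔ e φ = 1 := by
  have h := e_add φ (-φ)
  rw [add_neg_cancel, e_zero] at h
  constructor
  · intro h1
    rw [h1, mul_one] at h
    exact h.symm
  · intro h1
    rw [h1, one_mul] at h
    exact h.symm

/-- The alternating sum, over all places `x` of a list, of the products of the zeta series to the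
left and to the right of `x`, regularized with separate values of `T`. -/
noncomputable def sidesSum (φ : ι → ℝ) (a : ι → MvPowerSeries σ ℂ) (pre l : List ι) (T₁ T₂ : ℂ) :
    MvPowerSeries σ ℂ :=
  splitSum (fun p x r => (-1) ^ p.length
    * (Li T₁ (leftArgs φ a x p) * Li T₂ (rightArgs φ a x r))) pre l

theorem coeff_splitSum (n : σ →₀ ℕ) (F : List ι → ι → List ι → MvPowerSeries σ ℂ)
    (pre l : List ι) :
    coeff n (splitSum F pre l) = splitSum (fun p x r => coeff n (F p x r)) pre l :=
  map_splitSum (coeff n).toAddMonoidHom F pre l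

theorem coeff_neg_one_pow_mul (n : σ →₀ ℕ) (j : ℕ) (F : MvPowerSeries σ ℂ) :
    coeff n ((-1) ^ j * F) = (-1) ^ j * coeff n F := by
  have : ((-1) ^ j : MvPowerSeries σ ℂ) = C ((-1) ^ j) := by simp
  rw [this, coeff_C_mul]

theorem hasDerivAt_coeff_mul_Li (n : σ →₀ ℕ) (G : MvPowerSeries σ ℂ)
    {p : List (ℝ × MvPowerSeries σ ℂ)} {y : ℝ × MvPowerSeries σ ℂ}
    (hp : ∀ x ∈ p ++ [y], constantCoeff x.2 = 0) (T : ℂ) :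
    HasDerivAt (fun T => coeff n (G * Li T (p ++ [y])))
      (if e y.1 = 1 then coeff n (G * Li T p) else 0) T := by
  classical
  have hp' : ∀ x ∈ p, constantCoeff x.2 = 0 := fun x hx => hp x (by simp [hx])
  have h1 : (if e y.1 = 1 then coeff n (G * Li T p) else 0)
      = ∑ q ∈ antidiagonal n, coeff q.1 G
        * (Polynomial.derivative (regCoeff zetaDenom (p ++ [y]) q.2)).eval T := by
    simp only [derivative_regCoeff_concat]
    split_ifs with h
    · rw [coeff_mul]
      exact sum_congr rfl fun q _ => by rw [eval_regCoeff _ hp']; rfl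
    · simp
  have h2 : (fun T => coeff n (G * Li T (p ++ [y]))) = fun T => ∑ q ∈ antidiagonal n,
      coeff q.1 G * (regCoeff zetaDenom (p ++ [y]) q.2).eval T := by
    funext T
    rw [coeff_mul]
    exact sum_congr rfl fun q _ => by rw [eval_regCoeff _ hp]; rfl
  rw [h1, h2]
  exact HasDerivAt.fun_sum fun q _ => ((regCoeff zetaDenom (p ++ [y]) q.2).hasDerivAt T).const_mul _

theorem hasDerivAt_splitSum {F F' : ℂ → List ι → ι → List ι → ℂ} {T : ℂ}
    (h : ∀ p x r, HasDerivAt (fun T => F T p x r) (F' T p x r) T) (pre l : List ι) :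
    HasDerivAt (fun T => splitSum (F T) pre l) (splitSum (F' T) pre l) T := by
  induction l generalizing pre with
  | nil => exact hasDerivAt_const T 0
  | cons y l ih => exact (h pre y l).add (ih _)

theorem splitSum_ite (P : Prop) [Decidable P] (F : List ι → ι → List ι → ℂ) (pre l : List ι) :
    splitSum (fun p x r => if P then F p x r else 0) pre l
      = if P then splitSum F pre l else 0 := by
  split_ifs
  · rfl
  · induction l generalizing pre with
    | nil => rfl
    | cons y l ih => simp [splitSum, ih]

theorem hasDerivAt_coeff_sidesSum_right {φ : ι → ℝ} {a : ι → MvPowerSeries σ ℂ}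
    (ha : ∀ i, constantCoeff (a i) = 0) (n : σ →₀ ℕ) (l : List ι) (y : ι) (T₁ T₂ : ℂ) :
    HasDerivAt (fun T => coeff n (sidesSum φ a [] (l ++ [y]) T₁ T))
      (if e (φ y) = 1 then coeff n (sidesSum φ a [] l T₁ T₂) else 0) T₂ := by
  simp only [sidesSum, splitSum_concat, map_add, coeff_splitSum, ← splitSum_ite]
  have hr : ∀ x r, rightArgs φ a x (r ++ [y])
      = rightArgs φ a x r ++ [(φ y, C (1 / 2) * (a y - a x))] := fun x r => by simp [rightArgs]
  rw [← add_zero (splitSum (fun p x r => if e (φ y) = 1 then _ else 0) [] l)]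
  refine HasDerivAt.add ?_ ?_
  · refine hasDerivAt_splitSum (F' := fun T₂ p x r => if e (φ y) = 1 then
      coeff n ((-1) ^ p.length * (Li T₁ (leftArgs φ a x p) * Li T₂ (rightArgs φ a x r))) else 0)
      (fun p x r => ?_) [] l
    simp only [hr, ← mul_assoc]
    refine hasDerivAt_coeff_mul_Li n _ ?_ T₂
    rw [← hr]
    exact constantCoeff_of_mem_rightArgs ha
  · simp only [rightArgs, List.map_nil, Li, genSeriesAt_nil]
    exact hasDerivAt_const _ _

theorem hasDerivAt_coeff_sidesSum_left {φ : ι → ℝ} {a : ι → MvPowerSeries σ ℂ}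
    (ha : ∀ i, constantCoeff (a i) = 0) (n : σ →₀ ℕ) (l : List ι) (y : ι) (T₁ T₂ : ℂ) :
    HasDerivAt (fun T => coeff n (sidesSum φ a [] (y :: l) T T₂))
      (if e (φ y) = 1 then -coeff n (sidesSum φ a [] l T₁ T₂) else 0) T₁ := by
  have hl : ∀ x r, leftArgs φ a x (r ++ [y])
      = leftArgs φ a x r ++ [(-φ y, C (1 / 2) * (a x - a y))] := fun x r => by simp [leftArgs]
  have h0 : -coeff n (sidesSum φ a [] l T₁ T₂) = splitSum (fun p x r =>
      coeff n (-((-1) ^ p.length) * Li T₂ (rightArgs φ a x r) * Li T₁ (leftArgs φ a x p))) [] l := by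
    rw [← map_neg, ← neg_one_mul, sidesSum, mul_splitSum, coeff_splitSum]
    refine splitSum_congr fun p x r _ => ?_
    congr 1
    ring
  simp only [sidesSum, splitSum, map_add]
  rw [sidesSum] at h0
  rw [h0, ← splitSum_ite, ← zero_add (splitSum _ _ _)]
  refine HasDerivAt.add ?_ ?_
  · simp only [leftArgs, List.map_nil, Li, genSeriesAt_nil]
    exact hasDerivAt_const _ _
  · have h3 : ∀ F : List ι → ι → List ι → MvPowerSeries σ ℂ,
        splitSum F [y] l = splitSum (fun p x r => F (p ++ [y]) x r) [] l :=
      fun F => splitSum_pre_concat F [] l y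
    simp only [h3, coeff_splitSum]
    refine hasDerivAt_splitSum (F' := fun T₁ p x r => if e (φ y) = 1 then
      coeff n (-((-1) ^ p.length) * Li T₂ (rightArgs φ a x r) * Li T₁ (leftArgs φ a x p)) else 0)
      (fun p x r => ?_) [] l
    have h1 : ∀ T, (-1) ^ (p ++ [y]).length
        * (Li T (leftArgs φ a x (p ++ [y])) * Li T₂ (rightArgs φ a x r))
        = (-((-1) ^ p.length) * Li T₂ (rightArgs φ a x r))
          * Li T (leftArgs φ a x p ++ [(-φ y, C (1 / 2) * (a x - a y))]) := fun T => by
      rw [hl, List.length_append, List.length_singleton, pow_succ]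
      ring
    simp only [h1]
    have h2 := hasDerivAt_coeff_mul_Li n (-((-1) ^ p.length) * Li T₂ (rightArgs φ a x r))
      (p := leftArgs φ a x p) (y := (-φ y, C (1 / 2) * (a x - a y)))
      (by rw [← hl]; exact constantCoeff_of_mem_leftArgs ha) T₁
    simpa only [e_neg_eq_one_iff] using h2

/-- The truncated counterpart of `sidesSum`. -/
noncomputable def truncSides (φ : ι → ℝ) (a : ι → MvPowerSeries σ ℂ) (l : List ι) (A B : ℤ) :
    MvPowerSeries σ ℂ :=
  splitSum (fun p x r => (-1) ^ p.length
    * (truncLi (leftArgs φ a x p) (A + 1) * truncLi (rightArgs φ a x r) (B + 1))) [] l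

theorem small_coeff_truncLi_sub (n : σ →₀ ℕ) {p : List (ℝ × MvPowerSeries σ ℂ)}
    (hp : ∀ x ∈ p, constantCoeff x.2 = 0) :
    Small fun M : ℕ => coeff n (truncLi p (M + 1)) - coeff n (Li (truncOne zetaDenom 0 M) p) := by
  have := small_coeff_nest_sub zetaInt_natCast regularDenom_zeta n hp
  simp only [eval_regCoeff _ hp] at this
  exact this

theorem logLip_coeff_truncLi (n : σ →₀ ℕ) {p : List (ℝ × MvPowerSeries σ ℂ)}
    (hp : ∀ x ∈ p, constantCoeff x.2 = 0) : LogLip fun M : ℕ => coeff n (truncLi p (M + 1)) :=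
  logLip_coeff_nest zetaInt_natCast regularDenom_zeta n hp

theorem logBdd_coeff_Li (n : σ →₀ ℕ) {p : List (ℝ × MvPowerSeries σ ℂ)}
    (hp : ∀ x ∈ p, constantCoeff x.2 = 0) :
    LogBdd fun M : ℕ => coeff n (Li (truncOne zetaDenom 0 M) p) := by
  have := (logBdd_truncOne regularDenom_zeta).polynomial_eval (regCoeff zetaDenom p n)
  simp only [eval_regCoeff _ hp] at this
  exact this

theorem small₂_coeff_truncSides_sub (φ : ι → ℝ) {a : ι → MvPowerSeries σ ℂ}
    (ha : ∀ i, constantCoeff (a i) = 0) (n : σ →₀ ℕ) (l : List ι) :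
    Small₂ fun A B => coeff n (truncSides φ a l A B)
      - coeff n (sidesSum φ a [] l (truncOne zetaDenom 0 A) (truncOne zetaDenom 0 B)) := by
  classical
  have h : ∀ A B : ℕ, coeff n (truncSides φ a l A B)
      - coeff n (sidesSum φ a [] l (truncOne zetaDenom 0 A) (truncOne zetaDenom 0 B))
      = splitSum (fun p x r => (-1) ^ p.length * ∑ q ∈ antidiagonal n,
        (coeff q.1 (truncLi (leftArgs φ a x p) (A + 1))
          * coeff q.2 (truncLi (rightArgs φ a x r) (B + 1))
        - coeff q.1 (Li (truncOne zetaDenom 0 A) (leftArgs φ a x p))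
          * coeff q.2 (Li (truncOne zetaDenom 0 B) (rightArgs φ a x r)))) [] l := fun A B => by
    rw [sub_eq_iff_eq_add, truncSides, sidesSum, coeff_splitSum, coeff_splitSum, ← splitSum_add]
    refine splitSum_congr fun p x r _ => ?_
    rw [coeff_neg_one_pow_mul, coeff_neg_one_pow_mul, coeff_mul, coeff_mul, ← mul_add,
      ← sum_add_distrib]
    simp only [sub_add_cancel]
  simp only [h]
  refine Small₂.splitSum (fun p x r => (Small₂.sum _ fun q _ => ?_).const_mul _) [] l
  exact small₂_mul_sub_mul (small_coeff_truncLi_sub _ (constantCoeff_of_mem_leftArgs ha))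
    (small_coeff_truncLi_sub _ (constantCoeff_of_mem_rightArgs ha))
    (logBdd_coeff_Li _ (constantCoeff_of_mem_leftArgs ha))
    (logBdd_coeff_Li _ (constantCoeff_of_mem_rightArgs ha))

theorem sum_truncSides_eq_zero {φ : ι → ℝ} {a : ι → MvPowerSeries σ ℂ}
    (ha : ∀ i, constantCoeff (a i) = 0) {l : List ι} (hl : 2 ≤ l.length)
    (hφ : e (l.map φ).sum = 1) (N : ℕ) :
    ∑ c ∈ range (N + 1), truncSides φ a l c ((N - c : ℕ) : ℤ) = 0 := by
  rw [← splitSum_convolution_eq_zero ha hl hφ (-1) (N + 1)]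
  simp only [truncSides, ← splitSum_sum]
  refine splitSum_congr fun p x r _ => ?_
  rw [mul_sum]
  refine sum_bij' (fun c _ => (c : ℤ)) (fun c _ => c.toNat) ?_ ?_ ?_ ?_ ?_
  · intro c hc
    simp only [mem_range, mem_Ioo] at *
    omega
  · intro c hc
    simp only [mem_range, mem_Ioo] at *
    omega
  · intro c hc
    simp
  · intro c hc
    simp only [mem_Ioo] at hc
    omega
  · intro c hc
    rw [mem_range] at hc
    have h1 : ((N - c : ℕ) : ℤ) + 1 = N + 1 - c := by omega
    rw [h1, sub_neg_eq_add]

/-- For an integral total phase, the alternating sum of products of left and right zeta series has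
no coefficients except possibly, for integral phases, its constant coefficient. By induction its
derivatives in `T₁` and `T₂` vanish, so that a coefficient is a constant; the vanishing of the coupled
convolution forces this constant to be zero. -/
theorem coeff_sidesSum_eq_zero {φ : ι → ℝ} {a : ι → MvPowerSeries σ ℂ}
    (ha : ∀ i, constantCoeff (a i) = 0) {n : σ →₀ ℕ} {l : List ι}
    (hφ : e (l.map φ).sum = 1) (hn : n ≠ 0 ∨ ∃ i ∈ l, e (φ i) ≠ 1) (T₁ T₂ : ℂ) :
    coeff n (sidesSum φ a [] l T₁ T₂) = 0 := by
  obtain ⟨d, hd⟩ : ∃ d, l.length = d := ⟨_, rfl⟩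
  induction d generalizing l T₁ T₂ with
  | zero =>
    rw [List.length_eq_zero_iff] at hd
    subst hd
    simp [sidesSum, splitSum]
  | succ d ih =>
    rcases Nat.eq_zero_or_pos d with rfl | hd0
    · obtain ⟨x, rfl⟩ := List.length_eq_one_iff.1 hd
      have hx : e (φ x) = 1 := by simpa using hφ
      have hn0 : n ≠ 0 := by
        rcases hn with h | ⟨i, hi, h⟩
        · exact h
        · rw [List.mem_singleton] at hi
          subst hi
          exact absurd hx h
      classical
      simp [sidesSum, splitSum, leftArgs, rightArgs, Li, genSeriesAt_nil, coeff_one, hn0]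
    -- the coefficient does not depend on `T₁`
    have hleft : ∀ S₁ S₁' S₂, coeff n (sidesSum φ a [] l S₁ S₂)
        = coeff n (sidesSum φ a [] l S₁' S₂) := by
      intro S₁ S₁' S₂
      obtain ⟨y, l', rfl⟩ : ∃ y l', l = y :: l' := by
        cases l with
        | nil => simp at hd
        | cons y l' => exact ⟨y, l', rfl⟩
      have hder : ∀ T, HasDerivAt (fun T => coeff n (sidesSum φ a [] (y :: l') T S₂)) 0 T := by
        intro T
        have h := hasDerivAt_coeff_sidesSum_left (φ := φ) ha n l' y T S₂
        split_ifs at h with hy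
        · rw [ih (l := l') ?_ ?_ T S₂ (by simpa using hd), neg_zero] at h
          · exact h
          · simpa [e_add, hy] using hφ
          · refine hn.imp id ?_
            rintro ⟨i, hi, h'⟩
            rcases List.mem_cons.1 hi with rfl | hi
            · exact absurd hy h'
            · exact ⟨i, hi, h'⟩
        · exact h
      exact is_const_of_deriv_eq_zero (fun T => (hder T).differentiableAt)
        (fun T => (hder T).deriv) S₁ S₁'
    -- nor on `T₂`
    have hright : ∀ S₁ S₂ S₂', coeff n (sidesSum φ a [] l S₁ S₂)
        = coeff n (sidesSum φ a [] l S₁ S₂') := by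
      intro S₁ S₂ S₂'
      obtain ⟨l', y, rfl⟩ : ∃ l' y, l = l' ++ [y] := by
        rcases List.eq_nil_or_concat l with rfl | ⟨l', y, rfl⟩
        · simp at hd
        · exact ⟨l', y, List.concat_eq_append⟩
      have hder : ∀ T, HasDerivAt (fun T => coeff n (sidesSum φ a [] (l' ++ [y]) S₁ T)) 0 T := by
        intro T
        have h := hasDerivAt_coeff_sidesSum_right (φ := φ) ha n l' y S₁ T
        split_ifs at h with hy
        · rw [ih (l := l') ?_ ?_ S₁ T (by simpa using hd)] at h
          · exact h
          · simpa [e_add, hy] using hφ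
          · refine hn.imp id ?_
            rintro ⟨i, hi, h'⟩
            rcases List.mem_append.1 hi with hi | hi
            · exact ⟨i, hi, h'⟩
            · rw [List.mem_singleton] at hi
              subst hi
              exact absurd hy h'
        · exact h
      exact is_const_of_deriv_eq_zero (fun T => (hder T).differentiableAt)
        (fun T => (hder T).deriv) S₂ S₂'
    rw [← neg_eq_zero]
    refine (small₂_coeff_truncSides_sub φ ha n l).eq_zero_of_sum_eq fun N => ?_
    rw [sum_sub_distrib, ← map_sum, sum_truncSides_eq_zero ha (by omega) hφ, map_zero, zero_sub]
    have hconst : ∀ c ∈ range (N + 1), coeff n (sidesSum φ a [] l (truncOne zetaDenom 0 c)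
        (truncOne zetaDenom 0 (N - c))) = coeff n (sidesSum φ a [] l T₁ T₂) := fun c _ =>
      (hleft _ T₁ _).trans (hright _ _ _)
    rw [sum_congr rfl hconst, sum_const, card_range, nsmul_eq_mul]
    push_cast
    ring

theorem small₂_coeff_truncSides {φ : ι → ℝ} {a : ι → MvPowerSeries σ ℂ}
    (ha : ∀ i, constantCoeff (a i) = 0) {n : σ →₀ ℕ} {l : List ι}
    (hφ : e (l.map φ).sum = 1) (hn : n ≠ 0 ∨ ∃ i ∈ l, e (φ i) ≠ 1) :
    Small₂ fun A B => coeff n (truncSides φ a l A B) := by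
  have h := small₂_coeff_truncSides_sub φ ha n l
  simpa only [coeff_sidesSum_eq_zero ha hφ hn, sub_zero] using h

end Sides

end MultipleT

namespace MultipleT

open Finset Filter Topology Polynomial

/-! ### The constant coefficient for integral phases -/

/-- A nested sum of factors that depend on the index only is an elementary symmetric polynomial in
these factors. -/
theorem nest_const_eq_coeff {ι : Type*} (g : ℤ → ℂ) (l : List ι) (A : ℤ) (n : ℕ) :
    nest (fun _ k => g k) l A (A + 1 + n)
      = (∏ k ∈ Ioo A (A + 1 + n), (1 + C (g k) * X)).coeff l.length := by
  have hI : ∀ n : ℕ, Ioo A (A + 1 + ((n + 1 : ℕ) : ℤ)) = insert (A + 1 + n) (Ioo A (A + 1 + n)) :=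
    fun n => by
      ext k
      simp only [mem_Ioo, mem_insert]
      push_cast
      omega
  have hnot : ∀ n : ℕ, (A + 1 + n : ℤ) ∉ Ioo A (A + 1 + n) := fun n => by simp
  have hempty : Ioo A (A + 1) = ∅ := by
    ext k
    simp only [mem_Ioo]
    constructor
    · omega
    · simp
  induction n generalizing l with
  | zero =>
    cases l with
    | nil => simp [nest, hempty]
    | cons x l => simp [nest, hempty, Polynomial.coeff_one]
  | succ n ih =>
    rw [hI, prod_insert (hnot n)]
    rcases List.eq_nil_or_concat l with rfl | ⟨l, x, rfl⟩
    · have := ih []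
      simp only [nest, List.length_nil] at this ⊢
      rw [mul_coeff_zero, ← this]
      simp
    · have h1 := ih (l ++ [x])
      rw [List.concat_eq_append, nest_concat, hI, sum_insert (hnot n), ← nest_concat (x := x)
        (g := fun _ k => g k), h1, ih l]
      rw [add_mul, one_mul, coeff_add, List.length_append, List.length_singleton, mul_assoc,
        coeff_C_mul, coeff_X_mul, add_comm]

/-- The factors belonging to `k` and `1 - k` are combined. -/
theorem prod_window_eq (M : ℕ) :
    ∏ k ∈ Ioo (-(M : ℤ)) (M + 1), (1 + C (tInt k)⁻¹ * X)
      = ∏ j ∈ range M, (1 + C (-(1 / (2 * (j : ℂ) + 1) ^ 2)) * X ^ 2) := by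
  induction M with
  | zero =>
    have : Ioo (-((0 : ℕ) : ℤ)) ((0 : ℕ) + 1) = ∅ := by
      ext k
      simp only [mem_Ioo]
      constructor
      · omega
      · simp
    rw [this, prod_empty, range_zero, prod_empty]
  | succ M ih =>
    have hI : Ioo (-((M + 1 : ℕ) : ℤ)) ((M + 1 : ℕ) + 1)
        = insert (-(M : ℤ)) (insert ((M : ℤ) + 1) (Ioo (-(M : ℤ)) (M + 1))) := by
      ext k
      simp only [mem_Ioo, mem_insert]
      push_cast
      omega
    rw [hI, prod_insert, prod_insert, ih, prod_range_succ]
    · have h1 : tInt (-(M : ℤ)) = -(2 * (M : ℂ) + 1) := by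
        unfold tInt
        push_cast
        ring
      have h2 : tInt ((M : ℤ) + 1) = 2 * (M : ℂ) + 1 := by
        unfold tInt
        push_cast
        ring
      have h3 : (C (-(1 / (2 * (M : ℂ) + 1) ^ 2)) : ℂ[X])
          = -(C (2 * (M : ℂ) + 1)⁻¹ * C (2 * (M : ℂ) + 1)⁻¹) := by
        rw [← C_mul, ← C_neg]
        congr 1
        rw [one_div, sq, mul_inv]
      rw [h1, h2, h3, inv_neg, C_neg]
      ring
    · simp
    · simp only [mem_insert, mem_Ioo]
      omega

/-- The product formula for the cosine near zero, obtained from that for the sine and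
`sin (2θ) = 2 sin θ cos θ` by sorting the factors of `sin (π z)` by parity. -/
theorem tendsto_euler_cos_prod {z : ℂ} (hz : ‖z‖ < 1) :
    Tendsto (fun M : ℕ => ∏ j ∈ range M, (1 + -(z ^ 2 / (2 * (j : ℂ) + 1) ^ 2))) atTop
      (𝓝 (Complex.cos (Real.pi * z / 2))) := by
  rcases eq_or_ne z 0 with rfl | hz0
  · simp
  have hsplit : ∀ n : ℕ, ∏ j ∈ range (2 * n), ((1 : ℂ) - z ^ 2 / ((j : ℂ) + 1) ^ 2)
      = (∏ j ∈ range n, (1 + -(z ^ 2 / (2 * (j : ℂ) + 1) ^ 2)))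
        * ∏ j ∈ range n, ((1 : ℂ) - (z / 2) ^ 2 / ((j : ℂ) + 1) ^ 2) := by
    intro n
    induction n with
    | zero => simp
    | succ n ih =>
      rw [Nat.mul_succ, prod_range_succ, prod_range_succ, ih, prod_range_succ, prod_range_succ]
      have h1 : (z / 2) ^ 2 / ((n : ℂ) + 1) ^ 2 = z ^ 2 / (((2 * n + 1 : ℕ) : ℂ) + 1) ^ 2 := by
        have h2 : ((n : ℂ) + 1) ≠ 0 := Nat.cast_add_one_ne_zero n
        have h3 : (((2 * n + 1 : ℕ) : ℂ) + 1) = 2 * (n + 1) := by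
          push_cast
          ring
        rw [h3]
        field_simp
      rw [h1]
      push_cast
      ring
  have hπ : (Real.pi : ℂ) ≠ 0 := by exact_mod_cast Real.pi_ne_zero
  have hsin : Complex.sin (Real.pi * (z / 2)) ≠ 0 := by
    rw [Complex.sin_ne_zero_iff]
    intro k hk
    have h1 : z = 2 * k := by
      have : (Real.pi : ℂ) * (z / 2) = Real.pi * k := by rw [hk]; ring
      have := mul_left_cancel₀ hπ this
      linear_combination 2 * this
    rcases eq_or_ne k 0 with rfl | hk0
    · exact hz0 (by simpa using h1)
    · rw [h1, norm_mul, Complex.norm_intCast] at hz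
      have h2 : (1 : ℝ) ≤ |(k : ℝ)| := by
        have := Int.one_le_abs hk0
        exact_mod_cast this
      have h3 : ‖(2 : ℂ)‖ = 2 := by simp
      rw [h3] at hz
      linarith
  have t1 := (Complex.tendsto_euler_sin_prod z).comp (tendsto_id.const_mul_atTop' two_pos)
  have t2 := Complex.tendsto_euler_sin_prod (z / 2)
  have t3 := (t1.div t2 hsin).const_mul (1 / 2)
  have hlim : 1 / 2 * (Complex.sin (Real.pi * z) / Complex.sin (Real.pi * (z / 2)))
      = Complex.cos (Real.pi * z / 2) := by
    have : (Real.pi : ℂ) * z = 2 * (Real.pi * (z / 2)) := by ring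
    rw [this, Complex.sin_two_mul, show 2 * ((Real.pi : ℂ) * (z / 2)) / 2 = Real.pi * (z / 2) by ring]
    generalize (Real.pi : ℂ) * (z / 2) = θ at hsin
    field_simp
  rw [hlim] at t3
  have hne : ∀ᶠ n : ℕ in atTop, (Real.pi : ℂ) * (z / 2)
      * ∏ j ∈ range n, ((1 : ℂ) - (z / 2) ^ 2 / ((j : ℂ) + 1) ^ 2) ≠ 0 :=
    t2.eventually_ne hsin
  refine t3.congr' ?_
  filter_upwards [hne] with n hn
  simp only [Pi.div_apply, Function.comp, id, hsplit n]
  have h4 := right_ne_zero_of_mul hn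
  generalize ∏ j ∈ range n, ((1 : ℂ) - (z / 2) ^ 2 / ((j : ℂ) + 1) ^ 2) = P at h4
  generalize ∏ j ∈ range n, ((1 : ℂ) + -(z ^ 2 / (2 * (j : ℂ) + 1) ^ 2)) = Q
  field_simp

/-- The coefficients converge to those of `cos (π z / 2)`, since locally uniform convergence of
holomorphic functions passes to derivatives at zero. -/
theorem tendsto_coeff_prod_window (m : ℕ) :
    Tendsto (fun M : ℕ => (∏ j ∈ range M, (1 + C (-(1 / (2 * (j : ℂ) + 1) ^ 2)) * X ^ 2)).coeff m)
      atTop (𝓝 (if Even m then 1 / (m.factorial : ℂ) * (Complex.I * Real.pi / 2) ^ m else 0)) := by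
  set Q : ℕ → ℂ[X] := fun M => ∏ j ∈ range M, (1 + C (-(1 / (2 * (j : ℂ) + 1) ^ 2)) * X ^ 2)
    with hQ
  set F : ℂ → ℂ := fun z => Complex.cos (Real.pi * z / 2) with hF
  have hQeval : ∀ M z, (Q M).eval z = ∏ j ∈ range M, (1 + -(z ^ 2 / (2 * (j : ℂ) + 1) ^ 2)) := by
    intro M z
    simp only [hQ, eval_prod, eval_add, eval_one, eval_mul, eval_C, eval_pow, eval_X]
    refine prod_congr rfl fun j _ => ?_
    ring
  have hU : IsOpen (Metric.ball (0 : ℂ) 1) := Metric.isOpen_ball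
  have hloc : TendstoLocallyUniformlyOn (fun M z => (Q M).eval z) F atTop (Metric.ball 0 1) := by
    have hsum : Summable fun j : ℕ => 1 / ((j : ℝ) + 1) ^ 2 := by
      have := (summable_nat_add_iff 1).2 (Real.summable_one_div_nat_pow.2 one_lt_two)
      simpa using this
    have h := (hsum.hasProdLocallyUniformlyOn_nat_one_add
      (f := fun (j : ℕ) (z : ℂ) => -(z ^ 2 / (2 * (j : ℂ) + 1) ^ 2)) hU
      (Eventually.of_forall fun j z hz => ?_) (fun j => by fun_prop)).tendstoLocallyUniformlyOn_finsetRange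
    · simp only [hQeval]
      refine h.congr_right fun z hz => ?_
      exact tendsto_nhds_unique (h.tendsto_at hz) (tendsto_euler_cos_prod (by simpa using hz))
    · have hz' : ‖z‖ < 1 := by simpa using hz
      have h1 : ‖2 * (j : ℂ) + 1‖ = 2 * j + 1 := by
        have : (2 * (j : ℂ) + 1) = ((2 * j + 1 : ℕ) : ℂ) := by push_cast; ring
        rw [this, Complex.norm_natCast]
        push_cast
        ring
      rw [norm_neg, norm_div, norm_pow, norm_pow, h1]
      have h2 : ‖z‖ ^ 2 ≤ 1 := pow_le_one₀ (norm_nonneg _) hz'.le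
      gcongr
      linarith [(Nat.cast_nonneg j : (0 : ℝ) ≤ j)]
  have hder : ∀ m : ℕ, TendstoLocallyUniformlyOn (fun M z => (derivative^[m] (Q M)).eval z)
      (deriv^[m] F) atTop (Metric.ball 0 1) := by
    intro m
    induction m with
    | zero => simpa using hloc
    | succ m ih =>
      have h := ih.deriv (Eventually.of_forall fun M => (Polynomial.differentiable _).differentiableOn) hU
      simp only [Function.iterate_succ_apply']
      convert h using 2 with M
      funext z
      simp
  have hlim := (hder m).tendsto_at (Metric.mem_ball_self one_pos)
  have hcoeff : ∀ M, (derivative^[m] (Q M)).eval 0 = m.factorial * (Q M).coeff m := by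
    intro M
    rw [← coeff_zero_eq_eval_zero, coeff_iterate_derivative, zero_add, Nat.descFactorial_self,
      nsmul_eq_mul]
  have hFder : deriv^[m] F 0 = if Even m then (Complex.I * Real.pi / 2) ^ m else 0 := by
    have hF' : F = fun z => (1 / 2 : ℂ) * (Complex.exp ((Complex.I * Real.pi / 2) * z)
        + Complex.exp ((-(Complex.I * Real.pi / 2)) * z)) := by
      funext z
      simp only [hF, Complex.cos]
      rw [show (Real.pi : ℂ) * z / 2 * Complex.I = Complex.I * Real.pi / 2 * z by ring,
        show -((Real.pi : ℂ) * z / 2) * Complex.I = -(Complex.I * Real.pi / 2) * z by ring]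
      ring
    rw [← iteratedDeriv_eq_iterate, hF', iteratedDeriv_const_mul_field, iteratedDeriv_fun_add,
      iteratedDeriv_cexp_const_mul, iteratedDeriv_cexp_const_mul]
    · simp only [mul_zero, Complex.exp_zero, mul_one]
      split_ifs with hm
      · rw [hm.neg_pow]
        ring
      · rw [(Nat.not_even_iff_odd.1 hm).neg_pow]
        ring
    · exact ContDiff.contDiffAt (by fun_prop)
    · exact ContDiff.contDiffAt (by fun_prop)
  simp only [hcoeff, hFder] at hlim
  have hm : (m.factorial : ℂ) ≠ 0 := by exact_mod_cast m.factorial_ne_zero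
  have h := hlim.const_mul (1 / (m.factorial : ℂ))
  convert h using 2
  · rename_i M
    rw [← mul_assoc, one_div_mul_cancel hm, one_mul]
  · split_ifs <;> simp

end MultipleT

namespace MultipleT

open Finset MvPowerSeries Filter Topology

/-! ### Regularization of sequences of power series -/

section Regularization

variable {σ ι : Type*}

/-- A sequence of power series whose coefficients are asymptotic to polynomials in the harmonic
numbers, the constant terms of which are the coefficients of `F`. -/
def Regularizes (f : ℕ → MvPowerSeries σ ℂ) (F : MvPowerSeries σ ℂ) : Prop :=
  ∀ n, ∃ P : Polynomial ℂ, P.eval 0 = coeff n F ∧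
    Small fun M => coeff n (f M) - P.eval (truncOne zetaDenom 0 M)

theorem regularizes_const (F : MvPowerSeries σ ℂ) : Regularizes (fun _ => F) F := fun n =>
  ⟨Polynomial.C (coeff n F), by simp, by simpa using small_zero⟩

theorem Regularizes.add {f g : ℕ → MvPowerSeries σ ℂ} {F G : MvPowerSeries σ ℂ}
    (hf : Regularizes f F) (hg : Regularizes g G) :
    Regularizes (fun M => f M + g M) (F + G) := fun n => by
  obtain ⟨P, hP, h⟩ := hf n
  obtain ⟨Q, hQ, h'⟩ := hg n
  refine ⟨P + Q, by simp [hP, hQ], ?_⟩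
  convert h.add h' using 2
  simp only [map_add, Polynomial.eval_add]
  ring

theorem Regularizes.mul {f g : ℕ → MvPowerSeries σ ℂ} {F G : MvPowerSeries σ ℂ}
    (hf : Regularizes f F) (hg : Regularizes g G) :
    Regularizes (fun M => f M * g M) (F * G) := fun n => by
  classical
  choose P hP h using hf
  choose Q hQ h' using hg
  refine ⟨∑ q ∈ antidiagonal n, P q.1 * Q q.2, ?_, ?_⟩
  · simp [Polynomial.eval_finsetSum, coeff_mul, hP, hQ]
  · have hbd : ∀ R : Polynomial ℂ, LogBdd fun M => R.eval (truncOne zetaDenom 0 M) :=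
      (logBdd_truncOne regularDenom_zeta).polynomial_eval
    have hs : Small fun M => ∑ q ∈ antidiagonal n,
        ((coeff q.1 (f M) - (P q.1).eval (truncOne zetaDenom 0 M)) * coeff q.2 (g M)
          + (coeff q.2 (g M) - (Q q.2).eval (truncOne zetaDenom 0 M))
            * (P q.1).eval (truncOne zetaDenom 0 M)) := by
      refine Small.sum _ fun q _ => ((h q.1).mul ?_).add ((h' q.2).mul (hbd _))
      simpa using (h' q.2).logBdd.add (hbd (Q q.2))
    convert hs using 2
    rw [coeff_mul, Polynomial.eval_finsetSum, ← sum_sub_distrib]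
    refine sum_congr rfl fun q _ => ?_
    rw [Polynomial.eval_mul]
    ring

theorem Regularizes.sub {f g : ℕ → MvPowerSeries σ ℂ} {F G : MvPowerSeries σ ℂ}
    (hf : Regularizes f F) (hg : Regularizes g G) :
    Regularizes (fun M => f M - g M) (F - G) := by
  simpa [sub_eq_add_neg] using hf.add ((regularizes_const (-1)).mul hg)

theorem Regularizes.sum {κ : Type*} (s : Finset κ) {f : κ → ℕ → MvPowerSeries σ ℂ}
    {F : κ → MvPowerSeries σ ℂ} (h : ∀ i ∈ s, Regularizes (f i) (F i)) :
    Regularizes (fun M => ∑ i ∈ s, f i M) (∑ i ∈ s, F i) := by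
  classical
  induction s using Finset.induction_on with
  | empty => simpa using regularizes_const 0
  | insert i s hi ih =>
    simp only [sum_insert hi]
    exact (h i (mem_insert_self _ _)).add (ih fun j hj => h j (mem_insert_of_mem hj))

theorem Regularizes.splitSum {f : ℕ → List ι → ι → List ι → MvPowerSeries σ ℂ}
    {F : List ι → ι → List ι → MvPowerSeries σ ℂ}
    (h : ∀ p x r, Regularizes (fun M => f M p x r) (F p x r)) (pre l : List ι) :
    Regularizes (fun M => MultipleT.splitSum (f M) pre l) (MultipleT.splitSum F pre l) := by
  induction l generalizing pre with
  | nil => exact regularizes_const 0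
  | cons y l ih => exact (h pre y l).add (ih _)

theorem regularizes_truncLi {p : List (ℝ × MvPowerSeries σ ℂ)}
    (hp : ∀ x ∈ p, constantCoeff x.2 = 0) :
    Regularizes (fun M : ℕ => truncLi p (M + 1)) (Li 0 p) := fun n =>
  ⟨regCoeff zetaDenom p n, eval_regCoeff _ hp n 0,
    small_coeff_nest_sub zetaInt_natCast regularDenom_zeta n hp⟩

/-- The sums of `1 / (2k - 1)` are asymptotically half of those of `1 / k` plus `log 2`, so that
`T = 0` for zeta values corresponds to `T = log 2` for `t`-values. -/
theorem regularizes_nest_tInt {p : List (ℝ × MvPowerSeries σ ℂ)}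
    (hp : ∀ x ∈ p, constantCoeff x.2 = 0) :
    Regularizes (fun M : ℕ => nest (serLetter tInt) p 0 (M + 1)) (Lit (Real.log 2) p) := fun n => by
  refine ⟨(regCoeff tDenom p n).comp (Polynomial.C (1 / 2) * Polynomial.X
    + Polynomial.C (Real.log 2 : ℂ)), ?_, ?_⟩
  · simp [Polynomial.eval_comp, eval_regCoeff _ hp, Lit]
  · have hz := logBdd_truncOne regularDenom_zeta
    have h1 := Small.polynomial_eval_sub (g := fun M => truncOne zetaDenom 0 M / 2 + Real.log 2)
      (logBdd_truncOne regularDenom_t)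
      (by simpa [div_eq_inv_mul] using ((logBdd_const (1 / 2)).mul hz).add (logBdd_const _))
      small_truncOne_tDenom_sub (regCoeff tDenom p n)
    convert (small_coeff_nest_sub tInt_natCast regularDenom_t n hp).add h1 using 2
    simp only [Polynomial.eval_comp, Polynomial.eval_add, Polynomial.eval_mul, Polynomial.eval_C,
      Polynomial.eval_X]
    rw [one_div_mul_eq_div]
    ring

theorem tendsto_norm_truncOne_zetaDenom :
    Tendsto (fun M => ‖truncOne zetaDenom 0 M‖) atTop atTop := by
  have h1 : ∀ M, ‖truncOne zetaDenom 0 M‖ = ∑ k ∈ range M, 1 / ((k : ℝ) + 1) := fun M => by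
    have h2 : lam M - 1 = ∑ k ∈ range M, 1 / ((k : ℝ) + 1) := by
      unfold lam
      ring
    rw [truncOne_zetaDenom, Complex.norm_real, h2, Real.norm_of_nonneg]
    positivity
  simp only [h1]
  exact Real.tendsto_sum_range_one_div_nat_succ_atTop

/-- A polynomial in the harmonic numbers that converges is constant. -/
theorem Regularizes.eq_of_tendsto {f : ℕ → MvPowerSeries σ ℂ} {F G : MvPowerSeries σ ℂ}
    (hf : Regularizes f F) (h : ∀ n, Tendsto (fun M => coeff n (f M)) atTop (𝓝 (coeff n G))) :
    F = G := by
  ext n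
  obtain ⟨P, hP, hs⟩ := hf n
  have h1 : Tendsto (fun M => P.eval (truncOne zetaDenom 0 M)) atTop (𝓝 (coeff n G)) := by
    simpa using (h n).sub hs.tendsto
  have hdeg : ¬ 0 < P.degree := fun hd =>
    not_tendsto_nhds_of_tendsto_atTop
      (P.tendsto_norm_atTop hd tendsto_norm_truncOne_zetaDenom) _ h1.norm
  obtain ⟨c, rfl⟩ : ∃ c, P = Polynomial.C c := ⟨_, Polynomial.eq_C_of_degree_le_zero (not_lt.1 hdeg)⟩
  simp only [Polynomial.eval_C] at h1 hP
  rw [← hP]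
  exact tendsto_nhds_unique tendsto_const_nhds h1

end Regularization

/-! ### Decoupling the truncations -/

section Decoupling

variable {σ ι : Type*}

/-- The truncated `t`-Bernoulli series. -/
noncomputable def truncBt (φ : ℝ) (a : MvPowerSeries σ ℂ) (M : ℕ) : MvPowerSeries σ ℂ :=
  ∑ k ∈ Ioo (-(M : ℤ)) (M + 1), serLetter tInt (φ, a) k

theorem regularizes_truncBt (φ : ℝ) {a : MvPowerSeries σ ℂ} (ha : constantCoeff a = 0) :
    Regularizes (truncBt φ a) (Bt (Real.log 2) φ a) := by
  have h1 : truncBt φ a = fun M : ℕ => nest (serLetter tInt) [(φ, a)] 0 (M + 1)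
      - C (e φ) * nest (serLetter tInt) [(-φ, -a)] 0 (M + 1) := by
    funext M
    have h := window_eq_sum (fun _ : Unit => φ) (fun _ => a) [()] M
    have h2 : window (fun _ : Unit => φ) (fun _ => a) [()] (-M) (M + 1) = truncBt φ a M := by
      simp [window, nest, truncBt]
    rw [h2, List.length_singleton, sum_range_succ, sum_range_one] at h
    rw [h]
    simp [nest, e_zero, sub_eq_add_neg]
  rw [h1]
  exact (regularizes_nest_tInt (by simpa using ha)).sub
    ((regularizes_const _).mul (regularizes_nest_tInt (by simpa using ha)))

/-- The index range of a window is symmetric under `k ↦ 1 - k`. -/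
theorem sum_Ioo_neg_eq {V : Type*} [AddCommMonoid V] (f : ℤ → V) (M : ℕ) :
    ∑ k ∈ Ioo (-(M : ℤ)) (M + 1), f k = ∑ k ∈ Ioc 0 M, f k + ∑ k ∈ Ioc 0 M, f (1 - k) := by
  have h1 : Ioo (-(M : ℤ)) (M + 1) = Ioo ((0 : ℕ) : ℤ) (M + 1) ∪ Ioo (-(M : ℤ)) 1 := by
    ext k
    simp only [mem_Ioo, mem_union]
    omega
  have h2 : Disjoint (Ioo ((0 : ℕ) : ℤ) (M + 1)) (Ioo (-(M : ℤ)) 1) := by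
    rw [disjoint_left]
    intro k
    simp only [mem_Ioo]
    omega
  rw [h1, sum_union h2, sum_Ioo_int]
  congr 1
  rw [← sum_Ioo_int (fun k => f (1 - k))]
  refine sum_bij' (fun k _ => 1 - k) (fun k _ => 1 - k) ?_ ?_ ?_ ?_ ?_
  · intro k hk
    simp only [mem_Ioo] at *
    omega
  · intro k hk
    simp only [mem_Ioo] at *
    omega
  · intro k _
    omega
  · intro k _
    omega
  · intro k _
    rw [sub_sub_cancel]

/-- The terms of the geometric series for `1 / (2k - 1 - a)` are those of letters `(r + 1, e(φ))`. -/
theorem coeff_serLetter_tInt_mul (n : σ →₀ ℕ) (φ : ℝ) {a : MvPowerSeries σ ℂ}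
    (ha : constantCoeff a = 0) {k : ℕ} (hk : 1 ≤ k) (G : MvPowerSeries σ ℂ) :
    coeff n (serLetter tInt (φ, a) k * G) = ∑ r ∈ range (n.degree + 1),
      letterTerm tDenom (r + 1, e φ) k * coeff n (G * a ^ r) := by
  have h1 : serLetter tInt (φ, a) k * G = (C (e (φ * k)) * G) * (C (tDenom k) - a)⁻¹ := by
    rw [serLetter, tInt_natCast]
    push_cast
    ring
  rw [h1, coeff_mul_inv_C_sub ha (regularDenom_t.ne_zero (by omega))]
  refine sum_congr rfl fun r _ => ?_
  rw [mul_assoc (C _), coeff_C_mul, e_mul_nat, letterTerm]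
  ring

/-- `TailBdd.small_convolution` for the coefficients of products of power series. -/
theorem small_coeff_convolution {γ : ℕ → ℂ} (hγ : TailBdd γ) {f h : ℕ → MvPowerSeries σ ℂ}
    (hf : ∀ n, LogLip fun M => coeff n (f M)) (hh : ∀ n, LogLip fun M => coeff n (h M))
    (n : σ →₀ ℕ) (G : MvPowerSeries σ ℂ) :
    Small fun M => ∑ k ∈ Ioc 0 M,
      γ k * coeff n ((f (M - k) * h (M + (k - 1)) - f M * h M) * G) := by
  classical
  have h1 : Small fun M => ∑ q ∈ antidiagonal n, ∑ s ∈ antidiagonal q.1, coeff q.2 G *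
      ∑ k ∈ Ioc 0 M, γ k * (coeff s.1 (f (M - k)) * coeff s.2 (h (M + (k - 1)))
        - coeff s.1 (f M) * coeff s.2 (h M)) :=
    Small.sum _ fun q _ => Small.sum _ fun s _ =>
      (hγ.small_convolution (hf s.1) (hh s.2)).const_mul _
  convert h1 using 2 with M
  simp only [mul_sum]
  rw [sum_congr rfl fun q _ => sum_comm, sum_comm]
  refine sum_congr rfl fun k _ => ?_
  rw [coeff_mul, mul_sum]
  refine sum_congr rfl fun q _ => ?_
  rw [map_sub, coeff_mul, coeff_mul, ← sum_sub_distrib, sum_mul, mul_sum]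
  refine sum_congr rfl fun s _ => ?_
  ring

theorem Small.splitSum {E : ℕ → List ι → ι → List ι → ℂ}
    (h : ∀ p x r, Small fun M => E M p x r) (pre l : List ι) :
    Small fun M => MultipleT.splitSum (E M) pre l := by
  induction l generalizing pre with
  | nil => exact small_zero
  | cons y l ih => exact (h pre y l).add (ih _)

/-- The part of the decoupling error of one place that comes from the terms of degree `r` of the
geometric series `1 / (2k - 1 - a) = ∑ a ^ r / (2k - 1) ^ (r + 1)`, for positive and for nonpositive
indices. Here `f` and `h` are the zeta series to the left and to the right of the place. -/
noncomputable def decouplingError (Φ : ℝ) (a : MvPowerSeries σ ℂ) (f h : ℕ → MvPowerSeries σ ℂ)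
    (n : σ →₀ ℕ) (r M : ℕ) : ℂ :=
  ∑ k ∈ Ioc 0 M, letterTerm tDenom (r + 1, e Φ) k
      * coeff n ((h (M - k) * f (M + (k - 1)) - h M * f M) * a ^ r)
    - e Φ * ∑ k ∈ Ioc 0 M, letterTerm tDenom (r + 1, e (-Φ)) k
      * coeff n ((f (M - k) * h (M + (k - 1)) - f M * h M) * (-a) ^ r)

theorem coeff_sum_decoupling (Φ : ℝ) {a : MvPowerSeries σ ℂ} (ha : constantCoeff a = 0)
    (F G : ℤ → MvPowerSeries σ ℂ) (n : σ →₀ ℕ) (M : ℕ) :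
    coeff n (∑ c ∈ Ioo (-(M : ℤ)) (M + 1), serLetter tInt (Φ, a) c
        * (F (c + M) * G (M + 1 - c) - F (M + 1) * G (M + 1)))
      = ∑ r ∈ range (n.degree + 1),
        decouplingError Φ a (fun M : ℕ => F (M + 1)) (fun M : ℕ => G (M + 1)) n r M := by
  have ha' : constantCoeff (-a) = 0 := by simp [ha]
  simp only [decouplingError]
  rw [sum_Ioo_neg_eq, map_add, map_sum, map_sum, sum_sub_distrib, sub_eq_add_neg]
  congr 1
  · rw [sum_comm]
    refine sum_congr rfl fun k hk => ?_
    rw [mem_Ioc] at hk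
    rw [coeff_serLetter_tInt_mul n Φ ha hk.1]
    have h1 : ((M + (k - 1) : ℕ) : ℤ) + 1 = k + M := by omega
    have h2 : ((M - k : ℕ) : ℤ) + 1 = M + 1 - k := by omega
    simp only [h1, h2, mul_comm (G _)]
  · rw [← mul_sum, sum_comm, mul_sum, ← sum_neg_distrib]
    refine sum_congr rfl fun k hk => ?_
    rw [mem_Ioc] at hk
    rw [serLetter_tInt_one_sub, mul_assoc, coeff_C_mul, coeff_serLetter_tInt_mul n (-Φ) ha' hk.1]
    have h1 : ((M + (k - 1) : ℕ) : ℤ) + 1 = M + 1 - (1 - k) := by omega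
    have h2 : ((M - k : ℕ) : ℤ) + 1 = 1 - k + M := by omega
    simp only [h1, h2, neg_mul]

theorem small_decouplingError {Φ : ℝ} {r : ℕ} (hr : (r + 1, e Φ) ≠ ((1, 1) : Letter))
    (a : MvPowerSeries σ ℂ) {f h : ℕ → MvPowerSeries σ ℂ}
    (hf : ∀ n, LogLip fun M => coeff n (f M)) (hh : ∀ n, LogLip fun M => coeff n (h M))
    (n : σ →₀ ℕ) : Small (decouplingError Φ a f h n r) := by
  have hv : ∀ Φ, ValidLetter (r + 1, e Φ) := fun Φ => ⟨by simp, norm_e Φ⟩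
  have hr' : (r + 1, e (-Φ)) ≠ ((1, 1) : Letter) := by
    intro h
    rw [Prod.mk.injEq, e_neg_eq_one_iff] at h
    exact hr (Prod.ext h.1 h.2)
  exact (small_coeff_convolution (tailBdd_letterTerm regularDenom_t (hv _) hr) hh hf n _).sub
    ((small_coeff_convolution (tailBdd_letterTerm regularDenom_t (hv _) hr') hf hh n _).const_mul _)

/-- In the terms `1 / (2k - 1)` of a sum with integral total phase, the decoupled products cancel
between `k` and `1 - k`. -/
theorem decouplingError_zero {Φ : ℝ} (hΦ : e Φ = 1) (a : MvPowerSeries σ ℂ)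
    (f h : ℕ → MvPowerSeries σ ℂ) (n : σ →₀ ℕ) (M : ℕ) :
    decouplingError Φ a f h n 0 M = ∑ k ∈ Ioc 0 M, letterTerm tDenom (1, 1) k
      * (coeff n (f (M + (k - 1)) * h (M - k)) - coeff n (f (M - k) * h (M + (k - 1)))) := by
  rw [decouplingError, hΦ, (e_neg_eq_one_iff Φ).2 hΦ, one_mul, ← sum_sub_distrib]
  refine sum_congr rfl fun k _ => ?_
  simp only [pow_zero, mul_one, zero_add, map_sub, mul_comm (h _)]
  ring

/-- The truncations of the zeta series in the partial fraction expansion of a window may be decoupled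
from the index of the `t`-Bernoulli series, except in the constant coefficient for integral
phases. -/
theorem small_coeff_decoupling {φ : ι → ℝ} {a : ι → MvPowerSeries σ ℂ}
    (ha : ∀ i, constantCoeff (a i) = 0) {n : σ →₀ ℕ} {l : List ι}
    (hn : n ≠ 0 ∨ ∃ i ∈ l, e (φ i) ≠ 1) :
    Small fun M : ℕ => coeff n (splitSum (fun p x r => (-1) ^ p.length
      * ∑ c ∈ Ioo (-(M : ℤ)) (M + 1), serLetter tInt ((l.map φ).sum, a x) c
        * (truncLi (leftArgs φ a x p) (c + M) * truncLi (rightArgs φ a x r) (M + 1 - c)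
          - truncLi (leftArgs φ a x p) (M + 1) * truncLi (rightArgs φ a x r) (M + 1))) [] l) := by
  set Φ := (l.map φ).sum with hΦ
  set f : List ι → ι → ℕ → MvPowerSeries σ ℂ := fun p x M => truncLi (leftArgs φ a x p) (M + 1)
  set h : List ι → ι → ℕ → MvPowerSeries σ ℂ := fun r x M => truncLi (rightArgs φ a x r) (M + 1)
  have hf : ∀ p x n, LogLip fun M => coeff n (f p x M) := fun p x n =>
    logLip_coeff_truncLi n (constantCoeff_of_mem_leftArgs ha)
  have hh : ∀ r x n, LogLip fun M => coeff n (h r x M) := fun r x n =>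
    logLip_coeff_truncLi n (constantCoeff_of_mem_rightArgs ha)
  have key : ∀ M : ℕ, coeff n (splitSum (fun p x r => (-1) ^ p.length
      * ∑ c ∈ Ioo (-(M : ℤ)) (M + 1), serLetter tInt (Φ, a x) c
        * (truncLi (leftArgs φ a x p) (c + M) * truncLi (rightArgs φ a x r) (M + 1 - c)
          - truncLi (leftArgs φ a x p) (M + 1) * truncLi (rightArgs φ a x r) (M + 1))) [] l)
      = ∑ d ∈ range (n.degree + 1), splitSum (fun p x r =>
        (-1) ^ p.length * decouplingError Φ (a x) (f p x) (h r x) n d M) [] l := fun M => by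
    rw [coeff_splitSum, ← splitSum_sum]
    refine splitSum_congr fun p x r _ => ?_
    rw [coeff_neg_one_pow_mul, coeff_sum_decoupling Φ (ha x) (truncLi (leftArgs φ a x p))
      (truncLi (rightArgs φ a x r)), mul_sum]
  simp only [key]
  refine Small.sum _ fun d _ => ?_
  by_cases hd : (d + 1, e Φ) = ((1, 1) : Letter)
  · obtain ⟨hd0, he⟩ := Prod.mk.inj hd
    obtain rfl : d = 0 := by omega
    have hE := small₂_coeff_truncSides ha he hn
    have hg : ∀ k : ℕ, 1 ≤ k → ‖letterTerm tDenom (1, 1) k‖ ≤ 1 / k := fun k hk =>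
      norm_letterTerm_le_one_div regularDenom_t ⟨le_rfl, by simp⟩ hk
    have hs := (hE.swap.small_convolution hg).sub (hE.small_convolution hg)
    convert hs using 2 with M
    rw [← sum_sub_distrib]
    simp only [decouplingError_zero he, mul_sum, splitSum_sum]
    refine sum_congr rfl fun k _ => ?_
    rw [eq_sub_iff_add_eq, truncSides, truncSides, coeff_splitSum, coeff_splitSum, mul_splitSum,
      mul_splitSum, ← splitSum_add]
    refine splitSum_congr fun p x r _ => ?_
    rw [coeff_neg_one_pow_mul, coeff_neg_one_pow_mul]
    ring
  · exact Small.splitSum (fun p x r => (small_decouplingError hd _ (hf p x) (hh r x) n).const_mul _)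
      [] l

end Decoupling

/-! ### The symmetry identity -/

section Symmetry

variable {σ ι : Type*}

/-- The window minus the decoupled right side is the sum of the decoupling errors. -/
theorem window_sub_eq (φ : ι → ℝ) {a : ι → MvPowerSeries σ ℂ}
    (ha : ∀ i, constantCoeff (a i) = 0) {l : List ι} (hl : l ≠ []) (M : ℕ) :
    window φ a l (-M) (M + 1) - C ((1 / 2) ^ (l.length - 1)) * splitSum (fun p x r =>
        (-1) ^ p.length * (truncLi (leftArgs φ a x p) (M + 1) * truncBt (l.map φ).sum (a x) M
          * truncLi (rightArgs φ a x r) (M + 1))) [] l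
      = C ((1 / 2) ^ (l.length - 1)) * splitSum (fun p x r => (-1) ^ p.length
        * ∑ c ∈ Ioo (-(M : ℤ)) (M + 1), serLetter tInt ((l.map φ).sum, a x) c
          * (truncLi (leftArgs φ a x p) (c + M) * truncLi (rightArgs φ a x r) (M + 1 - c)
            - truncLi (leftArgs φ a x p) (M + 1) * truncLi (rightArgs φ a x r) (M + 1))) [] l := by
  rw [window_eq_splitSum φ ha hl, sub_eq_iff_eq_add, ← mul_add, ← splitSum_add]
  congr 1
  refine splitSum_congr fun p x r _ => ?_
  simp only [truncBt, mul_sum, sum_mul]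
  rw [← sum_add_distrib]
  refine sum_congr rfl fun c _ => ?_
  rw [sub_neg_eq_add]
  ring

theorem constantCoeff_serLetter_tInt {φ : ℝ} (hφ : e φ = 1) {a : MvPowerSeries σ ℂ}
    (ha : constantCoeff a = 0) (k : ℤ) : constantCoeff (serLetter tInt (φ, a) k) = (tInt k)⁻¹ := by
  simp [serLetter, e_mul_int hφ, constantCoeff_inv, ha]

theorem constantCoeff_truncBt {φ : ℝ} (hφ : e φ = 1) {a : MvPowerSeries σ ℂ}
    (ha : constantCoeff a = 0) (M : ℕ) : constantCoeff (truncBt φ a M) = 0 := by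
  simp only [truncBt, map_sum, constantCoeff_serLetter_tInt hφ ha]
  rw [sum_Ioo_neg_eq, ← sum_add_distrib]
  refine sum_eq_zero fun k _ => ?_
  have : tInt (1 - k) = -tInt k := by
    unfold tInt
    push_cast
    ring
  rw [this, inv_neg, add_neg_cancel]

theorem constantCoeff_window {φ : ι → ℝ} {a : ι → MvPowerSeries σ ℂ}
    (ha : ∀ i, constantCoeff (a i) = 0) {l : List ι} (hφ : ∀ i ∈ l, e (φ i) = 1) (M : ℕ) :
    constantCoeff (window φ a l (-M) (M + 1))
      = (∏ j ∈ range M, (1 + Polynomial.C (-(1 / (2 * (j : ℂ) + 1) ^ 2)) * Polynomial.X ^ 2)).coeff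
        l.length := by
  rw [← prod_window_eq]
  have h := nest_const_eq_coeff (fun k => (tInt k)⁻¹) l (-(M : ℤ)) (2 * M)
  have hM : (-(M : ℤ) + 1 + ((2 * M : ℕ) : ℤ)) = M + 1 := by
    push_cast
    ring
  rw [hM] at h
  rw [← h, window, nest_map, map_nest]
  exact nest_congr fun i hi k _ _ => constantCoeff_serLetter_tInt (hφ i hi) (ha i) k

theorem e_sum_eq_one {φ : ι → ℝ} {l : List ι} (hφ : ∀ i ∈ l, e (φ i) = 1) :
    e (l.map φ).sum = 1 := by
  rw [e_list_sum, List.map_map]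
  exact List.prod_eq_one fun x hx => by
    obtain ⟨i, hi, rfl⟩ := List.mem_map.1 hx
    exact hφ i hi

open Classical in
/-- The decoupling errors tend to the right side of the symmetry identity. The constant coefficient for
integral phases is that of the window, since the Bernoulli factor vanishes there. -/
theorem tendsto_coeff_window_sub (φ : ι → ℝ) {a : ι → MvPowerSeries σ ℂ}
    (ha : ∀ i, constantCoeff (a i) = 0) {l : List ι} (hl : l ≠ []) (n : σ →₀ ℕ) :
    Tendsto (fun M : ℕ => coeff n (window φ a l (-M) (M + 1)
      - C ((1 / 2) ^ (l.length - 1)) * splitSum (fun p x r =>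
        (-1) ^ p.length * (truncLi (leftArgs φ a x p) (M + 1) * truncBt (l.map φ).sum (a x) M
          * truncLi (rightArgs φ a x r) (M + 1))) [] l)) atTop
      (𝓝 (coeff n (if (∀ i ∈ l, e (φ i) = 1) ∧ Even l.length then
        C (1 / (l.length.factorial : ℂ) * (Complex.I * Real.pi / 2) ^ l.length) else 0))) := by
  by_cases hn : n ≠ 0 ∨ ∃ i ∈ l, e (φ i) ≠ 1
  · have h0 : coeff n (if (∀ i ∈ l, e (φ i) = 1) ∧ Even l.length then
        C (1 / (l.length.factorial : ℂ) * (Complex.I * Real.pi / 2) ^ l.length)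
        else (0 : MvPowerSeries σ ℂ)) = 0 := by
      split_ifs with h
      · rcases hn with hn | ⟨i, hi, hi'⟩
        · rw [coeff_C, if_neg hn]
        · exact absurd (h.1 i hi) hi'
      · simp
    simp only [h0, window_sub_eq φ ha hl, coeff_C_mul]
    exact ((small_coeff_decoupling ha hn).const_mul _).tendsto
  · push Not at hn
    obtain ⟨rfl, hφ⟩ := hn
    have h0 : coeff 0 (if (∀ i ∈ l, e (φ i) = 1) ∧ Even l.length then
        C (1 / (l.length.factorial : ℂ) * (Complex.I * Real.pi / 2) ^ l.length)
        else (0 : MvPowerSeries σ ℂ)) = if Even l.length then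
        1 / (l.length.factorial : ℂ) * (Complex.I * Real.pi / 2) ^ l.length else 0 := by
      by_cases he : Even l.length
      · rw [if_pos ⟨hφ, he⟩, if_pos he, coeff_zero_C]
      · rw [if_neg fun h => he h.2, if_neg he, map_zero]
    rw [h0]
    convert tendsto_coeff_prod_window l.length using 2 with M
    have h1 : ∀ p x r, constantCoeff ((-1) ^ p.length * (truncLi (leftArgs φ a x p) (M + 1)
        * truncBt (l.map φ).sum (a x) M * truncLi (rightArgs φ a x r) (M + 1))) = 0 :=
      fun p x r => by
        rw [map_mul, map_mul, map_mul, constantCoeff_truncBt (e_sum_eq_one hφ) (ha x)]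
        ring
    have h2 : constantCoeff (splitSum (fun p x r =>
        (-1) ^ p.length * (truncLi (leftArgs φ a x p) (M + 1) * truncBt (l.map φ).sum (a x) M
          * truncLi (rightArgs φ a x r) (M + 1))) [] l) = 0 := by
      have h3 := map_splitSum (constantCoeff (σ := σ) (R := ℂ)).toAddMonoidHom (fun p x r =>
        (-1) ^ p.length * (truncLi (leftArgs φ a x p) (M + 1) * truncBt (l.map φ).sum (a x) M
          * truncLi (rightArgs φ a x r) (M + 1))) [] l
      refine h3.trans ((splitSum_congr fun p x r _ => h1 p x r).trans ?_)
      simpa using (mul_splitSum (0 : ℂ) (fun _ _ _ => (0 : ℂ)) [] l).symm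
    rw [coeff_zero_eq_constantCoeff_apply, map_sub, map_mul, h2, mul_zero, sub_zero,
      constantCoeff_window ha hφ]

open Classical in
/-- The symmetry identity for the places of a list. -/
theorem symmetry_list (φ : ι → ℝ) {a : ι → MvPowerSeries σ ℂ}
    (ha : ∀ i, constantCoeff (a i) = 0) {l : List ι} (hl : l ≠ []) :
    ∑ j ∈ range (l.length + 1), (-1) ^ j * C (e ((l.take j).map φ).sum)
        * Lit (Real.log 2) ((l.drop j).map fun i => (φ i, a i))
        * Lit (Real.log 2) ((l.take j).reverse.map fun i => (-φ i, -a i))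
      - C ((1 / 2) ^ (l.length - 1)) * splitSum (fun p x r =>
        (-1) ^ p.length * (Li 0 (leftArgs φ a x p) * Bt (Real.log 2) (l.map φ).sum (a x)
          * Li 0 (rightArgs φ a x r))) [] l
      = if (∀ i ∈ l, e (φ i) = 1) ∧ Even l.length then
        C (1 / (l.length.factorial : ℂ) * (Complex.I * Real.pi / 2) ^ l.length) else 0 := by
  refine Regularizes.eq_of_tendsto (Regularizes.sub (Regularizes.sum _ fun j _ =>
    ((regularizes_const _).mul (regularizes_nest_tInt ?_)).mul (regularizes_nest_tInt ?_))
    ((regularizes_const _).mul (Regularizes.splitSum (fun p x r => (regularizes_const _).mul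
      (((regularizes_truncLi (constantCoeff_of_mem_leftArgs ha)).mul
        (regularizes_truncBt _ (ha x))).mul
        (regularizes_truncLi (constantCoeff_of_mem_rightArgs ha)))) [] l)))
    fun n => ?_
  · intro y hy
    obtain ⟨i, -, rfl⟩ := List.mem_map.1 hy
    exact ha i
  · intro y hy
    obtain ⟨i, -, rfl⟩ := List.mem_map.1 hy
    simp [ha i]
  · simp only [← window_eq_sum]
    exact tendsto_coeff_window_sub φ ha hl n

end Symmetry

/-! ### Sums over the finite index type -/

theorem e_eq_one_iff (x : ℝ) : e x = 1 ↔ ∃ n : ℤ, x = n := by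
  have hpi : (2 * Real.pi * Complex.I : ℂ) ≠ 0 := Complex.two_pi_I_ne_zero
  rw [e, Complex.exp_eq_one_iff]
  refine exists_congr fun n => ?_
  rw [mul_comm (n : ℂ), mul_right_inj' hpi]
  exact_mod_cast Iff.rfl

theorem splitSum_eq_sum {ι V : Type*} [AddCommMonoid V] (F : List ι → ι → List ι → V)
    (pre l : List ι) :
    splitSum F pre l = ∑ j : Fin l.length,
      F ((l.take j).reverse ++ pre) (l.get j) (l.drop (j + 1)) := by
  induction l generalizing pre with
  | nil => simp [splitSum]
  | cons y l ih =>
    rw [splitSum, ih]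
    simp only [List.length_cons]
    rw [Fin.sum_univ_succ]
    simp

theorem splitSum_finRange {m : ℕ} {V : Type*} [AddCommMonoid V]
    (F : List (Fin m) → Fin m → List (Fin m) → V) :
    splitSum F [] (List.finRange m) = ∑ j : Fin m, F (firstRev m j) j (lastPart m (j + 1)) := by
  rw [splitSum_eq_sum]
  refine Fintype.sum_equiv (finCongr List.length_finRange) _ _ fun j => ?_
  simp [firstRev, lastPart]

theorem sum_take_finRange {m : ℕ} (φ : Fin m → ℝ) (j : ℕ) :
    (((List.finRange m).take j).map φ).sum = ∑ i : Fin m with i.val < j, φ i := by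
  induction m generalizing j with
  | zero => simp
  | succ m ih =>
    cases j with
    | zero => simp
    | succ j =>
      have := ih (fun i => φ i.succ) j
      rw [sum_filter] at this ⊢
      rw [List.finRange_succ, List.take_succ_cons, List.map_cons, List.sum_cons, Fin.sum_univ_succ,
        ← List.map_take, List.map_map]
      simpa [Function.comp_def] using this

end MultipleT

open MultipleT MvPowerSeries in
/-- The nested series attached to all convergent words converge, and the symmetry identity holds
between formal power series in `X 0, …, X (m - 1)`, for every depth `m` and all real phases.
The second sum, over `j = 1, …, m` in the usual numbering, is indexed by `Fin m`, which starts
at `0`. -/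
theorem theorem2 (m : ℕ) (φ : Fin m → ℝ) :
    (∀ w : List Letter, IsConvergentWord w →
      (∃ l : ℂ, Filter.Tendsto (fun M : ℕ => truncSum zetaDenom w 0 M) Filter.atTop (nhds l)) ∧
      (∃ l : ℂ, Filter.Tendsto (fun M : ℕ => truncSum tDenom w 0 M) Filter.atTop (nhds l))) ∧
    ((∑ j ∈ Finset.range (m + 1),
        (-1 : MvPowerSeries (Fin m) ℂ) ^ j * C (e (∑ i : Fin m with i.val < j, φ i))
          * Lit (Real.log 2) ((lastPart m j).map fun i => (φ i, X i))
          * Lit (Real.log 2) ((firstRev m j).map fun i => (-φ i, -X i)))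
      - C (1 / (2 : ℂ) ^ ((m : ℤ) - 1)) * ∑ j : Fin m,
          (-1 : MvPowerSeries (Fin m) ℂ) ^ j.val
            * Li 0 ((firstRev m j.val).map fun i => (-φ i, C (1 / 2) * (X j - X i)))
            * Bt (Real.log 2) (∑ i, φ i) (X j)
            * Li 0 ((lastPart m (j.val + 1)).map fun i => (φ i, C (1 / 2) * (X i - X j)))
      = open Classical in
        if (∀ i, ∃ n : ℤ, φ i = n) ∧ Even m then
          C (1 / (m.factorial : ℂ) * (Complex.I * Real.pi / 2) ^ m)
        else 0) := by
  refine ⟨fun w hw => ⟨exists_tendsto_truncSum regularDenom_zeta hw,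
    exists_tendsto_truncSum regularDenom_t hw⟩, ?_⟩
  rcases Nat.eq_zero_or_pos m with rfl | hm
  · simp [lastPart, firstRev, Lit, genSeriesAt_nil, e_zero]
  have hl : List.finRange m ≠ [] := by
    simpa using hm.ne'
  have h := symmetry_list φ (a := fun i => (X i : MvPowerSeries (Fin m) ℂ)) (by simp) hl
  rw [splitSum_finRange, List.length_finRange] at h
  have hpow : (1 / (2 : ℂ) ^ ((m : ℤ) - 1)) = (1 / 2) ^ (m - 1) := by
    rw [one_div_pow, ← zpow_natCast, Nat.cast_sub hm, Nat.cast_one]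
  have hlen : ∀ j : Fin m, (firstRev m j).length = j := fun j => by
    simp [firstRev, j.isLt.le]
  have hsum : ((List.finRange m).map φ).sum = ∑ i, φ i := by
    rw [← List.ofFn_eq_map, List.sum_ofFn]
  have hint : (∀ i ∈ List.finRange m, e (φ i) = 1) ↔ ∀ i, ∃ n : ℤ, φ i = n := by
    simp [e_eq_one_iff]
  simp only [sum_take_finRange, hlen, hsum] at h
  rw [hpow]
  refine Eq.trans ?_ (h.trans ?_)
  swap
  · split_ifs with h1 h2 h2
    · rfl
    · exact absurd ⟨hint.1 h1.1, h1.2⟩ h2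
    · exact absurd ⟨hint.2 h2.1, h2.2⟩ h1
    · rfl
  congr 2
  refine Finset.sum_congr rfl fun j _ => ?_
  simp only [leftArgs, rightArgs]
  ring
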